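/- Let $N=\mathbf Z^d$ with dual lattice $M=\mathbf Z^d$, and let $\rho\subset N_{\mathbf R}$ be a rational strictly convex polyhedral cone of dimension $d$, with dual cone $\rho^\vee\subset M_{\mathbf R}$; write $u\le_\rho u'$ if $u'-u\in\rho^\vee$. For a lattice $L\subset M_{\mathbf Q}$ let $\mathbf C\{\rho^\vee\cap L\}$ be the ring of convergent power series $\sum c_uX^u$ with exponents $u\in\rho^\vee\cap L$. A polynomial in $\mathbf C\{\rho^\vee\cap M\}[Y]$ with invertible leading coefficient is quasi-ordinary if its discriminant is of the form $X^\delta H$ with $\delta\in\rho^\vee\cap M$, $H\in\mathbf C\{\rho^\vee\cap M\}$ and $H$ has non-zero constant term. Let $f\in\mathbf C\{\rho^\vee\cap M\}[Y]$ be a monic irreducible quasi-ordinary polynomial of degree $n$ whose non-leading coefficients have zero constant terms, let $\zeta\in\mathbf C\{\rho^\vee\cap\frac1nM\}$ be a root of $f$, and let $R=\mathbf C\{\rho^\vee\cap M\}[\zeta]$. Let $\lambda_1<_\rho\dots<_\rho\lambda_g$, with $g\ge1$, be the characteristic exponents of $f$, i.e. the exponents $\lambda$ such that the difference of two distinct roots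 of $f$ has the form $X^{\lambda}\cdot\text{unit}$. Put $M_0=M$, $M_i=M_{i-1}+\mathbf Z\lambda_i$, $n_0=1$, $n_i=\#(M_i/M_{i-1})$, $\gamma_1=\lambda_1$, $\gamma_{j+1}=n_j\gamma_j+\lambda_{j+1}-\lambda_j$, and $\Gamma=\rho^\vee\cap M+\mathbf Z_{\ge0}\gamma_1+\dots+\mathbf Z_{\ge0}\gamma_g$. For $j=0,\dots,g-1$ let $q_j$ be a $j$-th semi-root of $f$, i.e. an irreducible quasi-ordinary polynomial of degree $n_0n_1\cdots n_j$ such that $fq_j$ is quasi-ordinary and $\lambda_{j+1}$ is the largest exponent $\lambda$ for which the difference of a root of $f$ and a root of $q_j$ is of the form $X^\lambda\cdot\text{unit}$; assume that $q_j$ is normalized so that the coefficient of $X^{\gamma_{j+1}}$ in $q_j(\zeta)$ is $1$. Let $\Psi_0:\mathbf C\{\rho^\vee\cap M\}[U_1,\dots,U_g]\to R$ be the homomorphism of $\mathbf C\{\rho^\vee\cap M\}$-algebras with $U_j\mapsto q_{j-1}(\zeta)$. Let $\eta$ be in the interior of $\rho$. For $j\in\eta(\rho^\vee\cap M_g)$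 filter $\mathbf C\{\rho^\vee\cap M_g\}$ by the ideals of series all of whose exponents $u$ satisfy $\langle\eta,u\rangle\ge j$, give $R$ the induced filtration, and filter $\mathbf C\{\rho^\vee\cap M\}[U_1,\dots,U_g]$ by the ideals of elements all of whose terms $X^\alpha U^v$ satisfy $\langle\eta,\alpha+\sum v_i\gamma_i\rangle\ge j$. Then $R\subset\mathbf C\{\rho^\vee\cap M_g\}$, $\Gamma\subset\rho^\vee\cap M_g$, the homomorphisms $$\mathbf C\{\rho^\vee\cap M\}[U_1,\dots,U_g]\xrightarrow{\ \Psi_0\ }R\hookrightarrow\mathbf C\{\rho^\vee\cap M_g\}$$ are filtered, and the associated sequence of homomorphisms of graded $\mathbf C$-algebras is isomorphic, as a sequence of graded $\mathbf C$-algebras, to $$\mathbf C[\rho^\vee\cap M][U_1,\dots,U_g]\longrightarrow\mathbf C[\Gamma]\hookrightarrow\mathbf C[\rho^\vee\cap M_g],$$ where the first homomorphism maps $X^\alpha U^v\mapsto X^{\alpha+\sum v_i\gamma_i}$, the second is the inclusion, and the gradings are defined by $\eta$: $\deg X^u=\langle\eta,u\rangle$ and $\deg X^\alpha U^v=\langle\eta,\alpha+\sum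 v_i\gamma_i\rangle$. If moreover $\eta$ is irrational (its coordinates are linearly independent over $\mathbf Q$), then $\Gamma$ is determined by the grading: $u\mapsto\langle\eta,u\rangle$ is injective on $\rho^\vee\cap M_g$, each homogeneous component of $\operatorname{gr}\mathbf C\{\rho^\vee\cap M_g\}$, of degree in $\eta(\rho^\vee\cap M_g)$, has dimension one, each homogeneous component of $\operatorname{gr}R$ has dimension zero or one, an element $u\in\rho^\vee\cap M_g$ lies in $\Gamma$ if and only if the component of $\operatorname{gr}R$ of degree $\langle\eta,u\rangle$ is non-zero, and $\eta$ induces an isomorphism of $\Gamma$ onto the semigroup of the degrees of the non-zero components of $\operatorname{gr}R$. -/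

import Mathlib

open scoped DirectSum

noncomputable section

namespace ToricQO

/-! ### Filtered algebras and their associated graded algebras -/

section Filtration

set_option linter.unusedSectionVars false

/-- A decreasing multiplicative filtration of a commutative `ℂ`-algebra `B`, indexed by an ordered
commutative monoid `ι`. -/
structure Filt (ι : Type) [AddCommMonoid ι] [PartialOrder ι] (B : Type) [CommRing B]
    [Algebra ℂ B] where
  /-- the terms of the filtration -/
  F : ι → Submodule ℂ B
  anti : Antitone F
  one_mem : (1 : B) ∈ F 0
  mul_mem : ∀ {i j : ι} {x y : B}, x ∈ F i → y ∈ F j → x * y ∈ F (i + j)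

variable {ι : Type} [AddCommMonoid ι] [PartialOrder ι] [IsOrderedCancelAddMonoid ι]
  {B : Type} [CommRing B] [Algebra ℂ B] {B' : Type} [CommRing B'] [Algebra ℂ B']

namespace Filt

/-- The filtration induced by an algebra homomorphism (for an injective one: by a subalgebra). -/
def comap (F : Filt ι B') (φ : B →ₐ[ℂ] B') : Filt ι B where
  F i := (F.F i).comap φ.toLinearMap
  anti _ _ h := Submodule.comap_mono (F.anti h)
  one_mem := by simpa using F.one_mem
  mul_mem hx hy := by simpa using F.mul_mem hx hy

/-- The union (sum) of the terms of the filtration of index strictly larger than `i`; when `i` has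
an immediate successor `i⁺` this is the term of index `i⁺`. -/
def above (F : Filt ι B) (i : ι) : Submodule ℂ B := ⨆ (j : ι) (_ : i < j), F.F j

theorem mul_above (F : Filt ι B) {i j : ι} {x y : B} (hx : x ∈ F.F i) (hy : y ∈ F.above j) :
    x * y ∈ F.above (i + j) := by
  have : F.above j ≤ (F.above (i + j)).comap (LinearMap.mulLeft ℂ x) := by
    refine iSup₂_le fun k hk z hz => ?_
    exact (le_iSup₂_of_le (f := fun (l : ι) (_ : i + j < l) => F.F l) (i + k)
      (by gcongr) le_rfl) (F.mul_mem hx hz)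
  exact this hy

/-- The homogeneous component of degree `i` of the associated graded algebra. -/
def Piece (F : Filt ι B) (i : ι) : Type := F.F i ⧸ (F.above i).comap (F.F i).subtype

instance (F : Filt ι B) (i : ι) : AddCommGroup (F.Piece i) :=
  inferInstanceAs (AddCommGroup (F.F i ⧸ (F.above i).comap (F.F i).subtype))

instance (F : Filt ι B) (i : ι) : Module ℂ (F.Piece i) :=
  inferInstanceAs (Module ℂ (F.F i ⧸ (F.above i).comap (F.F i).subtype))

/-- The class in degree `i` of an element of the `i`-th term of the filtration. -/
def cls (F : Filt ι B) (i : ι) : F.F i →ₗ[ℂ] F.Piece i :=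
  ((F.above i).comap (F.F i).subtype).mkQ

theorem cls_surjective (F : Filt ι B) (i : ι) : Function.Surjective (F.cls i) :=
  Submodule.mkQ_surjective _

theorem cls_eq_zero (F : Filt ι B) {i : ι} {x : F.F i} : F.cls i x = 0 ↔ (x : B) ∈ F.above i :=
  Submodule.Quotient.mk_eq_zero _

/-- Multiplication of representatives, as a bilinear map. -/
def preMul (F : Filt ι B) (i j : ι) : F.F i →ₗ[ℂ] F.F j →ₗ[ℂ] F.F (i + j) :=
  LinearMap.mk₂ ℂ (fun x y => ⟨x.1 * y.1, F.mul_mem x.2 y.2⟩)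
    (fun _ _ _ => Subtype.ext (add_mul _ _ _))
    (fun _ _ _ => Subtype.ext (smul_mul_assoc _ _ _))
    (fun _ _ _ => Subtype.ext (mul_add _ _ _))
    (fun _ _ _ => Subtype.ext (mul_smul_comm _ _ _))

/-- Multiplication of homogeneous elements of the associated graded algebra. -/
def pieceMul (F : Filt ι B) (i j : ι) : F.Piece i →ₗ[ℂ] F.Piece j →ₗ[ℂ] F.Piece (i + j) :=
  Submodule.liftQ _
    (LinearMap.flip (Submodule.liftQ _ (LinearMap.flip ((F.preMul i j).compr₂ (F.cls (i + j))))
      (by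
        intro y hy
        ext x
        exact F.cls_eq_zero.2 (F.mul_above x.2 hy))))
    (by
      intro x hx
      refine LinearMap.ext fun y => ?_
      obtain ⟨y, rfl⟩ := F.cls_surjective j y
      refine F.cls_eq_zero.2 ?_
      have := F.mul_above y.2 hx
      rw [mul_comm, add_comm] at this
      exact this)

theorem pieceMul_cls (F : Filt ι B) {i j : ι} (x : F.F i) (y : F.F j) :
    F.pieceMul i j (F.cls i x) (F.cls j y) =
      F.cls (i + j) ⟨x.1 * y.1, F.mul_mem x.2 y.2⟩ := rfl

theorem mk_cls_eq (F : Filt ι B) {i j : ι} (h : i = j) {x : F.F i} {y : F.F j}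
    (hxy : (x : B) = y) :
    GradedMonoid.mk (A := F.Piece) i (F.cls i x) = GradedMonoid.mk j (F.cls j y) := by
  subst h
  obtain rfl : x = y := Subtype.ext hxy
  rfl

instance (F : Filt ι B) : GradedMonoid.GMul F.Piece := ⟨fun {i j} x y => F.pieceMul i j x y⟩

instance (F : Filt ι B) : GradedMonoid.GOne F.Piece := ⟨F.cls 0 ⟨1, F.one_mem⟩⟩

theorem mk_mul_cls (F : Filt ι B) {i j : ι} (x : F.F i) (y : F.F j) :
    GradedMonoid.mk (A := F.Piece) i (F.cls i x) * GradedMonoid.mk j (F.cls j y) =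
      GradedMonoid.mk (i + j) (F.cls (i + j) ⟨x.1 * y.1, F.mul_mem x.2 y.2⟩) := rfl

theorem one_mk (F : Filt ι B) :
    (1 : GradedMonoid F.Piece) = GradedMonoid.mk 0 (F.cls 0 ⟨1, F.one_mem⟩) := rfl

theorem exists_rep (F : Filt ι B) (a : GradedMonoid F.Piece) :
    ∃ (i : ι) (x : F.F i), a = GradedMonoid.mk i (F.cls i x) := by
  obtain ⟨i, a⟩ := a
  obtain ⟨x, rfl⟩ := F.cls_surjective i a
  exact ⟨i, x, rfl⟩

instance (F : Filt ι B) : DirectSum.GCommRing F.Piece where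
  mul_zero {i j} a := map_zero (F.pieceMul i j a)
  zero_mul {i j} b := LinearMap.map_zero₂ (F.pieceMul i j) b
  mul_add {i j} a b c := map_add (F.pieceMul i j a) b c
  add_mul {i j} a b c := LinearMap.map_add₂ (F.pieceMul i j) a b c
  one_mul a := by
    obtain ⟨i, x, rfl⟩ := F.exists_rep a
    rw [one_mk, mk_mul_cls]
    exact F.mk_cls_eq (zero_add _) (one_mul _)
  mul_one a := by
    obtain ⟨i, x, rfl⟩ := F.exists_rep a
    rw [one_mk, mk_mul_cls]
    exact F.mk_cls_eq (add_zero _) (mul_one _)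
  mul_assoc a b c := by
    obtain ⟨i, x, rfl⟩ := F.exists_rep a
    obtain ⟨j, y, rfl⟩ := F.exists_rep b
    obtain ⟨k, z, rfl⟩ := F.exists_rep c
    simp only [mk_mul_cls]
    exact F.mk_cls_eq (add_assoc _ _ _) (mul_assoc _ _ _)
  mul_comm a b := by
    obtain ⟨i, x, rfl⟩ := F.exists_rep a
    obtain ⟨j, y, rfl⟩ := F.exists_rep b
    simp only [mk_mul_cls]
    exact F.mk_cls_eq (add_comm _ _) (mul_comm _ _)
  natCast n := n • F.cls 0 ⟨1, F.one_mem⟩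
  natCast_zero := zero_smul _ _
  natCast_succ n := succ_nsmul _ n
  intCast n := n • F.cls 0 ⟨1, F.one_mem⟩
  intCast_ofNat n := natCast_zsmul _ n
  intCast_negSucc_ofNat n := negSucc_zsmul _ n

instance (F : Filt ι B) : DirectSum.GAlgebra ℂ F.Piece where
  toFun := ((LinearMap.toSpanSingleton ℂ (F.Piece 0) (F.cls 0 ⟨1, F.one_mem⟩)).toAddMonoidHom)
  map_one := one_smul ℂ (F.cls 0 ⟨1, F.one_mem⟩)
  map_mul r s := by
    change GradedMonoid.mk (A := F.Piece) 0 ((r * s) • F.cls 0 ⟨1, F.one_mem⟩) =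
      GradedMonoid.mk 0 (r • F.cls 0 ⟨1, F.one_mem⟩) *
        GradedMonoid.mk 0 (s • F.cls 0 ⟨1, F.one_mem⟩)
    rw [← map_smul, ← map_smul, ← map_smul, mk_mul_cls]
    exact F.mk_cls_eq (zero_add _).symm (by simp [smul_smul, mul_comm])
  commutes r a := by
    obtain ⟨i, x, rfl⟩ := F.exists_rep a
    change GradedMonoid.mk (A := F.Piece) 0 (r • F.cls 0 ⟨1, F.one_mem⟩) *
      GradedMonoid.mk i (F.cls i x) = GradedMonoid.mk i (F.cls i x) *
        GradedMonoid.mk 0 (r • F.cls 0 ⟨1, F.one_mem⟩)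
    rw [← map_smul, mk_mul_cls, mk_mul_cls]
    exact F.mk_cls_eq (add_comm _ _) (mul_comm _ _)
  smul_def r a := by
    obtain ⟨i, x, rfl⟩ := F.exists_rep a
    change GradedMonoid.mk (A := F.Piece) i (r • F.cls i x) =
      GradedMonoid.mk 0 (r • F.cls 0 ⟨1, F.one_mem⟩) * GradedMonoid.mk i (F.cls i x)
    rw [← map_smul, ← map_smul, mk_mul_cls]
    exact F.mk_cls_eq (zero_add _).symm (by simp)

/-- The associated graded algebra `⨁ i, F i / (⨆ j > i, F j)`. -/
abbrev Gr (F : Filt ι B) : Type := ⨁ i, F.Piece i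

/-- An algebra homomorphism between filtered algebras is filtered if it respects the terms of the
filtrations. -/
def IsFiltered (F : Filt ι B) (G : Filt ι B') (φ : B →ₐ[ℂ] B') : Prop :=
  ∀ i, ∀ x ∈ F.F i, φ x ∈ G.F i

/-- The homogeneous component of degree `i` of the map of graded algebras associated to a filtered
homomorphism. -/
def pieceMap (F : Filt ι B) (G : Filt ι B') (φ : B →ₐ[ℂ] B') (h : IsFiltered F G φ) (i : ι) :
    F.Piece i →ₗ[ℂ] G.Piece i :=
  Submodule.mapQ _ _ (φ.toLinearMap.restrict (h i)) (by
    intro x hx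
    have : F.above i ≤ (G.above i).comap φ.toLinearMap :=
      iSup₂_le fun j hj z hz =>
        (le_iSup₂_of_le (f := fun (l : ι) (_ : i < l) => G.F l) j hj le_rfl) (h j z hz)
    exact this hx)

/-- The homomorphism of associated graded algebras defined by a filtered homomorphism. -/
def grMap [DecidableEq ι] (F : Filt ι B) (G : Filt ι B') (φ : B →ₐ[ℂ] B')
    (h : IsFiltered F G φ) : F.Gr →ₐ[ℂ] G.Gr :=
  DirectSum.toAlgebra ℂ F.Piece
    (fun i => (DirectSum.lof ℂ ι G.Piece i).comp (pieceMap F G φ h i))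
    (by
      change DirectSum.of G.Piece 0 (G.cls 0 ⟨φ 1, _⟩) = DirectSum.of G.Piece 0 (G.cls 0 ⟨1, _⟩)
      congr 3
      exact map_one φ)
    (by
      intro i j x y
      obtain ⟨x, rfl⟩ := F.cls_surjective i x
      obtain ⟨y, rfl⟩ := F.cls_surjective j y
      change DirectSum.of G.Piece (i + j) (G.cls (i + j) ⟨φ (x.1 * y.1), _⟩) =
        DirectSum.of G.Piece i (G.cls i ⟨φ x.1, _⟩) * DirectSum.of G.Piece j (G.cls j ⟨φ y.1, _⟩)
      rw [DirectSum.of_mul_of]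
      change _ = DirectSum.of G.Piece (i + j) (G.cls (i + j) ⟨φ x.1 * φ y.1, _⟩)
      congr 3
      exact map_mul φ _ _)

/-- An algebra isomorphism from the associated graded algebra to an algebra `C` with homogeneous
components `𝒞 i` is graded if it maps each homogeneous component onto the one of the same degree. -/
def IsGradedEquiv [DecidableEq ι] (F : Filt ι B) {C : Type} [CommRing C] [Algebra ℂ C]
    (𝒞 : ι → Submodule ℂ C) (e : F.Gr ≃ₐ[ℂ] C) : Prop :=
  ∀ i, (LinearMap.range (DirectSum.lof ℂ ι F.Piece i)).map e.toLinearMap = 𝒞 i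

end Filt

end Filtration

/-! ### Toric cones, exponents and convergent series -/

/-- A rational strictly convex polyhedral cone `ρ` of maximal dimension in `N_ℝ`, where
`N = ℤ^d`. -/
structure ToricCone (d : ℕ) where
  /-- the cone `ρ ⊂ N_ℝ = ℝ^d` -/
  cone : PointedCone ℝ (Fin d → ℝ)
  /-- it is generated by finitely many vectors of `N = ℤ^d` -/
  rational : ∃ s : Finset (Fin d → ℤ),
    cone = PointedCone.hull ℝ ((fun (v : Fin d → ℤ) (i : Fin d) => (v i : ℝ)) '' (s : Set _))
  /-- it contains no line -/
  strictly_convex : cone.toConvexCone.Salient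
  /-- it spans `N_ℝ` (equivalently, the dual cone `ρ^∨` is strictly convex) -/
  full_dim : Submodule.span ℝ (cone : Set (Fin d → ℝ)) = ⊤

namespace ToricCone

variable {d : ℕ}

/-- The space `M_ℝ = ℝ^d` of exponents, where `M = ℤ^d` is the lattice dual to `N`; it is ordered
by `u ≤ u'` iff `u' - u ∈ ρ^∨`. -/
def Expo (_ρ : ToricCone d) : Type := Fin d → ℝ

variable (ρ : ToricCone d)

instance : AddCommGroup ρ.Expo := inferInstanceAs (AddCommGroup (Fin d → ℝ))

/-- The duality pairing `⟨w, u⟩` of `w ∈ N_ℝ` and `u ∈ M_ℝ`. -/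
def pair (w : Fin d → ℝ) : ρ.Expo →+ ℝ where
  toFun u := ∑ i, w i * (show Fin d → ℝ from u) i
  map_zero' := Finset.sum_eq_zero fun i _ => mul_zero (w i)
  map_add' u v := by
    rw [← Finset.sum_add_distrib]
    exact Finset.sum_congr rfl fun i _ => mul_add (w i) _ _

theorem pair_add_left (w w' : Fin d → ℝ) (u : ρ.Expo) :
    ρ.pair (w + w') u = ρ.pair w u + ρ.pair w' u := by
  change ∑ i, (w i + w' i) * (show Fin d → ℝ from u) i = _
  simp only [add_mul, Finset.sum_add_distrib]
  rfl

/-- The dual cone `ρ^∨ ⊂ M_ℝ`. -/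
def dualCone : AddSubmonoid ρ.Expo where
  carrier := {u | ∀ w ∈ ρ.cone, 0 ≤ ρ.pair w u}
  zero_mem' w _ := by simp
  add_mem' hu hv w hw := by rw [map_add]; exact add_nonneg (hu w hw) (hv w hw)

theorem eq_zero_of_pair {u : ρ.Expo} (h : ∀ w ∈ ρ.cone, ρ.pair w u = 0) : u = 0 := by
  have h2 : ∀ w : Fin d → ℝ, ρ.pair w u = 0 := by
    intro w
    have hw : w ∈ Submodule.span ℝ (ρ.cone : Set (Fin d → ℝ)) := by
      rw [ρ.full_dim]; trivial
    induction hw using Submodule.span_induction with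
    | mem x hx => exact h x hx
    | zero =>
      change ∑ i, (0 : ℝ) * (show Fin d → ℝ from u) i = 0
      simp
    | add x y _ _ hx hy => rw [pair_add_left, hx, hy, add_zero]
    | smul a x _ hx =>
      change ∑ i, (a * x i) * (show Fin d → ℝ from u) i = 0
      simp only [mul_assoc]
      rw [← Finset.mul_sum]
      exact mul_eq_zero_of_right a hx
  have h3 : ∑ i, (show Fin d → ℝ from u) i * (show Fin d → ℝ from u) i = 0 := h2 u
  funext i
  exact mul_self_eq_zero.1
    ((Finset.sum_eq_zero_iff_of_nonneg fun i _ => mul_self_nonneg _).1 h3 i (Finset.mem_univ i))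

instance : PartialOrder ρ.Expo where
  le u u' := u' - u ∈ ρ.dualCone
  le_refl u := by rw [sub_self]; exact zero_mem _
  le_trans u v w huv hvw := by
    have := add_mem hvw huv
    rwa [sub_add_sub_cancel] at this
  le_antisymm u v huv hvu := by
    refine (sub_eq_zero.1 (ρ.eq_zero_of_pair fun w hw => ?_)).symm
    refine le_antisymm ?_ (huv w hw)
    have := hvu w hw
    rw [← neg_sub, map_neg] at this
    linarith

theorem le_def {u v : ρ.Expo} : u ≤ v ↔ v - u ∈ ρ.dualCone := Iff.rfl

instance : IsOrderedAddMonoid ρ.Expo where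
  add_le_add_left u v h w := by
    rw [le_def] at h ⊢
    rwa [add_sub_add_right_eq_sub]

instance : AddCommMonoid ρ.Expo := AddCommGroup.toAddCommMonoid

instance : IsOrderedCancelAddMonoid ρ.Expo := IsOrderedAddMonoid.toIsOrderedCancelAddMonoid

/-- The lattice `M = ℤ^d`. -/
def M : AddSubgroup ρ.Expo :=
  AddMonoidHom.range (G := Fin d → ℤ) (N := ρ.Expo)
    { toFun := fun m => (fun i => (m i : ℝ) : Fin d → ℝ)
      map_zero' := funext fun _ => Int.cast_zero
      map_add' := fun m m' => funext fun i => Int.cast_add (m i) (m' i) }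

/-- The lattice `(1/k) M`, for `k ≥ 1`. -/
def fracM (k : ℕ) : AddSubgroup ρ.Expo := ρ.M.comap (nsmulAddMonoidHom k)

/-- The semigroup `ρ^∨ ∩ L` of a lattice `L`. -/
def semigroup (L : AddSubgroup ρ.Expo) : AddSubmonoid ρ.Expo := ρ.dualCone ⊓ L.toAddSubmonoid

/-- Series with exponents in `M_ℝ` whose supports are partially well ordered for `≤_ρ`. All formal
series with exponents in `ρ^∨ ∩ L`, for a lattice `L`, are of this kind. -/
abbrev Series : Type := HahnSeries ρ.Expo ℂ

/-- A series is absolutely convergent at some point of the torus with coordinates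
`|X^u| = exp (-⟨ξ, u⟩)`, `ξ ∈ ρ`. -/
def IsConvergent (φ : ρ.Series) : Prop :=
  ∃ ξ ∈ ρ.cone, Summable fun u : ρ.Expo => ‖φ.coeff u‖ * Real.exp (-ρ.pair ξ u)

theorem weaken {φ : ρ.Series} (hs : ∀ u ∈ φ.support, u ∈ ρ.dualCone) {ξ : Fin d → ℝ}
    (h : Summable fun u : ρ.Expo => ‖φ.coeff u‖ * Real.exp (-ρ.pair ξ u)) {ξ' : Fin d → ℝ}
    (hξ' : ξ' ∈ ρ.cone) :
    Summable fun u : ρ.Expo => ‖φ.coeff u‖ * Real.exp (-ρ.pair (ξ + ξ') u) := by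
  refine h.of_nonneg_of_le (fun u => by positivity) fun u => ?_
  by_cases hu : φ.coeff u = 0
  · simp [hu]
  · have := hs u hu ξ' hξ'
    gcongr
    rw [pair_add_left]
    linarith

theorem summable_mul {φ ψ : ρ.Series} {ξ : Fin d → ℝ}
    (h : Summable fun u : ρ.Expo => ‖φ.coeff u‖ * Real.exp (-ρ.pair ξ u))
    (h' : Summable fun u : ρ.Expo => ‖ψ.coeff u‖ * Real.exp (-ρ.pair ξ u)) :
    Summable fun u : ρ.Expo => ‖(φ * ψ).coeff u‖ * Real.exp (-ρ.pair ξ u) := by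
  classical
  have hp := h.mul_of_nonneg h' (fun u => by positivity) (fun u => by positivity)
  let e : ρ.Expo × ρ.Expo ≃ ρ.Expo × ρ.Expo :=
    { toFun := fun p => (p.2, p.1 - p.2)
      invFun := fun p => (p.1 + p.2, p.1)
      left_inv := fun p => by simp
      right_inv := fun p => by simp }
  have hq := (e.summable_iff).2 hp
  have hr := hq.prod
  refine hr.of_nonneg_of_le (fun u => by positivity) fun u => ?_
  have hf := hq.prod_factor u
  rw [HahnSeries.coeff_mul]
  calc ‖∑ ij ∈ Finset.antidiagonal φ.isPWO_support ψ.isPWO_support u,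
          φ.coeff ij.1 * ψ.coeff ij.2‖ * Real.exp (-ρ.pair ξ u)
      ≤ (∑ ij ∈ Finset.antidiagonal φ.isPWO_support ψ.isPWO_support u,
          ‖φ.coeff ij.1‖ * ‖ψ.coeff ij.2‖) * Real.exp (-ρ.pair ξ u) := by
        gcongr
        exact norm_sum_le_of_le _ fun ij _ => norm_mul_le _ _
    _ = ∑ ij ∈ Finset.antidiagonal φ.isPWO_support ψ.isPWO_support u,
          (fun v => ‖φ.coeff v‖ * Real.exp (-ρ.pair ξ v) *
            (‖ψ.coeff (u - v)‖ * Real.exp (-ρ.pair ξ (u - v)))) ij.1 := by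
        rw [Finset.sum_mul]
        refine Finset.sum_congr rfl fun ij hij => ?_
        obtain ⟨-, -, hij⟩ := Finset.mem_antidiagonal.1 hij
        subst hij
        simp only [add_sub_cancel_left, map_add, neg_add, Real.exp_add]
        ring
    _ = ∑ v ∈ (Finset.antidiagonal φ.isPWO_support ψ.isPWO_support u).image Prod.fst,
          ‖φ.coeff v‖ * Real.exp (-ρ.pair ξ v) *
            (‖ψ.coeff (u - v)‖ * Real.exp (-ρ.pair ξ (u - v))) := by
        rw [Finset.sum_image]
        intro a ha b hb hab
        have ha' := (Finset.mem_antidiagonal.1 ha).2.2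
        have hb' := (Finset.mem_antidiagonal.1 hb).2.2
        refine Prod.ext hab ?_
        rw [← hb', hab] at ha'
        exact add_left_cancel ha'
    _ ≤ _ := hf.sum_le_tsum _ fun v _ => by positivity

/-- The algebra `ℂ{ρ^∨ ∩ L}` of convergent series with exponents in `ρ^∨ ∩ L`: the analytic algebra
of the affine toric variety of the semigroup `ρ^∨ ∩ L` at its zero-dimensional orbit. -/
def conv (L : AddSubgroup ρ.Expo) : Subalgebra ℂ ρ.Series where
  carrier := {φ | (∀ u ∈ φ.support, u ∈ ρ.semigroup L) ∧ ρ.IsConvergent φ}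
  mul_mem' := by
    rintro φ ψ ⟨h1, ξ, hξ, h2⟩ ⟨h1', ξ', hξ', h2'⟩
    refine ⟨fun u hu => ?_, ξ + ξ', add_mem hξ hξ', ?_⟩
    · obtain ⟨a, ha, b, hb, rfl⟩ := HahnSeries.support_mul_subset hu
      exact add_mem (h1 a ha) (h1' b hb)
    · refine ρ.summable_mul (ρ.weaken (fun u hu => (h1 u hu).1) h2 hξ') ?_
      rw [add_comm ξ]
      exact ρ.weaken (fun u hu => (h1' u hu).1) h2' hξ
  add_mem' := by
    rintro φ ψ ⟨h1, ξ, hξ, h2⟩ ⟨h1', ξ', hξ', h2'⟩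
    refine ⟨fun u hu => ?_, ξ + ξ', add_mem hξ hξ', ?_⟩
    · rcases HahnSeries.support_add_subset _ _ hu with hu | hu
      exacts [h1 u hu, h1' u hu]
    · have a := ρ.weaken (fun u hu => (h1 u hu).1) h2 hξ'
      have b := ρ.weaken (fun u hu => (h1' u hu).1) h2' hξ
      rw [add_comm ξ'] at b
      refine (a.add b).of_nonneg_of_le (fun u => by positivity) fun u => ?_
      rw [← add_mul]
      gcongr
      exact norm_add_le _ _
  algebraMap_mem' r := by
    have hz : ∀ u : ρ.Expo, u ≠ 0 → (algebraMap ℂ ρ.Series r).coeff u = 0 := fun u hu => by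
      rw [HahnSeries.algebraMap_apply]
      exact HahnSeries.coeff_single_of_ne hu
    refine ⟨fun u hu => ?_, 0, zero_mem _, ?_⟩
    · have : u = 0 := by
        by_contra h
        exact hu (hz u h)
      rw [this]
      exact zero_mem _
    · refine summable_of_ne_finset_zero (s := {0}) fun u hu => ?_
      rw [hz u (by simpa using hu)]
      simp

instance (L : AddSubgroup ρ.Expo) : CommRing (ρ.conv L) := Subalgebra.toCommRing _

instance (L : AddSubgroup ρ.Expo) : Algebra ℂ (ρ.conv L) := Subalgebra.algebra _

instance (L : AddSubgroup ρ.Expo) : Algebra (ρ.conv L) ρ.Series := Subalgebra.toAlgebra _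

/-! ### Quasi-ordinary polynomials, characteristic exponents -/

/-- `φ = X^λ H` where `H` is a convergent series with (fractional) exponents in some `ρ^∨ ∩ (1/k)M`
and non-zero constant term. -/
def IsMonomialTimesUnit (φ : ρ.Series) (lam : ρ.Expo) : Prop :=
  ∃ k : ℕ, 0 < k ∧ ∃ H ∈ ρ.conv (ρ.fracM k), H.coeff 0 ≠ 0 ∧ φ = HahnSeries.single lam 1 * H

/-- The polynomial ring `ℂ{ρ^∨ ∩ M}[Y]`. -/
abbrev Poly : Type := Polynomial (ρ.conv ρ.M)

/-- Quasi-ordinary polynomials of `ℂ{ρ^∨ ∩ M}[Y]`: the leading coefficient is invertible and the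
discriminant is of the form `X^δ H` with `δ ∈ ρ^∨ ∩ M`, `H ∈ ℂ{ρ^∨ ∩ M}` and `H(o) ≠ 0`. -/
def IsQuasiOrdinary (f : ρ.Poly) : Prop :=
  IsUnit f.leadingCoeff ∧ ∃ δ ∈ ρ.semigroup ρ.M, ∃ H ∈ ρ.conv ρ.M, H.coeff 0 ≠ 0 ∧
    ((f.discr : ρ.conv ρ.M) : ρ.Series) = HahnSeries.single δ 1 * H

/-- `z` is a root of `f`, as a convergent fractional power series. -/
def IsBranchOf (f : ρ.Poly) (z : ρ.Series) : Prop :=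
  (∃ k : ℕ, 0 < k ∧ z ∈ ρ.conv (ρ.fracM k)) ∧ Polynomial.aeval z f = 0

/-- The set of characteristic exponents of `f`: those `λ` such that `z - z' = X^λ · unit` for two
different roots of `f`. -/
def charExponents (f : ρ.Poly) : Set ρ.Expo :=
  {lam | ∃ z z', z ≠ z' ∧ ρ.IsBranchOf f z ∧ ρ.IsBranchOf f z' ∧ ρ.IsMonomialTimesUnit (z - z') lam}

/-- `f` and `q` have order of coincidence `λ`: their product is quasi-ordinary and `λ` is the largest
of the exponents of the differences between a root of `f` and a root of `q`. -/
def HasOrderOfCoincidence (f q : ρ.Poly) (lam : ρ.Expo) : Prop :=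
  ρ.IsQuasiOrdinary (f * q) ∧
    IsGreatest {μ | ∃ z z', ρ.IsBranchOf f z ∧ ρ.IsBranchOf q z' ∧
      ρ.IsMonomialTimesUnit (z - z') μ} lam

/-- The filtration of the ring of series (indexed by a semigroup `S` of real numbers) defined by
`η`: the term of index `j` consists of the series all of whose exponents satisfy `⟨η, u⟩ ≥ j`. -/
def etaFilt (η : Fin d → ℝ) (S : AddSubmonoid ℝ) : Filt S ρ.Series where
  F j :=
    { carrier := {φ | ∀ u ∈ φ.support, (j : ℝ) ≤ ρ.pair η u}
      zero_mem' := fun u hu => absurd rfl hu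
      add_mem' := fun h h' u hu => (HahnSeries.support_add_subset _ _ hu).elim (h u) (h' u)
      smul_mem' := fun c φ h u hu => h u fun h0 => hu (by simp [h0]) }
  anti _ _ h _ hφ u hu := le_trans h (hφ u hu)
  one_mem u hu := by
    rw [HahnSeries.support_one] at hu
    rw [Set.mem_singleton_iff.1 hu]
    simp
  mul_mem hx hy u hu := by
    obtain ⟨a, ha, b, hb, rfl⟩ := HahnSeries.support_mul_subset hu
    rw [map_add]
    exact add_le_add (hx a ha) (hy b hb)

/-- The weighted filtration of `ℂ{ρ^∨ ∩ M}[U_1, …, U_g]` defined by `η`, where the weight of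
`X^α U^v` is `α + ∑ v_i γ_i`: the term of index `j` consists of the polynomials all of whose terms
have weights `w` with `⟨η, w⟩ ≥ j`. -/
def weightFilt {g : ℕ} (γ : Fin g → ρ.Expo) (η : Fin d → ℝ) (S : AddSubmonoid ℝ) :
    Filt S (MvPolynomial (Fin g) (ρ.conv ρ.M)) where
  F j :=
    { carrier := {P : MvPolynomial (Fin g) (ρ.conv ρ.M) | ∀ (v : Fin g →₀ ℕ),
        ∀ α ∈ ((P.coeff v : ρ.conv ρ.M) : ρ.Series).support, (j : ℝ) ≤ ρ.pair η (α + ∑ i, v i • γ i)}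
      zero_mem' := fun v u hu => absurd (by simp) hu
      add_mem' := fun {P Q} h h' v u hu =>
        (HahnSeries.support_add_subset ((P.coeff v : ρ.conv ρ.M) : ρ.Series)
          ((Q.coeff v : ρ.conv ρ.M) : ρ.Series) (by simpa using hu)).elim (h v u) (h' v u)
      smul_mem' := fun c P h v u hu => h v u fun h0 => hu (by simp [h0]) }
  anti _ _ h _ hP v u hu := le_trans h (hP v u hu)
  one_mem v u hu := by
    rw [MvPolynomial.coeff_one] at hu
    split_ifs at hu with h
    · subst h
      rw [OneMemClass.coe_one, HahnSeries.support_one] at hu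
      rw [Set.mem_singleton_iff.1 hu]
      simp
    · exact absurd (by simp) hu
  mul_mem := by
    intro i j P Q hP hQ v u hu
    rw [MvPolynomial.coeff_mul] at hu
    have : ∃ x ∈ Finset.HasAntidiagonal.antidiagonal v,
        (((P.coeff x.1 : ρ.conv ρ.M) : ρ.Series) *
          ((Q.coeff x.2 : ρ.conv ρ.M) : ρ.Series)).coeff u ≠ 0 := by
      by_contra hcon
      push Not at hcon
      refine hu ?_
      rw [AddSubmonoidClass.coe_finsetSum, HahnSeries.coeff_sum]
      exact Finset.sum_eq_zero hcon
    obtain ⟨x, hx, hxu⟩ := this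
    obtain ⟨a, ha, b, hb, rfl⟩ := HahnSeries.support_mul_subset hxu
    rw [← Finset.HasAntidiagonal.mem_antidiagonal.1 hx]
    have e : a + b + ∑ i, (x.1 + x.2) i • γ i =
        (a + ∑ i, x.1 i • γ i) + (b + ∑ i, x.2 i • γ i) := by
      simp only [Finsupp.add_apply, add_smul, Finset.sum_add_distrib]
      abel
    refine le_trans (add_le_add (hP _ a ha) (hQ _ b hb)) ?_
    rw [← map_add]
    exact le_of_eq (congrArg _ e.symm)

/-- The homogeneous components of `ℂ[Λ]` with respect to `η`: the component of degree `j` is spanned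
by the monomials `X^u`, `u ∈ Λ`, `⟨η, u⟩ = j`. -/
def etaGrade (η : Fin d → ℝ) (S : AddSubmonoid ℝ) (Λ : AddSubmonoid ρ.Expo) (j : S) :
    Submodule ℂ (AddMonoidAlgebra ℂ Λ) :=
  AddMonoidAlgebra.gradeBy ℂ (fun u : Λ => ρ.pair η u) (j : ℝ)

/-- The homogeneous components of `ℂ[ρ^∨ ∩ M][U_1, …, U_g]` with respect to `η`: the component of
degree `j` is spanned by the monomials `X^α U^v` with `⟨η, α + ∑ v_i γ_i⟩ = j`. -/
def weightGrade {g : ℕ} (γ : Fin g → ρ.Expo) (η : Fin d → ℝ) (S : AddSubmonoid ℝ) (j : S) :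
    Submodule ℂ (MvPolynomial (Fin g) (AddMonoidAlgebra ℂ (ρ.semigroup ρ.M))) :=
  Submodule.span ℂ
    {P | ∃ (α : ρ.semigroup ρ.M) (v : Fin g →₀ ℕ),
      ρ.pair η ((α : ρ.Expo) + ∑ i, v i • γ i) = (j : ℝ) ∧
        P = MvPolynomial.monomial v (AddMonoidAlgebra.single α 1)}

end ToricCone

/-! ### Toric quasi-ordinary branches, the semigroup `Γ`, semi-roots -/

/-- A toric quasi-ordinary branch `ζ` with `g ≥ 1` characteristic exponents. -/
structure Branch {d : ℕ} (ρ : ToricCone d) where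
  /-- the minimal polynomial -/
  f : ρ.Poly
  monic : f.Monic
  irreducible : Irreducible f
  quasiOrdinary : ρ.IsQuasiOrdinary f
  /-- `f(o, Y) = Y^n` -/
  special_fibre : ∀ k < f.natDegree, (f.coeff k : ρ.Series).coeff 0 = 0
  /-- the root `ζ ∈ ℂ{ρ^∨ ∩ (1/n)M}` of `f`, where `n = deg f` -/
  ζ : ρ.Series
  ζ_mem : ζ ∈ ρ.conv (ρ.fracM f.natDegree)
  root : Polynomial.aeval ζ f = 0
  /-- the number of characteristic exponents -/
  g : ℕ
  g_pos : 0 < g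
  /-- the characteristic exponents `λ_1 < … < λ_g` (here `lam i` is `λ_{i+1}`) -/
  lam : Fin g → ρ.Expo
  lam_strictMono : StrictMono lam
  range_lam : Set.range lam = ρ.charExponents f

namespace Branch

variable {d : ℕ} {ρ : ToricCone d} (Z : Branch ρ)

/-- The characteristic lattices `M_i = M + ℤ λ_1 + … + ℤ λ_i`. -/
def lattice (i : ℕ) : AddSubgroup ρ.Expo :=
  ρ.M ⊔ AddSubgroup.closure {u | ∃ k : Fin Z.g, (k : ℕ) < i ∧ u = Z.lam k}

/-- `charInt i` is the characteristic integer `n_{i+1} = # M_{i+1} / M_i`. -/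
def charInt (i : ℕ) : ℕ := (Z.lattice i).relIndex (Z.lattice (i + 1))

/-- `gammaAux i` is `γ_{i+1}`, where `γ_1 = λ_1` and `γ_{j+1} = n_j γ_j + λ_{j+1} - λ_j`. -/
def gammaAux : (i : ℕ) → i < Z.g → ρ.Expo
  | 0, h => Z.lam ⟨0, h⟩
  | i + 1, h => Z.charInt i • gammaAux i (Nat.lt_of_succ_lt h) + Z.lam ⟨i + 1, h⟩ -
      Z.lam ⟨i, Nat.lt_of_succ_lt h⟩

/-- The elements `γ_1, …, γ_g` (here `gamma i` is `γ_{i+1}`). -/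
def gamma (i : Fin Z.g) : ρ.Expo := Z.gammaAux i i.2

/-- The semigroup `Γ = ρ^∨ ∩ M + γ_1 ℤ_{≥0} + … + γ_g ℤ_{≥0}`. -/
def Gam : AddSubmonoid ρ.Expo :=
  ρ.semigroup ρ.M ⊔ AddSubmonoid.closure (Set.range Z.gamma)

/-- The semigroup `ρ^∨ ∩ M_g`. -/
abbrev bigSemigroup : AddSubmonoid ρ.Expo := ρ.semigroup (Z.lattice Z.g)

/-- The algebra `ℂ{ρ^∨ ∩ M_g}`. -/
abbrev bigRing : Subalgebra ℂ ρ.Series := ρ.conv (Z.lattice Z.g)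

/-- The analytic algebra `R = ℂ{ρ^∨ ∩ M}[ζ]`. -/
def R : Subalgebra ℂ ρ.Series :=
  (Algebra.adjoin (ρ.conv ρ.M) ({Z.ζ} : Set ρ.Series)).restrictScalars ℂ

instance : CommRing Z.R := Subalgebra.toCommRing _

instance : Algebra ℂ Z.R := Subalgebra.algebra _

/-- `q` is a `j`-th semi-root of `f`: an irreducible quasi-ordinary polynomial of degree
`n_0 n_1 ⋯ n_j` (with `n_0 = 1`) whose order of coincidence with `f` is `λ_{j+1}`. -/
def IsSemiRoot (j : Fin Z.g) (q : ρ.Poly) : Prop :=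
  Irreducible q ∧ ρ.IsQuasiOrdinary q ∧ q.natDegree = ∏ i ∈ Finset.range j, Z.charInt i ∧
    ρ.HasOrderOfCoincidence Z.f q (Z.lam j)

/-- The homomorphism `Ψ₀ : ℂ{ρ^∨ ∩ M}[U_1, …, U_g] → R` of `ℂ{ρ^∨ ∩ M}`-algebras,
`U_j ↦ q_{j-1}(ζ)`. -/
def Psi (q : Fin Z.g → ρ.Poly) : MvPolynomial (Fin Z.g) (ρ.conv ρ.M) →ₐ[ℂ] Z.R :=
  ((MvPolynomial.aeval (R := ρ.conv ρ.M) (S₁ := ρ.Series)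
    (fun j => Polynomial.aeval Z.ζ (q j))).restrictScalars ℂ).codRestrict Z.R (by
      intro P
      change MvPolynomial.aeval _ P ∈ Algebra.adjoin (ρ.conv ρ.M) ({Z.ζ} : Set ρ.Series)
      induction P using MvPolynomial.induction_on with
      | C a => rw [MvPolynomial.aeval_C]; exact Subalgebra.algebraMap_mem _ a
      | add P Q hP hQ => rw [map_add]; exact add_mem hP hQ
      | mul_X P i hP =>
        rw [map_mul, MvPolynomial.aeval_X]
        exact mul_mem hP (Polynomial.aeval_mem_adjoin_singleton _ _))

/-- The index set `η(ρ^∨ ∩ M_g)` of the filtrations defined by `η`. -/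
def degrees (η : Fin d → ℝ) : AddSubmonoid ℝ := Z.bigSemigroup.map (ρ.pair η)

/-- The map `ρ^∨ ∩ M_g → η(ρ^∨ ∩ M_g)`, `u ↦ ⟨η, u⟩`. -/
def deg (η : Fin d → ℝ) (u : Z.bigSemigroup) : Z.degrees η :=
  ⟨ρ.pair η u, u, u.2, rfl⟩

/-- The filtration of `ℂ{ρ^∨ ∩ M_g}` defined by `η`. -/
def filtBig (η : Fin d → ℝ) : Filt (Z.degrees η) Z.bigRing :=
  (ρ.etaFilt η (Z.degrees η)).comap Z.bigRing.val

/-- The filtration of `R` defined by `η`. -/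
def filtR (η : Fin d → ℝ) : Filt (Z.degrees η) Z.R :=
  (ρ.etaFilt η (Z.degrees η)).comap Z.R.val

/-- The weighted filtration of `ℂ{ρ^∨ ∩ M}[U_1, …, U_g]` defined by `η`. -/
def filtU (η : Fin d → ℝ) : Filt (Z.degrees η) (MvPolynomial (Fin Z.g) (ρ.conv ρ.M)) :=
  ρ.weightFilt Z.gamma η (Z.degrees η)

/-- The homomorphism `ℂ[ρ^∨ ∩ M][U_1, …, U_g] → ℂ[Γ]`, `X^α U^v ↦ X^{α + ∑ v_i γ_i}`. -/
def monomialMap :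
    MvPolynomial (Fin Z.g) (AddMonoidAlgebra ℂ (ρ.semigroup ρ.M)) →ₐ[ℂ] AddMonoidAlgebra ℂ Z.Gam :=
  MvPolynomial.aevalTower
    (AddMonoidAlgebra.mapDomainAlgHom ℂ ℂ
      (AddSubmonoid.inclusion (le_sup_left : ρ.semigroup ρ.M ≤ Z.Gam)))
    (fun i => AddMonoidAlgebra.single
      ⟨Z.gamma i, (le_sup_right : _ ≤ Z.Gam) (AddSubmonoid.subset_closure ⟨i, rfl⟩)⟩ 1)

end Branch

end ToricQO

end

noncomputable section

namespace ToricQO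

namespace ToricCone
variable {d : ℕ} (ρ : ToricCone d)

/-! ### Monomial orders refining `≤_ρ` -/

/-! Everything rests on one fact: the exponents of lowest `η`-degree of an element of `R` lie in
`Γ`, and every element of `Γ` is the leading exponent of some element of `R`. Taking parts of lowest
degree then identifies `gr R` with `ℂ[Γ]`. Since `q_{j-1}(ζ)` is `X^{γ_j}` plus larger terms, `Ψ₀`
becomes the monomial map on initial forms.

The orders of the semi-roots (`IsSemiRoot.hasOrder`) come from monodromy. The group `N` acts on
fractional series by `X^u ↦ exp(2πi⟨w, u⟩) X^u`, and the roots of an irreducible polynomial with a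
fractional power series root form one orbit (`map_eq_C_mul_prod_orbit`). The discriminant condition
forces the difference of two roots to have a least exponent. Filter `N` by the annihilators of the
lattices `M_i`, whose successive indices are the `n_i` by duality (`relIndex_ann`). If `y` is a root
of a semi-root whose contact with `ζ` is maximal, the order of `ζ - w • y` depends only on how far
down this filtration `w` lies. Multiplying over the orbit of `y` gives `γ_{j+1}`.

Dividing successively by the semi-roots writes each element of `R` as `∑ c_v q(ζ)^v` with `0 ≤ v_i <
n_i` (`exists_box_expansion`). In this box the exponents `∑ v_i γ_i` are pairwise incongruent modulo
`M` (`eq_of_add_wt_eq`). Hence initial terms with different `v` cannot cancel, the expansion lies in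
the same term of the filtration as its value (`mem_filtU_of_Psi_mem`), and initial forms of elements
of `R` lie in `ℂ[Γ]` (`level_mem_Gam`).

`Filt.InitialForms` turns these facts into graded isomorphisms for the three rings, and
compatibility of initial forms (`cut_Psi`, `cut_eq_mapDomain`) gives the two commuting squares. An
irrational `η` separates the points of `M_g ⊆ (1/n)M`, so each homogeneous component is spanned by
at most one monomial. -/

theorem exists_pair_pos : ∃ w ∈ ρ.cone, ∀ u ∈ ρ.dualCone, u ≠ 0 → 0 < ρ.pair w u := by
  obtain ⟨s, hs⟩ := ρ.rational
  let c : (Fin d → ℤ) → Fin d → ℝ := fun v i => (v i : ℝ)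
  have hmem : ∀ v ∈ s, c v ∈ ρ.cone := fun v hv => by
    rw [hs]
    exact Submodule.subset_span ⟨v, hv, rfl⟩
  have hsum : ∀ u : ρ.Expo, ρ.pair (∑ v ∈ s, c v) u = ∑ v ∈ s, ρ.pair (c v) u := fun u =>
    map_sum (AddMonoidHom.mk' (fun w => ρ.pair w u) fun a b => ρ.pair_add_left a b u) c s
  -- The sum of the generators works: if it vanishes on `u ∈ ρ^∨`, every generator does, hence all
  -- of `ρ`, which spans.
  refine ⟨∑ v ∈ s, c v, sum_mem hmem, fun u hu hu0 => ?_⟩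
  rw [hsum]
  refine lt_of_le_of_ne (Finset.sum_nonneg fun v hv => hu _ (hmem v hv)) fun h => hu0 ?_
  have h0 := (Finset.sum_eq_zero_iff_of_nonneg fun v hv => hu _ (hmem v hv)).1 h.symm
  refine ρ.eq_zero_of_pair fun w hw => ?_
  rw [hs] at hw
  induction hw using Submodule.span_induction with
  | mem x hx =>
    obtain ⟨v, hv, rfl⟩ := hx
    exact h0 v hv
  | zero =>
    change ∑ i, (0 : ℝ) * (show Fin d → ℝ from u) i = 0
    simp
  | add x y _ _ hx hy => rw [pair_add_left, hx, hy, add_zero]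
  | smul a x _ hx =>
    change ∑ i, ((a : ℝ) * x i) * (show Fin d → ℝ from u) i = 0
    simp only [mul_assoc]
    rw [← Finset.mul_sum]
    exact mul_eq_zero_of_right _ hx

/-- For small `t > 0` the vector `η - t w` is still in `ρ`, with `w` from `exists_pair_pos`; so `⟨η,
u⟩ ≥ t⟨w, u⟩ > 0`. -/
theorem pair_pos_of_mem_interior {η : Fin d → ℝ}
    (hη : η ∈ interior (ρ.cone : Set (Fin d → ℝ))) {u : ρ.Expo} (hu : u ∈ ρ.dualCone)
    (hu0 : u ≠ 0) : 0 < ρ.pair η u := by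
  obtain ⟨w, hw, hpos⟩ := ρ.exists_pair_pos
  have hlim : Filter.Tendsto (fun t : ℝ => η - t • w) (nhds 0) (nhds η) := by
    have : Continuous fun t : ℝ => η - t • w := by fun_prop
    simpa using this.tendsto 0
  have hev := hlim.eventually (mem_interior_iff_mem_nhds.1 hη)
  obtain ⟨ε, hε, hball⟩ := Metric.eventually_nhds_iff.1 hev
  have h1 := hball (y := ε / 2) (by
    rw [Real.dist_eq, sub_zero, abs_of_pos (by linarith)]; linarith)
  have h2 := hu _ h1
  have h3 : ρ.pair (η - (ε / 2) • w) u = ρ.pair η u - ε / 2 * ρ.pair w u := by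
    change ∑ i, (η i - ε / 2 * w i) * (show Fin d → ℝ from u) i =
      ∑ i, η i * (show Fin d → ℝ from u) i - ε / 2 * ∑ i, w i * (show Fin d → ℝ from u) i
    rw [Finset.mul_sum, ← Finset.sum_sub_distrib]
    exact Finset.sum_congr rfl fun i _ => by ring
  rw [h3] at h2
  have := mul_pos (half_pos hε) (hpos u hu hu0)
  linarith

/-- Comparison of exponents by `w`, then by `w₀`, then lexicographically. -/
def lexKey (w w₀ : Fin d → ℝ) : ρ.Expo →+ ℝ ×ₗ (ℝ ×ₗ Lex (Fin d → ℝ)) where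
  toFun u := toLex (ρ.pair w u, toLex (ρ.pair w₀ u, toLex (show Fin d → ℝ from u)))
  map_zero' := by rw [map_zero, map_zero]; rfl
  map_add' u v := by rw [map_add, map_add]; rfl

theorem lexKey_injective (w w₀ : Fin d → ℝ) : Function.Injective (ρ.lexKey w w₀) := fun u v h => by
  have h1 := congrArg (fun x => (ofLex (ofLex x).2).2) h
  exact h1

/-- When `w` lies on the boundary of `ρ` it may not separate comparable exponents; the strictly
positive `w₀` then decides. The lexicographic coordinate serves only injectivity. -/
theorem lexKey_mono {w w₀ : Fin d → ℝ} (hw : w ∈ ρ.cone)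
    (hw₀ : ∀ u ∈ ρ.dualCone, u ≠ 0 → 0 < ρ.pair w₀ u) : Monotone (ρ.lexKey w w₀) := by
  intro u v h
  rcases eq_or_ne u v with rfl | hne
  · exact le_rfl
  have h1 := h w hw
  rw [map_sub, sub_nonneg] at h1
  have h2 := hw₀ _ h (sub_ne_zero.2 hne.symm)
  rw [map_sub, sub_pos] at h2
  rw [lexKey, AddMonoidHom.coe_mk, ZeroHom.coe_mk, Prod.Lex.toLex_le_toLex]
  rcases h1.lt_or_eq with h1 | h1
  · exact Or.inl h1
  · refine Or.inr ⟨h1, ?_⟩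
    rw [Prod.Lex.toLex_le_toLex]
    exact Or.inl h2

theorem pair_le_of_lexKey_le {w w₀ : Fin d → ℝ} {u v : ρ.Expo}
    (h : ρ.lexKey w w₀ u ≤ ρ.lexKey w w₀ v) : ρ.pair w u ≤ ρ.pair w v := by
  rw [lexKey, AddMonoidHom.coe_mk, ZeroHom.coe_mk, Prod.Lex.toLex_le_toLex] at h
  exact h.elim le_of_lt fun h => h.1.le

/-- A monotone image of a partially well-ordered set in a linear order is well ordered, so a minimum
exists. -/
theorem exists_isMin_lexKey {w w₀ : Fin d → ℝ} (hw : w ∈ ρ.cone)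
    (hw₀ : ∀ u ∈ ρ.dualCone, u ≠ 0 → 0 < ρ.pair w₀ u) {φ : ρ.Series} (hφ : φ ≠ 0) :
    ∃ a ∈ φ.support, ∀ u ∈ φ.support, ρ.lexKey w w₀ a ≤ ρ.lexKey w w₀ u := by
  have hp := φ.isPWO_support.image_of_monotone (ρ.lexKey_mono hw hw₀)
  obtain ⟨a, ha⟩ := Set.IsPWO.exists_minimalFor _ _ hp (HahnSeries.support_nonempty_iff.2 hφ)
  refine ⟨a, ha.1, fun u hu => ?_⟩
  rcases le_total (ρ.lexKey w w₀ a) (ρ.lexKey w w₀ u) with h | h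
  · exact h
  · exact ha.2 hu h

/-- The least terms of two series for a monomial order multiply to the least term of the product. -/
theorem coeff_add_of_isMin {w w₀ : Fin d → ℝ} {φ ψ : ρ.Series} {a b : ρ.Expo}
    (ha : ∀ u ∈ φ.support, ρ.lexKey w w₀ a ≤ ρ.lexKey w w₀ u)
    (hb : ∀ u ∈ ψ.support, ρ.lexKey w w₀ b ≤ ρ.lexKey w w₀ u) :
    (φ * ψ).coeff (a + b) = φ.coeff a * ψ.coeff b := by
  classical
  rw [HahnSeries.coeff_mul]
  rw [Finset.sum_eq_single (a, b)]
  · rintro ⟨x, y⟩ hxy hne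
    obtain ⟨hx, hy, hs⟩ := Finset.mem_antidiagonal.1 hxy
    refine absurd ?_ hne
    have h1 := ha x hx
    have h2 := hb y hy
    -- The key is additive and injective, so `(a, b)` is the only pair of exponents contributing to
    -- `a + b`.
    have h3 : ρ.lexKey w w₀ x + ρ.lexKey w w₀ y = ρ.lexKey w w₀ a + ρ.lexKey w w₀ b := by
      rw [← map_add, ← map_add]
      exact congrArg _ hs
    have h4 : ρ.lexKey w w₀ x = ρ.lexKey w w₀ a := by
      refine le_antisymm ?_ h1
      by_contra hlt
      exact absurd h3 (add_lt_add_of_lt_of_le (not_le.1 hlt) h2).ne'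
    have h5 := ρ.lexKey_injective w w₀ h4
    subst h5
    exact Prod.ext rfl (add_left_cancel hs)
  · intro h
    by_contra h0
    exact h (Finset.mem_antidiagonal.2 ⟨left_ne_zero_of_mul h0, right_ne_zero_of_mul h0, rfl⟩)

instance : NoZeroDivisors ρ.Series where
  eq_zero_or_eq_zero_of_mul_eq_zero {φ ψ} h := by
    by_contra! hne
    obtain ⟨w, hw, hpos⟩ := ρ.exists_pair_pos
    obtain ⟨a, ha, ha'⟩ := ρ.exists_isMin_lexKey hw hpos hne.1
    obtain ⟨b, hb, hb'⟩ := ρ.exists_isMin_lexKey hw hpos hne.2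
    have := ρ.coeff_add_of_isMin ha' hb'
    rw [h, HahnSeries.coeff_zero] at this
    exact mul_ne_zero ha hb this.symm

instance : IsDomain ρ.Series := NoZeroDivisors.to_isDomain _

instance (L : AddSubgroup ρ.Expo) : IsDomain (ρ.conv L) := Subalgebra.isDomain _

/-! ### Series with a dominating exponent -/

/-- `a` is the least exponent of `φ` for `≤_ρ`, i.e. `φ` is `X^a` times a series with exponents in
`ρ^∨` and non-zero constant term. -/
def HasOrder (φ : ρ.Series) (a : ρ.Expo) : Prop :=
  φ.coeff a ≠ 0 ∧ ∀ u ∈ φ.support, a ≤ u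

variable {ρ}

theorem HasOrder.ne_zero {φ : ρ.Series} {a : ρ.Expo} (h : ρ.HasOrder φ a) : φ ≠ 0 := by
  rintro rfl
  exact h.1 rfl

theorem le_of_mem_support_mul {φ ψ : ρ.Series} {a b : ρ.Expo} (ha : ∀ u ∈ φ.support, a ≤ u)
    (hb : ∀ u ∈ ψ.support, b ≤ u) : ∀ u ∈ (φ * ψ).support, a + b ≤ u := by
  intro u hu
  obtain ⟨x, hx, y, hy, rfl⟩ := HahnSeries.support_mul_subset hu
  exact add_le_add (ha x hx) (hb y hy)

theorem coeff_mul_of_le {φ ψ : ρ.Series} {a b : ρ.Expo} (ha : ∀ u ∈ φ.support, a ≤ u)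
    (hb : ∀ u ∈ ψ.support, b ≤ u) : (φ * ψ).coeff (a + b) = φ.coeff a * ψ.coeff b := by
  obtain ⟨w, hw, hpos⟩ := ρ.exists_pair_pos
  exact ρ.coeff_add_of_isMin (fun u hu => ρ.lexKey_mono hw hpos (ha u hu))
    (fun u hu => ρ.lexKey_mono hw hpos (hb u hu))

theorem HasOrder.mul {φ ψ : ρ.Series} {a b : ρ.Expo} (h : ρ.HasOrder φ a)
    (h' : ρ.HasOrder ψ b) : ρ.HasOrder (φ * ψ) (a + b) := by
  refine ⟨?_, le_of_mem_support_mul h.2 h'.2⟩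
  rw [coeff_mul_of_le h.2 h'.2]
  exact mul_ne_zero h.1 h'.1

theorem HasOrder.one : ρ.HasOrder 1 0 := by
  refine ⟨by simp, fun u hu => ?_⟩
  rw [HahnSeries.support_one] at hu
  exact (Set.mem_singleton_iff.1 hu).ge

theorem HasOrder.prod {ι : Type*} (s : Finset ι) {φ : ι → ρ.Series} {a : ι → ρ.Expo}
    (h : ∀ i ∈ s, ρ.HasOrder (φ i) (a i)) : ρ.HasOrder (∏ i ∈ s, φ i) (∑ i ∈ s, a i) := by
  classical
  induction s using Finset.induction_on with
  | empty => simpa using HasOrder.one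
  | insert i s hi ih =>
    rw [Finset.prod_insert hi, Finset.sum_insert hi]
    exact (h i (Finset.mem_insert_self _ _)).mul
      (ih fun k hk => h k (Finset.mem_insert_of_mem hk))

theorem HasOrder.add_of_lt {φ ψ : ρ.Series} {a b : ρ.Expo} (h : ρ.HasOrder φ a)
    (hb : ∀ u ∈ ψ.support, b ≤ u) (hab : a < b) : ρ.HasOrder (φ + ψ) a := by
  have h0 : ψ.coeff a = 0 := by
    by_contra h0
    exact (hb a h0).not_gt hab
  refine ⟨by simpa [h0] using h.1, fun u hu => ?_⟩
  rcases HahnSeries.support_add_subset _ _ hu with hu | hu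
  exacts [h.2 u hu, hab.le.trans (hb u hu)]

/-- A factor of a series with a dominating exponent has a dominating exponent. -/
theorem HasOrder.of_mul {φ ψ : ρ.Series} {c : ρ.Expo} (h : ρ.HasOrder (φ * ψ) c) :
    ∃ a, ρ.HasOrder φ a := by
  have hφ : φ ≠ 0 := left_ne_zero_of_mul h.ne_zero
  have hψ : ψ ≠ 0 := right_ne_zero_of_mul h.ne_zero
  obtain ⟨w₀, hw₀, hpos⟩ := ρ.exists_pair_pos
  -- For each `w` the least exponents `a`, `b` of the factors give an exponent `a + b` of the
  -- product, so `c ≤ a + b`. Conversely `c` is a sum of exponents of the factors, so its key is at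
  -- least that of `a + b`.
  have key : ∀ w ∈ ρ.cone, ∃ a ∈ φ.support, ∃ b ∈ ψ.support, a + b = c ∧
      (∀ u ∈ φ.support, ρ.pair w a ≤ ρ.pair w u) ∧ ∀ u ∈ ψ.support, ρ.pair w b ≤ ρ.pair w u := by
    intro w hw
    obtain ⟨a, ha, ha'⟩ := ρ.exists_isMin_lexKey hw hpos hφ
    obtain ⟨b, hb, hb'⟩ := ρ.exists_isMin_lexKey hw hpos hψ
    refine ⟨a, ha, b, hb, ρ.lexKey_injective w w₀ (le_antisymm ?_ ?_),
      fun u hu => ρ.pair_le_of_lexKey_le (ha' u hu), fun u hu => ρ.pair_le_of_lexKey_le (hb' u hu)⟩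
    · obtain ⟨x, hx, y, hy, rfl⟩ := HahnSeries.support_mul_subset h.1
      simp only [map_add]
      exact add_le_add (ha' x hx) (hb' y hy)
    · refine ρ.lexKey_mono hw hpos (h.2 _ ?_)
      rw [HahnSeries.mem_support, ρ.coeff_add_of_isMin ha' hb']
      exact mul_ne_zero ha hb
  obtain ⟨a, ha, b, hb, hab, -, -⟩ := key w₀ hw₀
  refine ⟨a, ha, fun u hu w hw => ?_⟩
  -- As `a + b = c = a' + b'` with `a'`, `b'` minimal for `w`, the exponent `a` found for `w₀` is
  -- minimal for `w` too. Since `w ∈ ρ` is arbitrary, `a` is least for `≤_ρ`.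
  obtain ⟨a', ha', b', hb', hab', h1, h2⟩ := key w hw
  have h3 := h1 u hu
  have h4 := h2 b hb
  have h5 : ρ.pair w a + ρ.pair w b = ρ.pair w a' + ρ.pair w b' := by
    rw [← map_add, ← map_add, hab, hab']
  rw [map_sub]
  linarith

theorem IsMonomialTimesUnit.hasOrder {φ : ρ.Series} {a : ρ.Expo}
    (h : ρ.IsMonomialTimesUnit φ a) : ρ.HasOrder φ a := by
  obtain ⟨k, -, H, hH, h0, rfl⟩ := h
  have h1 : ρ.HasOrder (HahnSeries.single a (1 : ℂ)) a :=
    ⟨by simp, fun u hu => (HahnSeries.support_single_subset hu).ge⟩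
  have h2 : ρ.HasOrder H 0 := ⟨h0, fun u hu => by
    rw [le_def, sub_zero]
    exact (hH.1 u hu).1⟩
  simpa using h1.mul h2

/-- Dividing by `X^a` shifts exponents by an element of `(1/k)M` and multiplies the absolute sum at
the same `ξ` by `exp⟨ξ, a⟩`, so convergence is kept. -/
theorem HasOrder.isMonomialTimesUnit {φ : ρ.Series} {a : ρ.Expo} (h : ρ.HasOrder φ a) {k : ℕ}
    (hk : 0 < k) (hφ : φ ∈ ρ.conv (ρ.fracM k)) : ρ.IsMonomialTimesUnit φ a := by
  have hc : ∀ u, (HahnSeries.single (-a) (1 : ℂ) * φ).coeff u = φ.coeff (u + a) := fun u => by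
    have := HahnSeries.coeff_single_mul_add (r := (1 : ℂ)) (x := φ) (a := u + a) (b := -a)
    simpa using this
  refine ⟨k, hk, HahnSeries.single (-a) 1 * φ, ⟨fun u hu => ?_, ?_⟩, ?_, ?_⟩
  · rw [HahnSeries.mem_support, hc] at hu
    refine ⟨?_, ?_⟩
    · have := h.2 _ hu
      rwa [le_def, add_sub_cancel_right] at this
    · have h1 := (hφ.1 _ hu).2
      have h2 := (hφ.1 _ h.1).2
      have := AddSubgroup.sub_mem _ h1 h2
      rwa [add_sub_cancel_right] at this
  · obtain ⟨ξ, hξ, hs⟩ := hφ.2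
    refine ⟨ξ, hξ, ?_⟩
    have h1 := ((Equiv.addRight a).summable_iff.2 hs).mul_right (Real.exp (ρ.pair ξ a))
    refine h1.congr fun u => ?_
    simp only [Function.comp, Equiv.coe_addRight, hc, map_add, neg_add, Real.exp_add, mul_assoc]
    rw [← Real.exp_add (-ρ.pair ξ a), neg_add_cancel, Real.exp_zero, mul_one]
  · rw [hc, zero_add]
    exact h.1
  · rw [← mul_assoc, HahnSeries.single_mul_single]
    simp

end ToricCone

namespace ToricCone
variable {d : ℕ} (ρ : ToricCone d)

/-! ### The action of `N` on fractional power series -/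

/-- The pairing `⟨w, u⟩` of `w ∈ N = ℤ^d` and `u ∈ M_ℝ`. -/
def intPair (w : Fin d → ℤ) : ρ.Expo →+ ℝ := ρ.pair fun i => (w i : ℝ)

theorem intPair_zero (u : ρ.Expo) : ρ.intPair 0 u = 0 := by
  change ∑ i, (((0 : Fin d → ℤ) i : ℤ) : ℝ) * (show Fin d → ℝ from u) i = 0
  simp

theorem intPair_add_left (w w' : Fin d → ℤ) (u : ρ.Expo) :
    ρ.intPair (w + w') u = ρ.intPair w u + ρ.intPair w' u := by
  rw [intPair, intPair, intPair, ← pair_add_left]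
  congr 2
  funext i
  simp

/-- `X^u ↦ exp(2πi⟨w, u⟩) X^u` is the monodromy along the loop `w ∈ N` of the torus. -/
def chi (w : Fin d → ℤ) (u : ρ.Expo) : ℂ := Complex.exp (ρ.intPair w u * (2 * Real.pi * Complex.I))

theorem chi_zero (w : Fin d → ℤ) : ρ.chi w 0 = 1 := by simp [chi]

theorem chi_zero_left (u : ρ.Expo) : ρ.chi 0 u = 1 := by simp [chi, intPair_zero]

theorem chi_add (w : Fin d → ℤ) (u v : ρ.Expo) : ρ.chi w (u + v) = ρ.chi w u * ρ.chi w v := by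
  rw [chi, chi, chi, ← Complex.exp_add, map_add]
  push_cast
  ring_nf

theorem chi_add_left (w w' : Fin d → ℤ) (u : ρ.Expo) :
    ρ.chi (w + w') u = ρ.chi w u * ρ.chi w' u := by
  rw [chi, chi, chi, ← Complex.exp_add, intPair_add_left]
  push_cast
  ring_nf

theorem norm_chi (w : Fin d → ℤ) (u : ρ.Expo) : ‖ρ.chi w u‖ = 1 := by
  have : (ρ.intPair w u : ℂ) * (2 * Real.pi * Complex.I) =
      ((ρ.intPair w u * (2 * Real.pi) : ℝ) : ℂ) * Complex.I := by
    push_cast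
    ring
  rw [chi, this, Complex.norm_exp_ofReal_mul_I]

theorem chi_ne_zero (w : Fin d → ℤ) (u : ρ.Expo) : ρ.chi w u ≠ 0 := Complex.exp_ne_zero _

theorem chi_eq_one_iff {w : Fin d → ℤ} {u : ρ.Expo} :
    ρ.chi w u = 1 ↔ ∃ m : ℤ, ρ.intPair w u = m := by
  rw [chi, Complex.exp_eq_one_iff]
  refine exists_congr fun m => ?_
  rw [mul_left_inj' (by simp [Real.pi_ne_zero])]
  exact_mod_cast Iff.rfl

theorem mem_M_iff {u : ρ.Expo} :
    u ∈ ρ.M ↔ ∀ i, ∃ m : ℤ, (show Fin d → ℝ from u) i = m := by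
  constructor
  · rintro ⟨m, rfl⟩ i
    exact ⟨m i, rfl⟩
  · intro h
    choose m hm using h
    exact ⟨m, funext fun i => (hm i).symm⟩

theorem chi_of_mem_M (w : Fin d → ℤ) {u : ρ.Expo} (hu : u ∈ ρ.M) : ρ.chi w u = 1 := by
  rw [chi_eq_one_iff]
  obtain ⟨m, rfl⟩ := hu
  refine ⟨∑ i, w i * m i, ?_⟩
  push_cast
  rfl

theorem mem_M_of_chi {u : ρ.Expo} (h : ∀ w, ρ.chi w u = 1) : u ∈ ρ.M := by
  classical
  rw [mem_M_iff]
  intro i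
  obtain ⟨m, hm⟩ := ρ.chi_eq_one_iff.1 (h (Pi.single i 1))
  refine ⟨m, ?_⟩
  rw [← hm]
  change _ = ∑ j, (((Pi.single i 1 : Fin d → ℤ) j : ℤ) : ℝ) * (show Fin d → ℝ from u) j
  rw [Finset.sum_eq_single i]
  · simp
  · intro j _ hj
    simp [Pi.single_eq_of_ne hj]
  · simp

/-- The underlying function of `twist`. -/
def twistFun (w : Fin d → ℤ) (φ : ρ.Series) : ρ.Series where
  coeff u := ρ.chi w u * φ.coeff u
  isPWO_support' := φ.isPWO_support.mono fun _ hu => right_ne_zero_of_mul hu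

theorem support_twistFun (w : Fin d → ℤ) (φ : ρ.Series) :
    (ρ.twistFun w φ).support = φ.support := by
  ext u
  exact (mul_ne_zero_iff_left (ρ.chi_ne_zero w u))

/-- The automorphism `X^u ↦ exp(2πi⟨w, u⟩) X^u` over the series with exponents in `M`. -/
def twist (w : Fin d → ℤ) : ρ.Series →ₐ[ρ.conv ρ.M] ρ.Series where
  toFun := ρ.twistFun w
  map_one' := by
    ext u
    change ρ.chi w u * _ = _
    by_cases hu : u = 0
    · subst hu; rw [chi_zero, one_mul]
    · simp [HahnSeries.coeff_one, hu]
  map_zero' := by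
    ext u
    exact mul_zero _
  map_add' φ ψ := by
    ext u
    exact mul_add _ _ _
  map_mul' φ ψ := by
    ext u
    change ρ.chi w u * _ = _
    rw [HahnSeries.coeff_mul, HahnSeries.coeff_mul, Finset.mul_sum]
    refine Finset.sum_congr ?_ fun x hx => ?_
    · ext x
      simp only [Finset.mem_antidiagonal, support_twistFun]
    · rw [← (Finset.mem_antidiagonal.1 hx).2.2, chi_add]
      change _ = ρ.chi w x.1 * _ * (ρ.chi w x.2 * _)
      ring
  commutes' a := by
    ext u
    change ρ.chi w u * (a : ρ.Series).coeff u = (a : ρ.Series).coeff u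
    by_cases hu : (a : ρ.Series).coeff u = 0
    · rw [hu, mul_zero]
    · rw [ρ.chi_of_mem_M w (a.2.1 u hu).2, one_mul]

theorem coeff_twist (w : Fin d → ℤ) (φ : ρ.Series) (u : ρ.Expo) :
    (ρ.twist w φ).coeff u = ρ.chi w u * φ.coeff u := rfl

theorem support_twist (w : Fin d → ℤ) (φ : ρ.Series) : (ρ.twist w φ).support = φ.support :=
  ρ.support_twistFun w φ

theorem twist_mem_conv {L : AddSubgroup ρ.Expo} (w : Fin d → ℤ) {φ : ρ.Series}
    (hφ : φ ∈ ρ.conv L) : ρ.twist w φ ∈ ρ.conv L := by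
  obtain ⟨h1, ξ, hξ, h2⟩ := hφ
  refine ⟨by rwa [support_twist], ξ, hξ, ?_⟩
  simpa only [coeff_twist, norm_mul, norm_chi, one_mul] using h2

variable {ρ} in
theorem HasOrder.twist {φ : ρ.Series} {a : ρ.Expo} (h : ρ.HasOrder φ a) (w : Fin d → ℤ) :
    ρ.HasOrder (ρ.twist w φ) a :=
  ⟨mul_ne_zero (ρ.chi_ne_zero w a) h.1, by rw [support_twist]; exact h.2⟩

/-- With monodromy as an action, conjugates are orbits and degrees can be computed as indices of
stabilizers. -/
instance : AddAction (Fin d → ℤ) ρ.Series where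
  vadd w φ := ρ.twist w φ
  zero_vadd φ := by
    ext u
    change ρ.chi 0 u * _ = _
    rw [chi_zero_left, one_mul]
  add_vadd w w' φ := by
    ext u
    change ρ.chi (w + w') u * _ = ρ.chi w u * (ρ.chi w' u * _)
    rw [chi_add_left, mul_assoc]

theorem vadd_def (w : Fin d → ℤ) (φ : ρ.Series) : w +ᵥ φ = ρ.twist w φ := rfl

/-- Galois descent: a coefficient that is non-zero at `u` and invariant forces all `χ_w(u) = 1`,
that is, `u ∈ M`. -/
theorem mem_conv_M_of_twist {k : ℕ} {φ : ρ.Series} (hφ : φ ∈ ρ.conv (ρ.fracM k))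
    (h : ∀ w, ρ.twist w φ = φ) : φ ∈ ρ.conv ρ.M := by
  refine ⟨fun u hu => ⟨(hφ.1 u hu).1, ρ.mem_M_of_chi fun w => ?_⟩, hφ.2⟩
  have := congrArg (fun ψ : ρ.Series => ψ.coeff u) (h w)
  exact mul_right_cancel₀ hu (by simpa [coeff_twist] using this)

/-! ### Conjugates of a fractional power series -/

open Polynomial

theorem algebraMap_conv_injective : Function.Injective (algebraMap (ρ.conv ρ.M) ρ.Series) :=
  Subtype.val_injective

theorem aeval_twist {p : ρ.Poly} {z : ρ.Series} (h : aeval z p = 0) (w : Fin d → ℤ) :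
    aeval (w +ᵥ z) p = 0 := by
  rw [vadd_def, aeval_algHom_apply, h, map_zero]

theorem finite_orbit {p : ρ.Poly} (hp : p ≠ 0) {z : ρ.Series} (h : aeval z p = 0) :
    (AddAction.orbit (Fin d → ℤ) z).Finite := by
  refine (p.rootSet_finite ρ.Series).subset ?_
  rintro _ ⟨w, rfl⟩
  rw [mem_rootSet]
  exact ⟨hp, ρ.aeval_twist h w⟩

/-- `N` permutes the factors, so the coefficients of the product are invariant and descend by
`mem_conv_M_of_twist`. -/
theorem exists_map_eq_prod_orbit {k : ℕ} {z : ρ.Series} (hz : z ∈ ρ.conv (ρ.fracM k))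
    (hfin : (AddAction.orbit (Fin d → ℤ) z).Finite) :
    ∃ h : ρ.Poly, h.Monic ∧ h.map (algebraMap _ ρ.Series) = ∏ y ∈ hfin.toFinset, (X - C y) := by
  set P : ρ.Series[X] := ∏ y ∈ hfin.toFinset, (X - C y) with hP
  have hPm : P.Monic := monic_prod_of_monic _ _ fun y _ => monic_X_sub_C y
  -- Invariance alone gives neither convergence nor exponents in `ρ^∨`; these come from the roots.
  have h1 : P ∈ lifts (ρ.conv (ρ.fracM k)).val.toRingHom := by
    refine prod_mem fun y hy => ?_
    obtain ⟨w, rfl⟩ := hfin.mem_toFinset.1 hy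
    refine (mem_lifts _).2 ⟨X - C ⟨_, ρ.twist_mem_conv w hz⟩, ?_⟩
    simp only [Polynomial.map_sub, map_X, map_C]
    rfl
  have h2 : ∀ w : Fin d → ℤ, P.map (ρ.twist w).toRingHom = P := by
    intro w
    rw [hP, Polynomial.map_prod]
    refine Finset.prod_bij' (fun y _ => w +ᵥ y) (fun y _ => -w +ᵥ y) ?_ ?_ ?_ ?_ ?_
    · intro y hy
      rw [hfin.mem_toFinset] at hy ⊢
      exact AddAction.mapsTo_vadd_orbit w z hy
    · intro y hy
      rw [hfin.mem_toFinset] at hy ⊢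
      exact AddAction.mapsTo_vadd_orbit (-w) z hy
    · intro y _
      exact neg_vadd_vadd w y
    · intro y _
      exact vadd_neg_vadd w y
    · intro y _
      simp only [Polynomial.map_sub, map_X, map_C]
      rfl
  have h3 : P ∈ lifts (algebraMap (ρ.conv ρ.M) ρ.Series) := by
    rw [lifts_iff_coeff_lifts]
    intro n
    obtain ⟨c, hc⟩ := (lifts_iff_coeff_lifts _).1 h1 n
    refine ⟨⟨P.coeff n, ρ.mem_conv_M_of_twist (k := k) (hc ▸ c.2) fun w => ?_⟩, rfl⟩
    have := congrArg (fun Q : ρ.Series[X] => Q.coeff n) (h2 w)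
    rw [coeff_map] at this
    exact this
  obtain ⟨h, hh, -, hm⟩ := lifts_and_natDegree_eq_and_monic h3 hPm
  exact ⟨h, hm, hh⟩

/-- An irreducible polynomial with a root `z` in the fractional power series is, up to a unit, the
product of the `Y - z'` for the conjugates `z'` of `z`. -/
theorem map_eq_C_mul_prod_orbit {p : ρ.Poly} (hp : Irreducible p) {k : ℕ} {z : ρ.Series}
    (hz : z ∈ ρ.conv (ρ.fracM k)) (h0 : aeval z p = 0)
    (hfin : (AddAction.orbit (Fin d → ℤ) z).Finite) :
    ∃ c : ρ.conv ρ.M, IsUnit c ∧ p.map (algebraMap _ ρ.Series) =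
      C (c : ρ.Series) * ∏ y ∈ hfin.toFinset, (X - C y) := by
  obtain ⟨h, hm, hh⟩ := ρ.exists_map_eq_prod_orbit hz hfin
  have hp0 : p.map (algebraMap (ρ.conv ρ.M) ρ.Series) ≠ 0 :=
    (Polynomial.map_ne_zero_iff ρ.algebraMap_conv_injective).2 hp.ne_zero
  -- The orbit consists of distinct roots of `p`, so the divisibility holds over the series; it
  -- descends because `h` is monic.
  have hdvd : h ∣ p := by
    rw [← map_dvd_map _ ρ.algebraMap_conv_injective hm, hh]
    refine (Multiset.prod_X_sub_C_dvd_iff_le_roots hp0 hfin.toFinset.val).2 ?_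
    refine Multiset.le_iff_subset hfin.toFinset.nodup |>.2 fun y hy => ?_
    obtain ⟨w, rfl⟩ := hfin.mem_toFinset.1 hy
    rw [mem_roots hp0, IsRoot, eval_map, ← aeval_def]
    exact ρ.aeval_twist h0 w
  obtain ⟨k, rfl⟩ := hdvd
  have hnu : ¬ IsUnit h := by
    intro hu
    have h1 := hm.eq_one_of_isUnit hu
    rw [h1, Polynomial.map_one] at hh
    have hz' : z ∈ hfin.toFinset := hfin.mem_toFinset.2 (AddAction.mem_orbit_self z)
    have := congrArg (eval z) hh
    rw [eval_one, eval_prod, Finset.prod_eq_zero hz' (by simp)] at this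
    exact one_ne_zero this
  obtain ⟨c, hc, rfl⟩ := isUnit_iff.1 ((hp.isUnit_or_isUnit rfl).resolve_left hnu)
  refine ⟨c, hc, ?_⟩
  rw [mul_comm h, Polynomial.map_mul, hh, map_C]
  rfl

/-- The exponents of `c` and of its inverse are all `≥ 0`, so the constant terms multiply to `1`. -/
theorem hasOrder_zero_of_isUnit {c : ρ.conv ρ.M} (hc : IsUnit c) :
    ρ.HasOrder (c : ρ.Series) 0 := by
  obtain ⟨c', hc'⟩ := hc.exists_right_inv
  have h1 : (c : ρ.Series) * c' = 1 := congrArg Subtype.val hc'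
  have hle : ∀ c : ρ.conv ρ.M, ∀ u ∈ (c : ρ.Series).support, 0 ≤ u := fun c u hu => by
    rw [le_def, sub_zero]
    exact (c.2.1 u hu).1
  refine ⟨?_, hle c⟩
  have := coeff_mul_of_le (hle c) (hle c')
  rw [h1, add_zero, HahnSeries.coeff_one, if_pos rfl] at this
  exact left_ne_zero_of_mul (this.symm ▸ one_ne_zero)

/-- The difference of two roots of a quasi-ordinary polynomial has a dominating exponent. -/
theorem IsQuasiOrdinary.exists_hasOrder_sub {ρ : ToricCone d} {p : ρ.Poly}
    (hp : ρ.IsQuasiOrdinary p) {z z' : ρ.Series}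
    (h : (X - C z) * (X - C z') ∣ p.map (algebraMap _ ρ.Series)) :
    ∃ a, ρ.HasOrder (z - z') a := by
  obtain ⟨hu, δ, -, H, hH, hH0, hd⟩ := hp
  have hdiscr : ρ.HasOrder (p.discr : ρ.Series) δ :=
    IsMonomialTimesUnit.hasOrder ⟨1, one_pos, H, ⟨fun u hu => ⟨(hH.1 u hu).1, by
      change 1 • u ∈ ρ.M
      rw [one_smul]
      exact (hH.1 u hu).2⟩, hH.2⟩, hH0, hd⟩
  obtain ⟨r, hr⟩ := h
  have hroot : aeval z p = 0 := by
    rw [aeval_def, ← eval_map, hr]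
    simp
  have hdeg : 0 < p.natDegree := by
    by_contra h0
    obtain ⟨a, rfl⟩ := natDegree_eq_zero.1 (Nat.eq_zero_of_not_pos h0)
    rw [leadingCoeff_C] at hu
    rw [aeval_C] at hroot
    exact (ρ.hasOrder_zero_of_isUnit hu).ne_zero hroot
  have hder : aeval z (derivative p) = (z - z') * r.eval z := by
    rw [aeval_def, ← eval_map, ← derivative_map, hr]
    simp [derivative_mul]
  -- The resultant of `p` and `p'` is a combination of both. At the root `z` this leaves `(z - z')
  -- r(z) b(z)`, while the resultant is a unit times the discriminant and so has order `δ`. Thus `z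
  -- - z'` divides a series with a least exponent, and `HasOrder.of_mul` applies.
  obtain ⟨a, b, -, -, hab⟩ := exists_mul_add_mul_eq_C_resultant p (derivative p) le_rfl
    (natDegree_derivative_le p) (by omega)
  have hres := congrArg (aeval z) hab
  rw [map_add, map_mul, map_mul, hroot, hder, zero_mul, zero_add, aeval_C,
    resultant_deriv (natDegree_pos_iff_degree_pos.1 hdeg)] at hres
  have hord : ρ.HasOrder ((z - z') * (r.eval z * aeval z b)) (0 + 0 + δ) := by
    rw [← mul_assoc, hres]
    refine HasOrder.mul (HasOrder.mul (ρ.hasOrder_zero_of_isUnit ?_) (ρ.hasOrder_zero_of_isUnit hu))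
      hdiscr
    exact (isUnit_one.neg).pow _
  exact hord.of_mul

end ToricCone

namespace ToricCone
variable {d : ℕ} (ρ : ToricCone d)

/-! ### Annihilators of lattices -/

/-- The elements of `N` acting trivially on the series with exponents in `L`. -/
def ann (L : AddSubgroup ρ.Expo) : AddSubgroup (Fin d → ℤ) where
  carrier := {w | ∀ u ∈ L, ρ.chi w u = 1}
  zero_mem' u _ := ρ.chi_zero_left u
  add_mem' {w w'} h h' u hu := by rw [chi_add_left, h u hu, h' u hu, one_mul]
  neg_mem' {w} h u hu := by
    have := ρ.chi_add_left w (-w) u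
    rw [add_neg_cancel, chi_zero_left, h u hu, one_mul] at this
    exact this.symm

theorem ann_anti {L L' : AddSubgroup ρ.Expo} (h : L ≤ L') : ρ.ann L' ≤ ρ.ann L :=
  fun _ hw u hu => hw u (h hu)

theorem ann_M : ρ.ann ρ.M = ⊤ := eq_top_iff.2 fun w _ _ hu => ρ.chi_of_mem_M w hu

/-- The elements of `M_ℝ` killed by `w`, as a subgroup. -/
def chiKer (w : Fin d → ℤ) : AddSubgroup ρ.Expo where
  carrier := {u | ρ.chi w u = 1}
  zero_mem' := ρ.chi_zero w
  add_mem' {u v} h h' := by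
    change ρ.chi w (u + v) = 1
    rw [chi_add, h, h', one_mul]
  neg_mem' {u} h := by
    have := ρ.chi_add w u (-u)
    rw [add_neg_cancel, chi_zero, h, one_mul] at this
    exact this.symm

theorem chi_nsmul (w : Fin d → ℤ) (m : ℕ) (u : ρ.Expo) : ρ.chi w (m • u) = ρ.chi w u ^ m := by
  induction m with
  | zero => rw [zero_smul, chi_zero, pow_zero]
  | succ m ih => rw [succ_nsmul, chi_add, ih, pow_succ]

theorem mem_ann_sup {L L' : AddSubgroup ρ.Expo} {w : Fin d → ℤ} :
    w ∈ ρ.ann (L ⊔ L') ↔ w ∈ ρ.ann L ∧ w ∈ ρ.ann L' := by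
  refine ⟨fun h => ⟨ρ.ann_anti le_sup_left h, ρ.ann_anti le_sup_right h⟩, fun h => ?_⟩
  have : L ⊔ L' ≤ ρ.chiKer w := sup_le (fun u hu => h.1 u hu) fun u hu => h.2 u hu
  exact fun u hu => this hu

theorem mem_ann_closure {s : Set ρ.Expo} {w : Fin d → ℤ} :
    w ∈ ρ.ann (AddSubgroup.closure s) ↔ ∀ u ∈ s, ρ.chi w u = 1 := by
  refine ⟨fun h u hu => h u (AddSubgroup.subset_closure hu), fun h => ?_⟩
  have : AddSubgroup.closure s ≤ ρ.chiKer w := (AddSubgroup.closure_le _).2 h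
  exact fun u hu => this hu

theorem M_le_fracM (k : ℕ) : ρ.M ≤ ρ.fracM k := fun _ hu => AddSubgroup.nsmul_mem _ hu k

theorem fracM_le_mul_left (k l : ℕ) : ρ.fracM k ≤ ρ.fracM (l * k) := fun u hu => by
  change (l * k) • u ∈ ρ.M
  rw [mul_smul]
  exact AddSubgroup.nsmul_mem ρ.M hu l

/-- A lattice is the annihilator of its annihilator. -/
theorem mem_of_chi_eq_one {L : AddSubgroup ρ.Expo} {k : ℕ} (hk : 0 < k) (hM : ρ.M ≤ L)
    (hL : L ≤ ρ.fracM k) {u : ρ.Expo} (hu : u ∈ ρ.fracM k)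
    (h : ∀ w ∈ ρ.ann L, ρ.chi w u = 1) : u ∈ L := by
  classical
  by_contra hnot
  have hne : (QuotientAddGroup.mk u : ρ.Expo ⧸ L) ≠ 0 := by
    rwa [Ne, QuotientAddGroup.eq_zero_iff]
  -- The class of `u` modulo `L` is detected by a character into `ℚ/ℤ`. On `(1/k)M` this character
  -- will be pairing with an integral vector `w`.
  obtain ⟨c, hc⟩ := CharacterModule.exists_character_apply_ne_zero_of_ne_zero hne
  have hk' : (k : ℝ) ≠ 0 := by positivity
  have hkq : (k : ℚ) ≠ 0 := by positivity
  let b : Fin d → ρ.Expo := fun i => (fun j => if j = i then (k : ℝ)⁻¹ else 0 : Fin d → ℝ)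
  let φ : ρ.Expo →+ AddCircle (1 : ℚ) :=
    AddMonoidHom.comp (show (ρ.Expo ⧸ L) →+ AddCircle (1 : ℚ) from c) (QuotientAddGroup.mk' L)
  have hφL : ∀ v ∈ L, φ v = 0 := fun v hv => by
    have : (QuotientAddGroup.mk' L) v = 0 := (QuotientAddGroup.eq_zero_iff v).2 hv
    change c (QuotientAddGroup.mk' L v) = 0
    rw [this, map_zero]
  have hb : ∀ i, k • b i ∈ ρ.M := fun i => by
    rw [mem_M_iff]
    intro j
    refine ⟨if j = i then 1 else 0, ?_⟩
    change (k • (fun j => if j = i then (k : ℝ)⁻¹ else 0 : Fin d → ℝ)) j = _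
    rw [Pi.smul_apply]
    split_ifs with h <;> simp [hk']
  -- `b i` is the `i`-th unit vector over `k`, so `k • b i ∈ M ⊆ L` and `φ (b i)` is `k`-torsion in
  -- `ℚ/ℤ`, of the form `m / k`. These `m` are the coordinates of `w`.
  have hw : ∀ i, ∃ m : ℤ, φ (b i) = ((m / k : ℚ) : AddCircle (1 : ℚ)) := fun i => by
    obtain ⟨x, hx⟩ := QuotientAddGroup.mk_surjective (φ (b i))
    have h1 : k • φ (b i) = 0 := by rw [← map_nsmul, hφL _ (hM (hb i))]
    rw [← hx] at h1
    have h2 : ((k • x : ℚ) : AddCircle (1 : ℚ)) = 0 := h1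
    obtain ⟨m, hm⟩ := AddCircle.coe_eq_zero_iff (1 : ℚ) |>.1 h2
    refine ⟨m, ?_⟩
    rw [← hx]
    change (x : AddCircle (1 : ℚ)) = _
    congr 1
    rw [eq_div_iff hkq]
    simp at hm
    linarith
  choose w hw using hw
  have key : ∀ v ∈ ρ.fracM k, (φ v = 0 ↔ ρ.chi w v = 1) := by
    intro v hv
    choose m hm using ρ.mem_M_iff.1 (show k • v ∈ ρ.M from hv)
    have hm' : ∀ i, (show Fin d → ℝ from v) i = m i / k := fun i => by
      rw [eq_div_iff hk', ← hm i, mul_comm]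
      change _ = (k • (show Fin d → ℝ from v)) i
      rw [Pi.smul_apply, nsmul_eq_mul]
    have hv' : v = ∑ i, m i • b i := by
      have : (show Fin d → ℝ from v) = ∑ i, m i • (show Fin d → ℝ from b i) := by
        funext j
        rw [Finset.sum_apply, Finset.sum_eq_single j, hm' j]
        · simp [b, div_eq_mul_inv]
        · intro i _ hi
          simp [b, hi.symm]
        · simp
      exact this
    have h1 : φ v = ((∑ i, m i * w i / k : ℚ) : AddCircle (1 : ℚ)) := by
      rw [hv', map_sum]
      have : ((∑ i, m i * w i / k : ℚ) : AddCircle (1 : ℚ)) =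
          ∑ i, ((m i * w i / k : ℚ) : AddCircle (1 : ℚ)) :=
        map_sum (QuotientAddGroup.mk' _) _ _
      rw [this]
      refine Finset.sum_congr rfl fun i _ => ?_
      rw [map_zsmul, hw i, ← AddCircle.coe_zsmul]
      congr 1
      rw [zsmul_eq_mul, mul_div_assoc]
    have h2 : ρ.intPair w v = ((∑ i, m i * w i / k : ℚ) : ℝ) := by
      push_cast
      change ∑ i, (w i : ℝ) * (show Fin d → ℝ from v) i = _
      refine Finset.sum_congr rfl fun i _ => ?_
      rw [hm' i]
      ring
    rw [h1, AddCircle.coe_eq_zero_iff, chi_eq_one_iff, h2]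
    refine exists_congr fun m => ?_
    rw [zsmul_eq_mul, mul_one, eq_comm]
    exact_mod_cast Iff.rfl
  -- `w` annihilates `L` because `φ` does, so `χ_w(u) = 1` by hypothesis, contradicting `φ u ≠ 0`.
  exact hc ((key u hu).2 (h w fun v hv => (key v (hL hv)).1 (hφL v hv)))

/-- `w ↦ exp(2πi⟨w, u⟩)` as a homomorphism. -/
def chiHom (u : ρ.Expo) : (Fin d → ℤ) →+ Additive ℂˣ where
  toFun w := Additive.ofMul (Units.mk0 (ρ.chi w u) (ρ.chi_ne_zero w u))
  map_zero' := congrArg Additive.ofMul (Units.ext (ρ.chi_zero_left u))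
  map_add' w w' := congrArg Additive.ofMul (Units.ext (ρ.chi_add_left w w' u))

theorem chiHom_eq_zero_iff {u : ρ.Expo} {w : Fin d → ℤ} : ρ.chiHom u w = 0 ↔ ρ.chi w u = 1 := by
  change Units.mk0 (ρ.chi w u) (ρ.chi_ne_zero w u) = 1 ↔ _
  rw [Units.ext_iff]
  rfl

theorem relIndex_sup_zmultiples (L : AddSubgroup ρ.Expo) (a : ρ.Expo) :
    L.relIndex (L ⊔ AddSubgroup.zmultiples a) =
      addOrderOf (QuotientAddGroup.mk a : ρ.Expo ⧸ L) := by
  rw [AddSubgroup.relIndex_sup_left]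
  conv_lhs => rw [← QuotientAddGroup.ker_mk' L]
  rw [AddSubgroup.relIndex_ker, AddMonoidHom.map_zmultiples, Nat.card_zmultiples]
  rfl

/-- Let `n` be the order of `a` modulo `L`. The map `w ↦ χ_w(a)` embeds the quotient of annihilators
into the `n`-th roots of unity, giving `≤`. If its image has order `m`, then `m • a` is killed by
`ann L`, hence lies in `L` by `mem_of_chi_eq_one`, so `n ∣ m`. -/
theorem relIndex_ann {L : AddSubgroup ρ.Expo} {k : ℕ} (hk : 0 < k) (hM : ρ.M ≤ L)
    (hL : L ≤ ρ.fracM k) {a : ρ.Expo} (ha : a ∈ ρ.fracM k) :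
    (ρ.ann (L ⊔ AddSubgroup.zmultiples a)).relIndex (ρ.ann L) =
      L.relIndex (L ⊔ AddSubgroup.zmultiples a) := by
  rw [relIndex_sup_zmultiples]
  set n := addOrderOf (QuotientAddGroup.mk a : ρ.Expo ⧸ L) with hn
  have hna : n • a ∈ L := by
    rw [← QuotientAddGroup.eq_zero_iff]
    exact addOrderOf_nsmul_eq_zero (QuotientAddGroup.mk a : ρ.Expo ⧸ L)
  have hn0 : n ≠ 0 := by
    have : k • (QuotientAddGroup.mk a : ρ.Expo ⧸ L) = 0 :=
      (QuotientAddGroup.eq_zero_iff _).2 (hM ha)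
    exact (addOrderOf_pos_iff.2 (isOfFinAddOrder_iff_nsmul_eq_zero.2 ⟨k, hk, this⟩)).ne'
  have : NeZero n := ⟨hn0⟩
  have h1 : ρ.ann (L ⊔ AddSubgroup.zmultiples a) = (ρ.chiHom a).ker ⊓ ρ.ann L := by
    ext w
    rw [mem_ann_sup, AddSubgroup.mem_inf, and_comm, AddMonoidHom.mem_ker, chiHom_eq_zero_iff,
      AddSubgroup.zmultiples_eq_closure, mem_ann_closure]
    simp
  rw [h1, AddSubgroup.inf_relIndex_right, AddSubgroup.relIndex_ker]
  set S := (ρ.ann L).map (ρ.chiHom a) with hS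
  let ι : S → rootsOfUnity n ℂ := fun s => ⟨s.1.toMul, by
    obtain ⟨_, w, hw, rfl⟩ := s
    rw [mem_rootsOfUnity, Units.ext_iff]
    change ρ.chi w a ^ n = 1
    rw [← chi_nsmul]
    exact hw _ hna⟩
  have hι : Function.Injective ι := fun s t h => Subtype.ext (Subtype.mk.inj h)
  have : Finite S := Finite.of_injective ι hι
  refine le_antisymm ((Nat.card_le_card_of_injective ι hι).trans (card_rootsOfUnity ℂ n)) ?_
  refine Nat.le_of_dvd Nat.card_pos ?_
  rw [hn]
  refine addOrderOf_dvd_of_nsmul_eq_zero ((QuotientAddGroup.eq_zero_iff (Nat.card S • a)).2 ?_)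
  refine ρ.mem_of_chi_eq_one hk hM hL (AddSubgroup.nsmul_mem _ ha _) fun w hw => ?_
  have h2 : Nat.card S • (⟨ρ.chiHom a w, w, hw, rfl⟩ : S) = 0 := card_nsmul_eq_zero'
  have h3 : Nat.card S • ρ.chiHom a w = 0 := congrArg Subtype.val h2
  rw [chi_nsmul]
  exact congrArg Units.val (congrArg Additive.toMul h3)

end ToricCone

namespace Branch
variable {d : ℕ} {ρ : ToricCone d} (Z : Branch ρ)

open Polynomial ToricCone

/-! ### Conjugates of a branch and the characteristic lattices -/

theorem natDegree_pos : 0 < Z.f.natDegree := by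
  by_contra h
  have h1 := Z.monic.natDegree_eq_zero.1 (Nat.eq_zero_of_not_pos h)
  exact Z.irreducible.not_isUnit (h1 ▸ isUnit_one)

theorem orbit_finite : (AddAction.orbit (Fin d → ℤ) Z.ζ).Finite :=
  ρ.finite_orbit Z.irreducible.ne_zero Z.root

theorem mem_orbit_of_aeval_eq_zero {z : ρ.Series} (hz : aeval z Z.f = 0) :
    ∃ w : Fin d → ℤ, ρ.twist w Z.ζ = z := by
  obtain ⟨c, hc, h⟩ := ρ.map_eq_C_mul_prod_orbit Z.irreducible Z.ζ_mem Z.root Z.orbit_finite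
  rw [aeval_def, ← eval_map, h, eval_mul, eval_C, eval_prod] at hz
  have h1 := (mul_eq_zero.1 hz).resolve_left (ρ.hasOrder_zero_of_isUnit hc).ne_zero
  obtain ⟨y, hy, hy0⟩ := Finset.prod_eq_zero_iff.1 h1
  obtain ⟨w, hw⟩ := Z.orbit_finite.mem_toFinset.1 hy
  refine ⟨w, hw.trans ?_⟩
  rw [eval_sub, eval_X, eval_C, sub_eq_zero] at hy0
  exact hy0.symm

theorem twist_root (w : Fin d → ℤ) : aeval (ρ.twist w Z.ζ) Z.f = 0 := ρ.aeval_twist Z.root w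

/-- Two distinct roots of `f` have a difference with a least exponent, which is characteristic by
definition. -/
theorem exists_hasOrder_sub_twist {w : Fin d → ℤ} (hw : ρ.twist w Z.ζ ≠ Z.ζ) :
    ∃ i, ρ.HasOrder (Z.ζ - ρ.twist w Z.ζ) (Z.lam i) := by
  have hdvd : (X - C Z.ζ) * (X - C (ρ.twist w Z.ζ)) ∣ Z.f.map (algebraMap _ ρ.Series) := by
    obtain ⟨r, hr⟩ := dvd_iff_isRoot.2
      (show IsRoot (Z.f.map (algebraMap _ ρ.Series)) Z.ζ by
        rw [IsRoot, eval_map, ← aeval_def, Z.root])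
    have h1 : eval (ρ.twist w Z.ζ) (Z.f.map (algebraMap _ ρ.Series)) = 0 := by
      rw [eval_map, ← aeval_def, Z.twist_root]
    rw [hr, eval_mul, eval_sub, eval_X, eval_C] at h1
    obtain ⟨r', rfl⟩ := dvd_iff_isRoot.2 ((mul_eq_zero.1 h1).resolve_left (sub_ne_zero.2 hw))
    exact ⟨r', by rw [hr, mul_assoc]⟩
  obtain ⟨a, ha⟩ := Z.quasiOrdinary.exists_hasOrder_sub hdvd
  have hm := ρ.twist_mem_conv w Z.ζ_mem
  have : a ∈ ρ.charExponents Z.f := ⟨Z.ζ, ρ.twist w Z.ζ, hw.symm,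
    ⟨⟨_, Z.natDegree_pos, Z.ζ_mem⟩, Z.root⟩, ⟨⟨_, Z.natDegree_pos, hm⟩, Z.twist_root w⟩,
    ha.isMonomialTimesUnit Z.natDegree_pos (sub_mem Z.ζ_mem hm)⟩
  rw [← Z.range_lam] at this
  obtain ⟨i, rfl⟩ := this
  exact ⟨i, ha⟩

theorem twist_neg_twist (w : Fin d → ℤ) (φ : ρ.Series) : ρ.twist (-w) (ρ.twist w φ) = φ :=
  neg_vadd_vadd w φ

theorem twist_add (w w' : Fin d → ℤ) (φ : ρ.Series) :
    ρ.twist (w + w') φ = ρ.twist w (ρ.twist w' φ) := add_vadd w w' φ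

/-- Twisting preserves orders, so of the two roots realising `λ` the first may be moved to `ζ`. -/
theorem exists_twist_hasOrder (i : Fin Z.g) :
    ∃ w : Fin d → ℤ, ρ.HasOrder (Z.ζ - ρ.twist w Z.ζ) (Z.lam i) := by
  have : Z.lam i ∈ ρ.charExponents Z.f := Z.range_lam ▸ ⟨i, rfl⟩
  obtain ⟨z, z', -, hz, hz', h⟩ := this
  obtain ⟨w, rfl⟩ := Z.mem_orbit_of_aeval_eq_zero hz.2
  obtain ⟨w', rfl⟩ := Z.mem_orbit_of_aeval_eq_zero hz'.2
  refine ⟨-w + w', ?_⟩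
  have h1 := h.hasOrder.twist (-w)
  rwa [map_sub, twist_neg_twist, ← twist_add] at h1

/-- Twisting multiplies the coefficient at `u` by `χ_w(u)`, so the difference carries the factor `1
- χ_w(u)`. -/
theorem mem_support_sub_twist {w : Fin d → ℤ} {u : ρ.Expo} :
    u ∈ (Z.ζ - ρ.twist w Z.ζ).support ↔ u ∈ Z.ζ.support ∧ ρ.chi w u ≠ 1 := by
  rw [HahnSeries.mem_support, HahnSeries.coeff_sub, coeff_twist, ← one_sub_mul, mul_ne_zero_iff,
    and_comm, HahnSeries.mem_support, sub_ne_zero, ne_comm (a := (1 : ℂ))]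

theorem lam_mem_support (i : Fin Z.g) : Z.lam i ∈ Z.ζ.support := by
  obtain ⟨w, hw⟩ := Z.exists_twist_hasOrder i
  exact (Z.mem_support_sub_twist.1 hw.1).1

theorem lam_mem_fracM (i : Fin Z.g) : Z.lam i ∈ ρ.fracM Z.f.natDegree :=
  (Z.ζ_mem.1 _ (Z.lam_mem_support i)).2

theorem M_le_lattice (i : ℕ) : ρ.M ≤ Z.lattice i := le_sup_left

theorem lattice_le_fracM (i : ℕ) : Z.lattice i ≤ ρ.fracM Z.f.natDegree := by
  refine sup_le (ρ.M_le_fracM _) ((AddSubgroup.closure_le _).2 ?_)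
  rintro _ ⟨k, -, rfl⟩
  exact Z.lam_mem_fracM k

theorem lattice_mono : Monotone Z.lattice := fun i j h => by
  refine sup_le_sup_left (AddSubgroup.closure_mono ?_) _
  rintro _ ⟨k, hk, hu⟩
  exact ⟨k, hk.trans_le h, hu⟩

theorem lam_mem_lattice (k : Fin Z.g) {i : ℕ} (h : (k : ℕ) < i) : Z.lam k ∈ Z.lattice i :=
  AddSubgroup.mem_sup_right (AddSubgroup.subset_closure ⟨k, h, rfl⟩)

theorem lattice_succ (i : Fin Z.g) :
    Z.lattice (i + 1) = Z.lattice i ⊔ AddSubgroup.zmultiples (Z.lam i) := by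
  refine le_antisymm (sup_le (le_sup_of_le_left (Z.M_le_lattice i)) ?_)
    (sup_le (Z.lattice_mono (Nat.le_succ _)) ?_)
  · rw [AddSubgroup.closure_le]
    rintro _ ⟨k, hk, rfl⟩
    rcases (Nat.lt_succ_iff.1 hk).lt_or_eq with h | h
    · exact AddSubgroup.mem_sup_left (Z.lam_mem_lattice k h)
    · rw [Fin.ext h]
      exact AddSubgroup.mem_sup_right (AddSubgroup.mem_zmultiples _)
  · rw [AddSubgroup.zmultiples_le]
    exact Z.lam_mem_lattice i (Nat.lt_succ_self _)

theorem lattice_zero : Z.lattice 0 = ρ.M := by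
  refine le_antisymm (sup_le le_rfl ((AddSubgroup.closure_le _).2 ?_)) (Z.M_le_lattice 0)
  rintro _ ⟨k, hk, -⟩
  exact absurd hk (Nat.not_lt_zero _)

/-- The annihilator of the `i`-th characteristic lattice. -/
def annLattice (i : ℕ) : AddSubgroup (Fin d → ℤ) := ρ.ann (Z.lattice i)

theorem annLattice_anti : Antitone Z.annLattice := fun _ _ h => ρ.ann_anti (Z.lattice_mono h)

theorem mem_annLattice {i : ℕ} {w : Fin d → ℤ} :
    w ∈ Z.annLattice i ↔ ∀ k : Fin Z.g, (k : ℕ) < i → ρ.chi w (Z.lam k) = 1 := by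
  refine ⟨fun h k hk => h _ (Z.lam_mem_lattice k hk), fun h => ?_⟩
  refine ρ.mem_ann_sup.2 ⟨ρ.ann_M.symm ▸ AddSubgroup.mem_top w, ρ.mem_ann_closure.2 ?_⟩
  rintro _ ⟨k, hk, rfl⟩
  exact h k hk

theorem mem_annLattice_succ {i : Fin Z.g} {w : Fin d → ℤ} (hw : w ∈ Z.annLattice i) :
    w ∈ Z.annLattice (i + 1) ↔ ρ.chi w (Z.lam i) = 1 := by
  rw [mem_annLattice] at hw ⊢
  refine ⟨fun h => h i (Nat.lt_succ_self _), fun h k hk => ?_⟩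
  rcases (Nat.lt_succ_iff.1 hk).lt_or_eq with hlt | heq
  · exact hw k hlt
  · rwa [Fin.ext heq]

/-- The first exponent of `ζ` not killed by `w` is a characteristic exponent. -/
theorem exists_hasOrder_of_chi_ne_one {i : ℕ} {w : Fin d → ℤ} (hw : w ∈ Z.annLattice i)
    {u : ρ.Expo} (hu : u ∈ Z.ζ.support) (h : ρ.chi w u ≠ 1) :
    ∃ k : Fin Z.g, i ≤ k ∧ ρ.HasOrder (Z.ζ - ρ.twist w Z.ζ) (Z.lam k) ∧ Z.lam k ≤ u := by
  have hmem := Z.mem_support_sub_twist.2 ⟨hu, h⟩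
  have hne : ρ.twist w Z.ζ ≠ Z.ζ := fun h0 => by
    rw [h0, sub_self] at hmem
    exact hmem rfl
  obtain ⟨k, hk⟩ := Z.exists_hasOrder_sub_twist hne
  refine ⟨k, ?_, hk, hk.2 u hmem⟩
  -- An exponent `Z.lam k` with `k < i` is killed by `w`, so it cannot survive in the difference.
  by_contra hlt
  exact (Z.mem_support_sub_twist.1 hk.1).2 (Z.mem_annLattice.1 hw k (not_le.1 hlt))

/-- If `w` annihilates `M_g` but `χ_w(u) ≠ 1`, then `w` would produce a characteristic exponent of
index at least `g`. So `χ_w(u) = 1` for all such `w`, and biduality puts `u` in `M_g`. -/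
theorem support_subset_lattice {u : ρ.Expo} (hu : u ∈ Z.ζ.support) : u ∈ Z.lattice Z.g := by
  refine ρ.mem_of_chi_eq_one Z.natDegree_pos (Z.M_le_lattice _) (Z.lattice_le_fracM _)
    (Z.ζ_mem.1 u hu).2 fun w hw => ?_
  by_contra h
  obtain ⟨k, hk, -⟩ := Z.exists_hasOrder_of_chi_ne_one hw hu h
  exact absurd k.2 (not_lt.2 hk)

/-- `Z.lam i` survives in the difference, so the order is some `Z.lam k ≤ Z.lam i`, while `i ≤ k`
because `w` annihilates the earlier exponents. -/
theorem hasOrder_sub_twist {i : Fin Z.g} {w : Fin d → ℤ} (hw : w ∈ Z.annLattice i)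
    (hw' : w ∉ Z.annLattice (i + 1)) : ρ.HasOrder (Z.ζ - ρ.twist w Z.ζ) (Z.lam i) := by
  rw [Z.mem_annLattice_succ hw] at hw'
  obtain ⟨k, hk, ho, hle⟩ := Z.exists_hasOrder_of_chi_ne_one hw (Z.lam_mem_support i) hw'
  rw [Z.lam_strictMono.le_iff_le] at hle
  rwa [le_antisymm hle hk] at ho

theorem lam_le_of_mem_support {j : Fin Z.g} {w : Fin d → ℤ} (hw : w ∈ Z.annLattice j) :
    ∀ u ∈ (Z.ζ - ρ.twist w Z.ζ).support, Z.lam j ≤ u := by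
  intro u hu
  obtain ⟨hu, h⟩ := Z.mem_support_sub_twist.1 hu
  obtain ⟨k, hk, -, hle⟩ := Z.exists_hasOrder_of_chi_ne_one hw hu h
  exact (Z.lam_strictMono.monotone hk).trans hle

/-- The support of `ζ` contains all the characteristic exponents and lies in `M_g`, the lattice they
generate with `M`. -/
theorem stabilizer_ζ : AddAction.stabilizer (Fin d → ℤ) Z.ζ = Z.annLattice Z.g := by
  ext w
  rw [AddAction.mem_stabilizer_iff]
  constructor
  · intro h
    refine Z.mem_annLattice.2 fun k _ => ?_
    by_contra hk
    have := Z.mem_support_sub_twist.2 ⟨Z.lam_mem_support k, hk⟩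
    rw [← vadd_def, h, sub_self] at this
    exact this rfl
  · intro h
    ext u
    rw [vadd_def, coeff_twist]
    by_cases hu : Z.ζ.coeff u = 0
    · rw [hu, mul_zero]
    · rw [h u (Z.support_subset_lattice hu), one_mul]

theorem relIndex_annLattice_succ {i : ℕ} (hi : i < Z.g) :
    (Z.annLattice (i + 1)).relIndex (Z.annLattice i) = Z.charInt i := by
  have h := Z.lattice_succ ⟨i, hi⟩
  rw [annLattice, annLattice, charInt, h]
  exact ρ.relIndex_ann Z.natDegree_pos (Z.M_le_lattice i) (Z.lattice_le_fracM i)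
    (Z.lam_mem_fracM _)

theorem relIndex_annLattice {i j : ℕ} (hij : i ≤ j) (hj : j ≤ Z.g) :
    (Z.annLattice j).relIndex (Z.annLattice i) = ∏ k ∈ Finset.Ico i j, Z.charInt k := by
  induction j, hij using Nat.le_induction with
  | base => simp
  | succ j hij ih =>
    rw [Finset.prod_Ico_succ_top hij, ← ih (Nat.le_of_succ_le hj),
      ← Z.relIndex_annLattice_succ hj, mul_comm]
    exact (AddSubgroup.relIndex_mul_relIndex _ _ _ (Z.annLattice_anti (Nat.le_succ j))
      (Z.annLattice_anti hij)).symm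

theorem annLattice_zero : Z.annLattice 0 = ⊤ := by rw [annLattice, lattice_zero, ann_M]

theorem index_annLattice {j : ℕ} (hj : j ≤ Z.g) :
    (Z.annLattice j).index = ∏ k ∈ Finset.range j, Z.charInt k := by
  rw [Finset.range_eq_Ico, ← Z.relIndex_annLattice (Nat.zero_le j) hj, annLattice_zero,
    AddSubgroup.relIndex_top_right]

theorem natDegree_eq_ncard_orbit {p : ρ.Poly} (hp : Irreducible p) {k : ℕ} {z : ρ.Series}
    (hz : z ∈ ρ.conv (ρ.fracM k)) (h0 : aeval z p = 0) :
    p.natDegree = (AddAction.orbit (Fin d → ℤ) z).ncard := by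
  have hfin := ρ.finite_orbit hp.ne_zero h0
  obtain ⟨c, hc, h⟩ := ρ.map_eq_C_mul_prod_orbit hp hz h0 hfin
  rw [← natDegree_map_eq_of_injective ρ.algebraMap_conv_injective, h,
    natDegree_C_mul (ρ.hasOrder_zero_of_isUnit hc).ne_zero, natDegree_finsetProd_X_sub_C_eq_card,
    Set.ncard_eq_toFinset_card _ hfin]

/-- Orbit–stabilizer for `ζ`. This is why the box `v_i < n_i` has room for all remainders modulo
`f`. -/
theorem natDegree_eq : Z.f.natDegree = ∏ k ∈ Finset.range Z.g, Z.charInt k := by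
  rw [natDegree_eq_ncard_orbit Z.irreducible Z.ζ_mem Z.root, ← AddAction.index_stabilizer,
    stabilizer_ζ, Z.index_annLattice le_rfl]

/-- A relative index is `0` when infinite; here the product of the indices is the positive degree of
`f`. -/
theorem charInt_pos {i : ℕ} (hi : i < Z.g) : 0 < Z.charInt i := by
  have h := Z.natDegree_pos.ne'
  rw [natDegree_eq, Finset.prod_ne_zero_iff] at h
  exact Nat.pos_of_ne_zero (h i (Finset.mem_range.2 hi))

theorem ζ_mem_bigRing : Z.ζ ∈ Z.bigRing :=
  ⟨fun u hu => ⟨(Z.ζ_mem.1 u hu).1, Z.support_subset_lattice hu⟩, Z.ζ_mem.2⟩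

end Branch

namespace Branch
variable {d : ℕ} {ρ : ToricCone d} (Z : Branch ρ)

open Polynomial ToricCone

/-! ### The order of a semi-root along the branch -/

/-- The characteristic exponents, extended by `0`. -/
def lamNat (i : ℕ) : ρ.Expo := if h : i < Z.g then Z.lam ⟨i, h⟩ else 0

theorem lamNat_eq (i : Fin Z.g) : Z.lamNat i = Z.lam i := dif_pos i.2

/-- Unrolled recursion. The multiplicity of `lamNat (i + 1) - lamNat i` is the number of conjugates
under `annLattice (i + 1)` of a suitable root of the semi-root, which is how it reappears in
`IsSemiRoot.hasOrder`. -/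
theorem gammaAux_eq {j : ℕ} (hj : j < Z.g) : Z.gammaAux j hj =
    (∏ k ∈ Finset.range j, Z.charInt k) • Z.lamNat 0 + ∑ i ∈ Finset.range j,
      (∏ k ∈ Finset.Ico (i + 1) j, Z.charInt k) • (Z.lamNat (i + 1) - Z.lamNat i) := by
  induction j with
  | zero => simp [gammaAux, lamNat, hj]
  | succ j ih =>
    have h1 := ih (Nat.lt_of_succ_lt hj)
    have h2 := Z.lamNat_eq ⟨j + 1, hj⟩
    have h3 := Z.lamNat_eq ⟨j, Nat.lt_of_succ_lt hj⟩
    simp only at h2 h3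
    rw [gammaAux, h1, ← h2, ← h3, Finset.sum_range_succ, Finset.Ico_self, Finset.prod_empty,
      one_smul, smul_add, smul_smul, Finset.prod_range_succ, mul_comm (Z.charInt j), Finset.smul_sum,
      add_sub_assoc, ← add_assoc]
    congr 2
    refine Finset.sum_congr rfl fun i hi => ?_
    rw [smul_smul, Finset.prod_Ico_succ_top (Finset.mem_range.1 hi), mul_comm]

theorem dvd_map_mul {f q : ρ.Poly} {z z' : ρ.Series} (hz : aeval z f = 0) (hz' : aeval z' q = 0) :
    (X - C z) * (X - C z') ∣ (f * q).map (algebraMap _ ρ.Series) := by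
  rw [Polynomial.map_mul]
  refine mul_dvd_mul (dvd_iff_isRoot.2 ?_) (dvd_iff_isRoot.2 ?_)
  · rw [IsRoot, eval_map, ← aeval_def, hz]
  · rw [IsRoot, eval_map, ← aeval_def, hz']

variable {Z}

/-- A semi-root has a root whose difference with `ζ` has the largest possible order. -/
theorem IsSemiRoot.exists_root {j : Fin Z.g} {q : ρ.Poly} (hq : Z.IsSemiRoot j q) :
    ∃ y k, 0 < k ∧ y ∈ ρ.conv (ρ.fracM k) ∧ aeval y q = 0 ∧ ρ.HasOrder (Z.ζ - y) (Z.lam j) := by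
  obtain ⟨z, z', ⟨-, hz⟩, ⟨⟨k, hk, hz'⟩, hq0⟩, h⟩ := hq.2.2.2.2.1
  -- The largest exponent is attained at some root of `f`; that root is a conjugate of `ζ`, and
  -- twisting back moves it to `ζ`.
  obtain ⟨w, rfl⟩ := Z.mem_orbit_of_aeval_eq_zero hz
  refine ⟨ρ.twist (-w) z', k, hk, ρ.twist_mem_conv _ hz', ρ.aeval_twist hq0 _, ?_⟩
  have := h.hasOrder.twist (-w)
  rwa [map_sub, twist_neg_twist] at this

/-- `y` and `ζ` have the same non-zero coefficients at the exponents `Z.lam i` with `i < j`, so a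
twist fixing `y` annihilates these. The degree of `q` excludes a smaller stabilizer. -/
theorem IsSemiRoot.stabilizer_eq {j : Fin Z.g} {q : ρ.Poly} (hq : Z.IsSemiRoot j q) {y : ρ.Series}
    {k : ℕ} (hy : y ∈ ρ.conv (ρ.fracM k)) (h0 : aeval y q = 0)
    (hord : ρ.HasOrder (Z.ζ - y) (Z.lam j)) :
    AddAction.stabilizer (Fin d → ℤ) y = Z.annLattice j := by
  have hle : AddAction.stabilizer (Fin d → ℤ) y ≤ Z.annLattice j := by
    intro w hw
    rw [AddAction.mem_stabilizer_iff, vadd_def] at hw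
    refine Z.mem_annLattice.2 fun i hi => ?_
    have h1 : (Z.ζ - y).coeff (Z.lam i) = 0 := by
      by_contra h1
      exact (hord.2 _ h1).not_gt (Z.lam_strictMono hi)
    rw [HahnSeries.coeff_sub, sub_eq_zero] at h1
    have h2 := congrArg (fun φ : ρ.Series => φ.coeff (Z.lam i)) hw
    have h3 : y.coeff (Z.lam i) ≠ 0 := h1 ▸ Z.lam_mem_support i
    exact mul_right_cancel₀ h3 (by simpa [coeff_twist] using h2)
  refine le_antisymm hle (AddSubgroup.relIndex_eq_one.1 ?_)
  -- Both indices are `n_1 ⋯ n_j`: the first counts the roots of `q`, the second is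
  -- `index_annLattice`.
  have h1 : (AddAction.stabilizer (Fin d → ℤ) y).index = (Z.annLattice j).index := by
    rw [AddAction.index_stabilizer, ← natDegree_eq_ncard_orbit hq.1 hy h0, hq.2.2.1,
      Z.index_annLattice j.2.le]
  have h2 := AddSubgroup.relIndex_mul_index hle
  rw [h1] at h2
  refine Nat.eq_of_mul_eq_mul_right (Nat.pos_of_ne_zero ?_) (h2.trans (one_mul _).symm)
  rw [Z.index_annLattice j.2.le, Finset.prod_ne_zero_iff]
  exact fun i hi => (Z.charInt_pos ((Finset.mem_range.1 hi).trans j.2)).ne'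

/-- Maximality of the order of coincidence bounds the exponent above. The splitting `(ζ - w • ζ) + w
• (ζ - y)`, whose terms both start at `Z.lam j` or later, bounds it below. -/
theorem IsSemiRoot.hasOrder_sub_twist {j : Fin Z.g} {q : ρ.Poly} (hq : Z.IsSemiRoot j q)
    {y : ρ.Series} {k : ℕ} (hk : 0 < k) (hy : y ∈ ρ.conv (ρ.fracM k)) (h0 : aeval y q = 0)
    (hord : ρ.HasOrder (Z.ζ - y) (Z.lam j)) {w : Fin d → ℤ} (hw : w ∈ Z.annLattice j) :
    ρ.HasOrder (Z.ζ - ρ.twist w y) (Z.lam j) := by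
  have hw0 : aeval (ρ.twist w y) q = 0 := ρ.aeval_twist h0 w
  obtain ⟨a, ha⟩ := hq.2.2.2.1.exists_hasOrder_sub (dvd_map_mul Z.root hw0)
  have hyw := ρ.twist_mem_conv w hy
  have hle : a ≤ Z.lam j := by
    -- The product of the denominators of `ζ` and `y` is a common denominator for their difference.
    refine hq.2.2.2.2.2 ⟨Z.ζ, ρ.twist w y, ⟨⟨_, Z.natDegree_pos, Z.ζ_mem⟩, Z.root⟩,
      ⟨⟨k, hk, hyw⟩, hw0⟩, ha.isMonomialTimesUnit (k := k * Z.f.natDegree)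
        (mul_pos hk Z.natDegree_pos) (sub_mem (S := Subalgebra ℂ ρ.Series) ?_ ?_)⟩
    · exact ⟨fun u hu => ⟨(Z.ζ_mem.1 u hu).1, ρ.fracM_le_mul_left _ _ (Z.ζ_mem.1 u hu).2⟩, Z.ζ_mem.2⟩
    · refine ⟨fun u hu => ⟨(hyw.1 u hu).1, ?_⟩, hyw.2⟩
      rw [mul_comm]
      exact ρ.fracM_le_mul_left _ _ (hyw.1 u hu).2
  have hge : Z.lam j ≤ a := by
    have h1 : Z.ζ - ρ.twist w y = (Z.ζ - ρ.twist w Z.ζ) + ρ.twist w (Z.ζ - y) := by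
      rw [map_sub]
      abel
    rw [h1] at ha
    rcases HahnSeries.support_add_subset _ _ ha.1 with h | h
    · exact Z.lam_le_of_mem_support hw a h
    · exact (hord.twist w).2 a h
  exact le_antisymm hle hge ▸ ha

/-- In the same splitting `ζ - w • ζ` has order exactly `Z.lam i`, and the other term starts at the
strictly larger `Z.lam j`. -/
theorem hasOrder_sub_twist_of_lt {j : Fin Z.g} {y : ρ.Series}
    (hord : ρ.HasOrder (Z.ζ - y) (Z.lam j)) {i : Fin Z.g} (hij : i < j) {w : Fin d → ℤ}
    (hw : w ∈ Z.annLattice i) (hw' : w ∉ Z.annLattice (i + 1)) :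
    ρ.HasOrder (Z.ζ - ρ.twist w y) (Z.lam i) := by
  have h1 : Z.ζ - ρ.twist w y = (Z.ζ - ρ.twist w Z.ζ) + ρ.twist w (Z.ζ - y) := by
    rw [map_sub]
    abel
  rw [h1]
  exact (Z.hasOrder_sub_twist hw hw').add_of_lt (hord.twist w).2 (Z.lam_strictMono hij)

open Classical in
/-- The order of `ζ - w • y`, for a root `y` of a `j`-th semi-root, as a telescoping sum. -/
theorem IsSemiRoot.hasOrder_sub_twist_sum {j : Fin Z.g} {q : ρ.Poly} (hq : Z.IsSemiRoot j q)
    {y : ρ.Series} {k : ℕ} (hk : 0 < k) (hy : y ∈ ρ.conv (ρ.fracM k)) (h0 : aeval y q = 0)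
    (hord : ρ.HasOrder (Z.ζ - y) (Z.lam j)) (w : Fin d → ℤ) :
    ρ.HasOrder (Z.ζ - ρ.twist w y) (Z.lamNat 0 + ∑ i ∈ Finset.range j,
      if w ∈ Z.annLattice (i + 1) then Z.lamNat (i + 1) - Z.lamNat i else 0) := by
  -- `l` is the largest index up to `j` with `w ∈ annLattice l`. The annihilators decrease, so the
  -- conditional sum stops at `l` and telescopes to `lamNat l`.
  obtain ⟨l, hlj, hl, hl'⟩ : ∃ l ≤ (j : ℕ), w ∈ Z.annLattice l ∧
      (l < j → w ∉ Z.annLattice (l + 1)) := by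
    refine ⟨Nat.findGreatest (fun l => w ∈ Z.annLattice l) j, Nat.findGreatest_le _, ?_, ?_⟩
    · exact Nat.findGreatest_spec (P := fun l => w ∈ Z.annLattice l) (Nat.zero_le _)
        (Z.annLattice_zero.symm ▸ AddSubgroup.mem_top w)
    · exact fun hlt => Nat.findGreatest_is_greatest (Nat.lt_succ_self _) hlt
  have hsum : Z.lamNat 0 + ∑ i ∈ Finset.range j,
      (if w ∈ Z.annLattice (i + 1) then Z.lamNat (i + 1) - Z.lamNat i else 0) = Z.lamNat l := by
    have h1 : ∑ i ∈ Finset.range j,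
        (if w ∈ Z.annLattice (i + 1) then Z.lamNat (i + 1) - Z.lamNat i else 0) =
        ∑ i ∈ Finset.range l, (Z.lamNat (i + 1) - Z.lamNat i) := by
      rw [← Finset.sum_subset (Finset.range_subset_range.2 hlj)]
      · refine Finset.sum_congr rfl fun i hi => if_pos ?_
        exact Z.annLattice_anti (Finset.mem_range.1 hi) hl
      · intro i hi hi'
        rw [Finset.mem_range] at hi hi'
        refine if_neg fun hw => hl' (by omega) (Z.annLattice_anti (by omega) hw)
    rw [h1, Finset.sum_range_sub]
    abel
  rw [hsum]
  rcases hlj.lt_or_eq with h | rfl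
  · rw [Z.lamNat_eq ⟨l, h.trans j.2⟩]
    exact hasOrder_sub_twist_of_lt hord h hl (hl' h)
  · rw [Z.lamNat_eq]
    exact hq.hasOrder_sub_twist hk hy h0 hord hl

theorem ncard_orbit_annLattice {j : Fin Z.g} {y : ρ.Series}
    (hst : AddAction.stabilizer (Fin d → ℤ) y = Z.annLattice j) {i : ℕ} (hi : i ≤ j) :
    (AddAction.orbit (Z.annLattice i) y).ncard = ∏ k ∈ Finset.Ico i j, Z.charInt k := by
  rw [← AddAction.index_stabilizer, ← Z.relIndex_annLattice hi j.2.le, ← hst]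
  congr 1

/-- The order of a `j`-th semi-root at `ζ` is `γ_{j+1}`. -/
theorem IsSemiRoot.hasOrder {j : Fin Z.g} {q : ρ.Poly} (hq : Z.IsSemiRoot j q) :
    ρ.HasOrder (aeval Z.ζ q) (Z.gamma j) := by
  classical
  obtain ⟨y, k, hk, hy, h0, hord⟩ := hq.exists_root
  have hst := hq.stabilizer_eq hy h0 hord
  have hfin := ρ.finite_orbit hq.1.ne_zero h0
  obtain ⟨c, hc, h⟩ := ρ.map_eq_C_mul_prod_orbit hq.1 hy h0 hfin
  have hprod : aeval Z.ζ q = c * ∏ x ∈ hfin.toFinset, (Z.ζ - x) := by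
    rw [aeval_def, ← eval_map, h, eval_mul, eval_C, eval_prod]
    simp
  -- The condition on `w` is restated for the root `x = w • y` itself, so that the orders can be
  -- summed over the set of roots.
  have hx : ∀ x ∈ hfin.toFinset, ρ.HasOrder (Z.ζ - x) (Z.lamNat 0 + ∑ i ∈ Finset.range j,
      if x ∈ AddAction.orbit (Z.annLattice (i + 1)) y then Z.lamNat (i + 1) - Z.lamNat i else 0) := by
    intro x hx
    obtain ⟨w, rfl⟩ := hfin.mem_toFinset.1 hx
    have hiff : ∀ i ∈ Finset.range j, w +ᵥ y ∈ AddAction.orbit (Z.annLattice (i + 1)) y ↔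
        w ∈ Z.annLattice (i + 1) := by
      intro i hi
      constructor
      · rintro ⟨v, hv⟩
        have h1 : w - v ∈ AddAction.stabilizer (Fin d → ℤ) y := by
          rw [AddAction.mem_stabilizer_iff, sub_eq_neg_add, add_vadd]
          change -(v : Fin d → ℤ) +ᵥ (w +ᵥ y) = y
          rw [neg_vadd_eq_iff]
          exact hv.symm
        rw [hst] at h1
        have h2 := add_mem (Z.annLattice_anti (Finset.mem_range.1 hi) h1) v.2
        rwa [sub_add_cancel] at h2
      · intro hw
        exact ⟨⟨w, hw⟩, rfl⟩
    have := hq.hasOrder_sub_twist_sum hk hy h0 hord w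
    rw [← Finset.sum_congr rfl fun i hi => if_congr (hiff i hi) rfl rfl] at this
    exact this
  rw [hprod, gamma, gammaAux_eq]
  have := (ρ.hasOrder_zero_of_isUnit hc).mul (HasOrder.prod _ hx)
  -- After exchanging the sums, `lamNat 0` occurs once per root and `lamNat (i + 1) - lamNat i` once
  -- per root in the orbit of `y` under `annLattice (i + 1)`: these are the coefficients in
  -- `gammaAux_eq`.
  rw [zero_add, Finset.sum_add_distrib, Finset.sum_const, Finset.sum_comm,
    ← Set.ncard_eq_toFinset_card _ hfin, ← natDegree_eq_ncard_orbit hq.1 hy h0, hq.2.2.1] at this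
  convert this using 3 with i hi
  rw [← Finset.sum_filter, Finset.sum_const, ← ncard_orbit_annLattice hst (Finset.mem_range.1 hi)]
  congr 1
  rw [← Set.ncard_coe_finset]
  congr 1
  ext x
  simp only [Finset.coe_filter, Set.Finite.mem_toFinset, Set.mem_ofPred_eq]
  refine ⟨fun hx => ⟨?_, hx⟩, fun hx => hx.2⟩
  obtain ⟨v, rfl⟩ := hx
  exact ⟨v, rfl⟩

end Branch

namespace Branch
variable {d : ℕ} {ρ : ToricCone d} (Z : Branch ρ)

open Polynomial ToricCone

/-! ### The semigroup `Γ` -/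

/-- By the recursion `γ_{j+1} - λ_{j+1} = n_j γ_j - λ_j ∈ M_j`. Thus `γ_{j+1}` and `λ_{j+1}` have
the same class modulo `M_j`, of order `n_{j+1}`. -/
theorem gammaAux_mem_and_sub_mem {j : ℕ} (hj : j < Z.g) :
    Z.gammaAux j hj ∈ Z.lattice (j + 1) ∧ Z.gammaAux j hj - Z.lam ⟨j, hj⟩ ∈ Z.lattice j := by
  induction j with
  | zero =>
    refine ⟨Z.lam_mem_lattice ⟨0, hj⟩ Nat.zero_lt_one, ?_⟩
    rw [gammaAux, sub_self]
    exact zero_mem _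
  | succ j ih =>
    have hj' := Nat.lt_of_succ_lt hj
    have h : Z.gammaAux (j + 1) hj - Z.lam ⟨j + 1, hj⟩ ∈ Z.lattice (j + 1) := by
      have e : Z.gammaAux (j + 1) hj - Z.lam ⟨j + 1, hj⟩ =
          Z.charInt j • Z.gammaAux j hj' - Z.lam ⟨j, hj'⟩ := by
        rw [gammaAux]
        abel
      rw [e]
      exact sub_mem (AddSubgroup.nsmul_mem _ (ih hj').1 _)
        (Z.lam_mem_lattice ⟨j, hj'⟩ (Nat.lt_succ_self _))
    refine ⟨?_, h⟩
    have := add_mem (Z.lattice_mono (Nat.le_succ _) h)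
      (Z.lam_mem_lattice ⟨j + 1, hj⟩ (Nat.lt_succ_self _))
    rwa [sub_add_cancel] at this

theorem gamma_mem_lattice (j : Fin Z.g) : Z.gamma j ∈ Z.lattice (j + 1) :=
  (Z.gammaAux_mem_and_sub_mem j.2).1

theorem gammaAux_nonneg {j : ℕ} (hj : j < Z.g) : 0 ≤ Z.gammaAux j hj := by
  induction j with
  | zero =>
    rw [gammaAux, le_def, sub_zero]
    exact (Z.ζ_mem.1 _ (Z.lam_mem_support _)).1
  | succ j ih =>
    have hj' := Nat.lt_of_succ_lt hj
    rw [gammaAux, add_sub_assoc]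
    refine add_nonneg (nsmul_nonneg (ih hj') _) (sub_nonneg.2 (Z.lam_strictMono.monotone ?_))
    exact Nat.le_succ j

theorem gamma_mem_bigSemigroup (j : Fin Z.g) : Z.gamma j ∈ Z.bigSemigroup := by
  refine ⟨?_, Z.lattice_mono j.2 (Z.gamma_mem_lattice j)⟩
  have := Z.gammaAux_nonneg j.2
  rwa [le_def, sub_zero] at this

theorem semigroup_M_le : ρ.semigroup ρ.M ≤ Z.bigSemigroup := fun _ hu =>
  ⟨hu.1, Z.M_le_lattice _ hu.2⟩

theorem Gam_le_bigSemigroup : Z.Gam ≤ Z.bigSemigroup := by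
  refine sup_le Z.semigroup_M_le (AddSubmonoid.closure_le.2 ?_)
  rintro _ ⟨j, rfl⟩
  exact Z.gamma_mem_bigSemigroup j

/-- The exponent `∑ v_i γ_i` of the monomial `U^v`. -/
def wt (v : Fin Z.g →₀ ℕ) : ρ.Expo := ∑ i, v i • Z.gamma i

theorem wt_zero : Z.wt 0 = 0 := by simp [wt]

theorem wt_add (v v' : Fin Z.g →₀ ℕ) : Z.wt (v + v') = Z.wt v + Z.wt v' := by
  simp [wt, add_smul, Finset.sum_add_distrib]

theorem wt_single (i : Fin Z.g) : Z.wt (Finsupp.single i 1) = Z.gamma i := by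
  classical
  rw [wt, Finset.sum_eq_single i]
  · simp
  · intro j _ hj
    simp [Finsupp.single_eq_of_ne hj]
  · simp

theorem gamma_mem_Gam (i : Fin Z.g) : Z.gamma i ∈ Z.Gam :=
  (le_sup_right : _ ≤ Z.Gam) (AddSubmonoid.subset_closure ⟨i, rfl⟩)

theorem wt_mem_Gam (v : Fin Z.g →₀ ℕ) : Z.wt v ∈ Z.Gam :=
  sum_mem fun i _ => AddSubmonoid.nsmul_mem _ (Z.gamma_mem_Gam i) _

theorem add_wt_mem_Gam {α : ρ.Expo} (hα : α ∈ ρ.semigroup ρ.M) (v : Fin Z.g →₀ ℕ) :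
    α + Z.wt v ∈ Z.Gam :=
  add_mem ((le_sup_left : _ ≤ Z.Gam) hα) (Z.wt_mem_Gam v)

theorem exists_eq_add_wt {u : ρ.Expo} (hu : u ∈ Z.Gam) :
    ∃ α ∈ ρ.semigroup ρ.M, ∃ v, u = α + Z.wt v := by
  obtain ⟨α, hα, β, hβ, rfl⟩ := AddSubmonoid.mem_sup.1 hu
  refine ⟨α, hα, ?_⟩
  suffices ∃ v, β = Z.wt v by
    obtain ⟨v, rfl⟩ := this
    exact ⟨v, rfl⟩
  induction hβ using AddSubmonoid.closure_induction with
  | mem x hx =>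
    obtain ⟨i, rfl⟩ := hx
    exact ⟨_, (Z.wt_single i).symm⟩
  | zero => exact ⟨0, Z.wt_zero.symm⟩
  | add x y hx hy ihx ihy =>
    obtain ⟨v, rfl⟩ := ihx (add_mem ((le_sup_left : _ ≤ Z.Gam) hα) ((le_sup_right : _ ≤ Z.Gam) hx))
    obtain ⟨v', rfl⟩ := ihy (add_mem ((le_sup_left : _ ≤ Z.Gam) hα) ((le_sup_right : _ ≤ Z.Gam) hy))
    exact ⟨v + v', (Z.wt_add v v').symm⟩

theorem charInt_eq_addOrderOf (i : Fin Z.g) :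
    Z.charInt i = addOrderOf (QuotientAddGroup.mk (Z.lam i) : ρ.Expo ⧸ Z.lattice i) := by
  rw [charInt, lattice_succ, relIndex_sup_zmultiples]

/-- The exponents `∑ v_i γ_i` with `v_i < n_i` are pairwise incongruent modulo `M`. -/
theorem eq_of_add_wt_eq {v v' : Fin Z.g →₀ ℕ} (hv : ∀ i, v i < Z.charInt i)
    (hv' : ∀ i, v' i < Z.charInt i) {α α' : ρ.Expo} (hα : α ∈ ρ.M) (hα' : α' ∈ ρ.M)
    (h : α + Z.wt v = α' + Z.wt v') : v = v' := by
  classical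
  by_contra hne
  have hs : (Finset.univ.filter fun i => v i ≠ v' i).Nonempty := by
    obtain ⟨i, hi⟩ := DFunLike.ne_iff.1 hne
    exact ⟨i, by simpa using hi⟩
  -- At the largest index of disagreement the terms beyond `i` cancel, and those before `i` lie in
  -- `lattice i`, so a multiple of `gamma i` does too.
  set i := (Finset.univ.filter fun i => v i ≠ v' i).max' hs with hi
  have hi1 : v i ≠ v' i := (Finset.mem_filter.1 (Finset.max'_mem _ hs)).2
  have hi2 : ∀ k, i < k → v k = v' k := fun k hk => by
    by_contra hc
    exact (Finset.le_max' _ k (by simpa using hc)).not_gt hk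
  have h1 : ∑ k, ((v k : ℤ) - v' k) • Z.gamma k ∈ ρ.M := by
    have : ∑ k, ((v k : ℤ) - v' k) • Z.gamma k = α' - α := by
      simp only [sub_smul, Finset.sum_sub_distrib, natCast_zsmul]
      change Z.wt v - Z.wt v' = _
      rw [sub_eq_sub_iff_add_eq_add, add_comm, h]
    rw [this]
    exact sub_mem hα' hα
  have h2 : ((v i : ℤ) - v' i) • Z.gamma i ∈ Z.lattice i := by
    rw [← Finset.add_sum_erase _ _ (Finset.mem_univ i)] at h1
    refine (AddSubgroup.add_mem_cancel_right _ ?_).1 (Z.M_le_lattice i h1)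
    refine sum_mem fun k hk => ?_
    rcases lt_or_gt_of_ne (Finset.ne_of_mem_erase hk) with hlt | hlt
    · exact AddSubgroup.zsmul_mem _ (Z.lattice_mono hlt (Z.gamma_mem_lattice k)) _
    · rw [hi2 k hlt, sub_self, zero_smul]
      exact zero_mem _
  -- `gamma i` may be replaced by `lam i`, whose class modulo `lattice i` has order `charInt i`.
  -- This order divides a difference of absolute value smaller than itself.
  have h3 : ((v i : ℤ) - v' i) • Z.lam i ∈ Z.lattice i := by
    have := sub_mem h2 (AddSubgroup.zsmul_mem _ (Z.gammaAux_mem_and_sub_mem i.2).2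
      ((v i : ℤ) - v' i))
    rwa [← smul_sub, gamma, sub_sub_cancel] at this
  have h4 : (Z.charInt i : ℤ) ∣ (v i : ℤ) - v' i := by
    rw [charInt_eq_addOrderOf, addOrderOf_dvd_iff_zsmul_eq_zero]
    exact (QuotientAddGroup.eq_zero_iff _).2 h3
  have h5 := hv i
  have h6 := hv' i
  have h7 := Int.eq_zero_of_abs_lt_dvd h4 (by rw [abs_lt]; omega)
  omega

/-! ### Expansions in terms of semi-roots -/

variable {Z}

/-- Division by the monic multiple `p * C c`. Degrees in `WithBot ℕ` let zero quotients and
remainders satisfy the bounds. -/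
theorem exists_mul_add_of_degree_lt {p P : ρ.Poly} (hp : IsUnit p.leadingCoeff) {s : ℕ}
    (hP : P.degree < ((p.natDegree * (s + 1) : ℕ) : WithBot ℕ)) :
    ∃ D r : ρ.Poly, P = p * D + r ∧ D.degree < ((p.natDegree * s : ℕ) : WithBot ℕ) ∧
      r.degree < (p.natDegree : WithBot ℕ) := by
  obtain ⟨c, hc⟩ := hp.exists_right_inv
  have hm : (p * C c).Monic := monic_mul_C_of_leadingCoeff_mul_eq_one hc
  have hc0 : c ≠ 0 := right_ne_zero_of_mul (hc ▸ one_ne_zero)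
  have hdeg : (p * C c).natDegree = p.natDegree := natDegree_mul_C hc0
  have hp0 : p ≠ 0 := fun h => by
    rw [h, zero_mul] at hm
    exact hm.ne_zero rfl
  refine ⟨C c * (P /ₘ (p * C c)), P %ₘ (p * C c), ?_, ?_, ?_⟩
  · rw [← mul_assoc, add_comm, modByMonic_add_div P]
  · rw [degree_C_mul hc0]
    by_cases hD : P /ₘ (p * C c) = 0
    · rw [hD, degree_zero]
      exact WithBot.bot_lt_coe _
    · have h1 : (p * C c).degree ≤ P.degree := by
        by_contra h1
        exact hD ((divByMonic_eq_zero_iff hm).2 (not_le.1 h1))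
      have hP0 : P ≠ 0 := fun h => hD (by rw [h, zero_divByMonic])
      rw [← natDegree_lt_iff_degree_lt hD, natDegree_divByMonic _ hm, hdeg]
      rw [← natDegree_lt_iff_degree_lt hP0, mul_add, mul_one] at hP
      have h2 := natDegree_le_natDegree h1
      rw [hdeg] at h2
      omega
  · have := degree_modByMonic_lt P hm
    rwa [degree_eq_natDegree hm.ne_zero, hdeg] at this

/-- Expand `P` in powers of the last semi-root. The number of powers is bounded by the ratio
`charInt i` of consecutive degrees, and the coefficients, of degree below that semi-root, are
expanded in the preceding ones. -/
theorem exists_box_expansion_step {q : Fin Z.g → ρ.Poly} (hq : ∀ j, Z.IsSemiRoot j (q j))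
    {i : ℕ} (hi : i ≤ Z.g) {P : ρ.Poly}
    (hP : P.degree < ((∏ k ∈ Finset.range i, Z.charInt k : ℕ) : WithBot ℕ)) :
    ∃ Q : MvPolynomial (Fin Z.g) (ρ.conv ρ.M),
      (∀ v ∈ Q.support, ∀ k : Fin Z.g, v k < Z.charInt k ∧ (i ≤ k → v k = 0)) ∧
        MvPolynomial.aeval q Q = P := by
  classical
  induction i generalizing P with
  | zero =>
    rw [Finset.prod_range_zero] at hP
    refine ⟨MvPolynomial.C (P.coeff 0), fun v hv k => ?_, ?_⟩
    · have : v = 0 := by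
        rw [MvPolynomial.mem_support_iff, MvPolynomial.coeff_C] at hv
        by_contra h
        exact hv (if_neg (Ne.symm h))
      subst this
      exact ⟨Z.charInt_pos k.2, fun _ => rfl⟩
    · rw [MvPolynomial.aeval_C, Polynomial.algebraMap_apply, Algebra.algebraMap_self, RingHom.id_apply]
      exact (eq_C_of_degree_le_zero (Nat.WithBot.lt_one_iff_le_zero.1 hP)).symm
  | succ i ih =>
    have hi' : i < Z.g := hi
    let j : Fin Z.g := ⟨i, hi'⟩
    have hdeg : (q j).natDegree = ∏ k ∈ Finset.range i, Z.charInt k := (hq j).2.2.1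
    -- `s` bounds the number of powers of `q j` used. The clause for `k = j` keeps that exponent
    -- below `charInt i` after multiplication by `X j`.
    have key : ∀ s : ℕ, s ≤ Z.charInt i → ∀ P : ρ.Poly,
        P.degree < (((q j).natDegree * s : ℕ) : WithBot ℕ) →
        ∃ Q : MvPolynomial (Fin Z.g) (ρ.conv ρ.M), (∀ v ∈ Q.support, ∀ k : Fin Z.g,
          v k < Z.charInt k ∧ (i + 1 ≤ k → v k = 0) ∧ (k = j → v k < s)) ∧
            MvPolynomial.aeval q Q = P := by
      intro s
      induction s with
      | zero =>
        intro _ P hP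
        rw [mul_zero, Nat.cast_zero, Nat.WithBot.lt_zero_iff, degree_eq_bot] at hP
        exact ⟨0, by simp, by simp [hP]⟩
      | succ s ihs =>
        intro hs P hP
        obtain ⟨D, r, rfl, hD, hr⟩ := exists_mul_add_of_degree_lt (hq j).2.1.1 hP
        obtain ⟨Q₁, h1, rfl⟩ := ihs (Nat.le_of_succ_le hs) D hD
        rw [hdeg] at hr
        obtain ⟨Q₂, h2, rfl⟩ := ih hi'.le hr
        refine ⟨MvPolynomial.X j * Q₁ + Q₂, fun v hv k => ?_, by simp⟩
        rcases Finset.mem_union.1 (MvPolynomial.support_add hv) with hv | hv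
        · rw [MvPolynomial.support_X_mul, Finset.mem_map] at hv
          obtain ⟨v', hv', rfl⟩ := hv
          obtain ⟨h3, h4, h5⟩ := h1 v' hv' k
          simp only [addLeftEmbedding_apply, Finsupp.add_apply]
          by_cases hk : k = j
          · subst hk
            have := h5 rfl
            have hji : (j : ℕ) = i := rfl
            simp only [Finsupp.single_eq_same]
            refine ⟨?_, fun h => ?_, fun _ => ?_⟩ <;> (try rw [hji] at *) <;> omega
          · rw [Finsupp.single_eq_of_ne hk, zero_add]
            exact ⟨h3, h4, fun h => absurd h hk⟩
        · obtain ⟨h3, h4⟩ := h2 v hv k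
          refine ⟨h3, fun h => h4 (Nat.le_of_succ_le h), fun h => ?_⟩
          rw [h4 (h ▸ le_rfl)]
          exact Nat.succ_pos s
    obtain ⟨Q, hQ, h⟩ := key (Z.charInt i) le_rfl P (by rwa [hdeg, ← Finset.prod_range_succ])
    exact ⟨Q, fun v hv k => ⟨(hQ v hv k).1, (hQ v hv k).2.1⟩, h⟩

/-- Every element of `R` is a polynomial in the semi-roots with exponents `v_i < n_i`. -/
theorem exists_box_expansion {q : Fin Z.g → ρ.Poly} (hq : ∀ j, Z.IsSemiRoot j (q j)) (x : Z.R) :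
    ∃ Q : MvPolynomial (Fin Z.g) (ρ.conv ρ.M),
      (∀ v ∈ Q.support, ∀ k : Fin Z.g, v k < Z.charInt k) ∧ Z.Psi q Q = x := by
  obtain ⟨P, hP⟩ : ∃ P : ρ.Poly, aeval Z.ζ P = x := by
    have h : (x : ρ.Series) ∈ Algebra.adjoin (ρ.conv ρ.M) ({Z.ζ} : Set ρ.Series) := x.2
    rw [Algebra.adjoin_singleton_eq_range_aeval] at h
    exact h
  -- The remainder modulo `f` has degree below `n = n_1 ⋯ n_g`, which the expansion step covers.
  have hmod : aeval Z.ζ (P %ₘ Z.f) = x := by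
    rw [← hP, aeval_modByMonic_eq_self_of_root Z.root]
  have hlt := degree_modByMonic_lt P Z.monic
  rw [degree_eq_natDegree Z.monic.ne_zero, natDegree_eq] at hlt
  obtain ⟨Q, hQ, h⟩ := exists_box_expansion_step hq le_rfl hlt
  refine ⟨Q, fun v hv k => (hQ v hv k).1, Subtype.ext ?_⟩
  rw [← hmod, ← h]
  change MvPolynomial.aeval (fun j => aeval Z.ζ (q j)) Q = _
  rw [← MvPolynomial.comp_aeval_apply]

end Branch

namespace Filt

/-! ### Associated graded algebras from initial forms -/

section InitialForms

set_option linter.unusedSectionVars false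

variable {ι : Type} [AddCommMonoid ι] [PartialOrder ι] [IsOrderedCancelAddMonoid ι]
  {B : Type} [CommRing B] [Algebra ℂ B] {B' : Type} [CommRing B'] [Algebra ℂ B']
  {C : Type} [CommRing C] [Algebra ℂ C] {D : Type} [CommRing D] [Algebra ℂ D]

/-- A system of initial forms, with values in a graded algebra `C`, on a filtered algebra: the
initial form of degree `i` of an element of `F i` vanishes exactly on the terms of higher index. -/
structure InitialForms (F : Filt ι B) (𝒞 : ι → Submodule ℂ C) where
  /-- the initial form of degree `i` -/
  ini : ι → B →ₗ[ℂ] C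
  ini_of_lt : ∀ {i k : ι}, i < k → ∀ x ∈ F.F k, ini i x = 0
  mem_above : ∀ {i : ι}, ∀ x ∈ F.F i, ini i x = 0 → x ∈ F.above i
  ini_one : ini 0 1 = 1
  ini_mul : ∀ {i j : ι}, ∀ x ∈ F.F i, ∀ y ∈ F.F j, ini (i + j) (x * y) = ini i x * ini j y
  map_eq : ∀ i, (F.F i).map (ini i) = 𝒞 i
  indep : iSupIndep 𝒞
  iSup_eq : ⨆ i, 𝒞 i = ⊤

namespace InitialForms

variable {F : Filt ι B} {𝒞 : ι → Submodule ℂ C} (I : InitialForms F 𝒞)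
  {F' : Filt ι B'} {𝒞' : ι → Submodule ℂ D} (I' : InitialForms F' 𝒞')

theorem ini_above {i : ι} {x : B} (hx : x ∈ F.above i) : I.ini i x = 0 := by
  have : F.above i ≤ LinearMap.ker (I.ini i) := iSup₂_le fun _ hk x hx => I.ini_of_lt hk x hx
  exact this hx

/-- The identification of the homogeneous components of the associated graded algebra. -/
def pieceEquiv (i : ι) : F.Piece i ≃ₗ[ℂ] 𝒞 i :=
  LinearEquiv.ofBijective
    (Submodule.liftQ _
      (((I.ini i).comp (F.F i).subtype).codRestrict (𝒞 i) fun x => by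
        rw [← I.map_eq i]
        exact ⟨x, x.2, rfl⟩)
      fun x hx => Subtype.ext (I.ini_above hx))
    (by
      constructor
      · rw [injective_iff_map_eq_zero]
        intro a ha
        obtain ⟨x, rfl⟩ := F.cls_surjective i a
        exact F.cls_eq_zero.2 (I.mem_above x.1 x.2 (congrArg Subtype.val ha))
      · rintro ⟨c, hc⟩
        rw [← I.map_eq i] at hc
        obtain ⟨x, hx, rfl⟩ := hc
        exact ⟨F.cls i ⟨x, hx⟩, rfl⟩)

theorem pieceEquiv_cls {i : ι} (x : F.F i) : (I.pieceEquiv i (F.cls i x) : C) = I.ini i x := rfl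

variable [DecidableEq ι]

/-- The homomorphism from the associated graded algebra defined by initial forms. -/
def grHom : F.Gr →ₐ[ℂ] C :=
  DirectSum.toAlgebra ℂ F.Piece (fun i => (𝒞 i).subtype.comp (I.pieceEquiv i).toLinearMap)
    (by
      change (I.pieceEquiv 0 (F.cls 0 ⟨1, F.one_mem⟩) : C) = 1
      rw [pieceEquiv_cls, I.ini_one])
    (by
      intro i j a b
      obtain ⟨x, rfl⟩ := F.cls_surjective i a
      obtain ⟨y, rfl⟩ := F.cls_surjective j b
      change (I.pieceEquiv (i + j) (F.cls (i + j) ⟨x.1 * y.1, F.mul_mem x.2 y.2⟩) : C) =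
        I.pieceEquiv i (F.cls i x) * I.pieceEquiv j (F.cls j y)
      simp only [pieceEquiv_cls]
      exact I.ini_mul x.1 x.2 y.1 y.2)

theorem grHom_lof {i : ι} (a : F.Piece i) :
    I.grHom (DirectSum.lof ℂ ι F.Piece i a) = I.pieceEquiv i a :=
  DirectSum.toModule_lof (φ := fun i => (𝒞 i).subtype.comp (I.pieceEquiv i).toLinearMap) ℂ i a

theorem grHom_lof_cls {i : ι} (x : F.F i) :
    I.grHom (DirectSum.lof ℂ ι F.Piece i (F.cls i x)) = I.ini i x := I.grHom_lof _

/-- `grHom` is the sum of the isomorphisms `pieceEquiv` followed by the internal decomposition of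
`C` into the `𝒞 i`. -/
theorem grHom_bijective : Function.Bijective I.grHom := by
  have hint := DirectSum.isInternal_submodule_of_iSupIndep_of_iSup_eq_top I.indep I.iSup_eq
  have h : I.grHom.toLinearMap = (DirectSum.coeLinearMap 𝒞).comp
      (DirectSum.lmap fun i => (I.pieceEquiv i).toLinearMap) := by
    refine DirectSum.linearMap_ext ℂ fun i => LinearMap.ext fun a => ?_
    change I.grHom (DirectSum.lof ℂ ι F.Piece i a) = DirectSum.coeLinearMap 𝒞
      (DirectSum.lmap _ (DirectSum.lof ℂ ι F.Piece i a))
    rw [grHom_lof, DirectSum.lmap_lof, DirectSum.coeLinearMap_lof]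
    rfl
  have h2 : Function.Bijective (DirectSum.lmap fun i => (I.pieceEquiv i).toLinearMap) :=
    ⟨(DirectSum.lmap_injective _).2 fun i => (I.pieceEquiv i).injective,
      (DirectSum.lmap_surjective _).2 fun i => (I.pieceEquiv i).surjective⟩
  have h3 : ⇑I.grHom = ⇑(DirectSum.coeLinearMap 𝒞) ∘
      ⇑(DirectSum.lmap fun i => (I.pieceEquiv i).toLinearMap) :=
    congrArg (fun l : F.Gr →ₗ[ℂ] C => (l : F.Gr → C)) h
  rw [h3]
  exact hint.comp h2

/-- The isomorphism of the associated graded algebra with `C` defined by initial forms. -/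
def grEquiv : F.Gr ≃ₐ[ℂ] C := AlgEquiv.ofBijective I.grHom I.grHom_bijective

theorem grEquiv_lof_cls {i : ι} (x : F.F i) :
    I.grEquiv (DirectSum.lof ℂ ι F.Piece i (F.cls i x)) = I.ini i x := I.grHom_lof_cls x

theorem isGradedEquiv : F.IsGradedEquiv 𝒞 I.grEquiv := by
  intro i
  ext c
  constructor
  · rintro ⟨_, ⟨a, rfl⟩, rfl⟩
    change I.grHom _ ∈ _
    rw [grHom_lof]
    exact (I.pieceEquiv i a).2
  · intro hc
    refine ⟨_, ⟨(I.pieceEquiv i).symm ⟨c, hc⟩, rfl⟩, ?_⟩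
    change I.grHom _ = c
    rw [grHom_lof, LinearEquiv.apply_symm_apply]

/-- Compatibility of initial forms with a filtered homomorphism. -/
theorem grEquiv_comp_grMap (φ : B →ₐ[ℂ] B') (h : IsFiltered F F' φ) (ψ : C →ₐ[ℂ] D)
    (hφ : ∀ i, ∀ x ∈ F.F i, I'.ini i (φ x) = ψ (I.ini i x)) :
    (I'.grEquiv : F'.Gr →ₐ[ℂ] D).comp (grMap F F' φ h) =
      ψ.comp (I.grEquiv : F.Gr →ₐ[ℂ] C) := by
  refine AlgHom.toLinearMap_injective (DirectSum.linearMap_ext ℂ fun i => LinearMap.ext fun a => ?_)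
  obtain ⟨x, rfl⟩ := F.cls_surjective i a
  change I'.grEquiv (grMap F F' φ h (DirectSum.lof ℂ ι F.Piece i (F.cls i x))) =
    ψ (I.grEquiv (DirectSum.lof ℂ ι F.Piece i (F.cls i x)))
  have h1 : grMap F F' φ h (DirectSum.lof ℂ ι F.Piece i (F.cls i x)) =
      DirectSum.lof ℂ ι F'.Piece i (F'.cls i ⟨φ x, h i x x.2⟩) :=
    DirectSum.toModule_lof ℂ i (F.cls i x)
  rw [h1, grEquiv_lof_cls, grEquiv_lof_cls]
  exact hφ i x x.2

end InitialForms

end InitialForms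

/-- Independence of homogeneous components from a jointly injective family of coordinates, each of
which is non-zero on one component only. -/
theorem iSupIndep_of_coordinates {ι σ : Type} {C : Type} [AddCommGroup C] [Module ℂ C]
    {𝒞 : ι → Submodule ℂ C} (c : σ → C →ₗ[ℂ] ℂ) (hc : ∀ x, (∀ s, c s x = 0) → x = 0)
    (h : ∀ s i j, i ≠ j → (∀ x ∈ 𝒞 i, c s x = 0) ∨ ∀ x ∈ 𝒞 j, c s x = 0) : iSupIndep 𝒞 := by
  intro i
  rw [Submodule.disjoint_def]
  intro x hx hx'
  refine hc x fun s => ?_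
  by_cases hs : ∀ x ∈ 𝒞 i, c s x = 0
  · exact hs x hx
  · have : ⨆ (j) (_ : j ≠ i), 𝒞 j ≤ LinearMap.ker (c s) :=
      iSup₂_le fun j hj y hy => ((h s j i hj).resolve_right hs) y hy
    exact this hx'

end Filt

namespace ToricCone
variable {d : ℕ} (ρ : ToricCone d)

/-! ### Homogeneous parts of series -/

theorem eq_of_le_of_pair_le {η : Fin d → ℝ} (hη : η ∈ interior (ρ.cone : Set (Fin d → ℝ)))
    {u v : ρ.Expo} (h : u ≤ v) (h' : ρ.pair η v ≤ ρ.pair η u) : u = v := by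
  by_contra hne
  have := ρ.pair_pos_of_mem_interior hη h (sub_ne_zero.2 (Ne.symm hne))
  rw [map_sub] at this
  linarith

theorem pair_mono {η : Fin d → ℝ} (hη : η ∈ interior (ρ.cone : Set (Fin d → ℝ)))
    {u v : ρ.Expo} (h : u ≤ v) : ρ.pair η u ≤ ρ.pair η v := by
  have := h η (interior_subset hη)
  rw [map_sub] at this
  linarith

/-- Comparable exponents of equal `η`-degree coincide, so a level is an antichain in a partially
well-ordered set. Initial parts are therefore polynomials. -/
theorem finite_level {η : Fin d → ℝ} (hη : η ∈ interior (ρ.cone : Set (Fin d → ℝ)))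
    (φ : ρ.Series) (r : ℝ) : {u | u ∈ φ.support ∧ ρ.pair η u = r}.Finite := by
  refine IsAntichain.finite_of_partiallyWellOrderedOn (r := (· ≤ ·)) ?_
    (φ.isPWO_support.mono fun u hu => hu.1)
  intro u hu v hv hne hle
  exact hne (ρ.eq_of_le_of_pair_le hη hle (hv.2.trans hu.2.symm).le)

theorem exists_isMin_pair {η : Fin d → ℝ} (hη : η ∈ interior (ρ.cone : Set (Fin d → ℝ)))
    {φ : ρ.Series} (hφ : φ ≠ 0) : ∃ a ∈ φ.support, ∀ u ∈ φ.support, ρ.pair η a ≤ ρ.pair η u := by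
  obtain ⟨a, ha, h⟩ := ρ.exists_isMin_lexKey (w := η) (w₀ := η) (interior_subset hη)
    (fun u hu hu0 => ρ.pair_pos_of_mem_interior hη hu hu0) hφ
  exact ⟨a, ha, fun u hu => ρ.pair_le_of_lexKey_le (h u hu)⟩

open Classical in
/-- The part of `η`-degree `r` of a series, restricted to exponents in `Λ`. -/
def cut {η : Fin d → ℝ} (hη : η ∈ interior (ρ.cone : Set (Fin d → ℝ))) (Λ : AddSubmonoid ρ.Expo)
    (r : ℝ) : ρ.Series →ₗ[ℂ] AddMonoidAlgebra ℂ Λ where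
  toFun φ := AddMonoidAlgebra.ofCoeff (Finsupp.ofSupportFinite
    (fun u : Λ => if ρ.pair η u = r then φ.coeff u else 0) (by
      refine Set.Finite.of_finite_image (f := Subtype.val)
        ((ρ.finite_level hη φ r).subset ?_) Subtype.val_injective.injOn
      rintro _ ⟨u, hu, rfl⟩
      rw [Function.mem_support, ite_ne_right_iff] at hu
      exact ⟨hu.2, hu.1⟩))
  map_add' φ ψ := by
    ext u
    change (if ρ.pair η u = r then φ.coeff u + ψ.coeff u else 0) =
      (if ρ.pair η u = r then φ.coeff u else 0) + if ρ.pair η u = r then ψ.coeff u else 0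
    split_ifs
    · rfl
    · rw [add_zero]
  map_smul' c φ := by
    ext u
    change (if ρ.pair η u = r then c * φ.coeff u else 0) =
      c * if ρ.pair η u = r then φ.coeff u else 0
    split_ifs
    · rfl
    · rw [mul_zero]

variable {η : Fin d → ℝ} (hη : η ∈ interior (ρ.cone : Set (Fin d → ℝ)))

open Classical in
theorem coeff_cut (Λ : AddSubmonoid ρ.Expo) (r : ℝ) (φ : ρ.Series) (u : Λ) :
    (ρ.cut hη Λ r φ).coeff u = if ρ.pair η u = r then φ.coeff u else 0 := rfl

theorem mem_support_coeff_cut {Λ : AddSubmonoid ρ.Expo} {r : ℝ} {φ : ρ.Series} {u : Λ} :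
    u ∈ (ρ.cut hη Λ r φ).coeff.support ↔ ρ.pair η u = r ∧ (u : ρ.Expo) ∈ φ.support := by
  classical
  rw [Finsupp.mem_support_iff, coeff_cut, ite_ne_right_iff, HahnSeries.mem_support]

theorem cut_eq_zero_of_lt (Λ : AddSubmonoid ρ.Expo) {r : ℝ} {φ : ρ.Series}
    (h : ∀ u ∈ φ.support, r < ρ.pair η u) : ρ.cut hη Λ r φ = 0 := by
  ext u
  by_contra hu
  obtain ⟨h1, h2⟩ := (ρ.mem_support_coeff_cut hη).1 (Finsupp.mem_support_iff.2 hu)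
  exact (h _ h2).ne' h1

/-- Two degrees at least `r` and `s` with sum `r + s` are equal to `r` and `s`, so only lowest parts
contribute. The last two hypotheses ensure that restricting to `Λ` drops no such term. -/
theorem cut_mul {Λ : AddSubmonoid ρ.Expo} {r s : ℝ} {φ ψ : ρ.Series}
    (hφ : ∀ u ∈ φ.support, r ≤ ρ.pair η u) (hψ : ∀ u ∈ ψ.support, s ≤ ρ.pair η u)
    (hφ' : ∀ u ∈ φ.support, ρ.pair η u = r → u ∈ Λ)
    (hψ' : ∀ u ∈ ψ.support, ρ.pair η u = s → u ∈ Λ) :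
    ρ.cut hη Λ (r + s) (φ * ψ) = ρ.cut hη Λ r φ * ρ.cut hη Λ s ψ := by
  classical
  ext u
  have h1 : (ρ.cut hη Λ r φ * ρ.cut hη Λ s ψ).coeff u =
      ∑ p ∈ (ρ.cut hη Λ r φ).coeff.support ×ˢ (ρ.cut hη Λ s ψ).coeff.support with p.1 + p.2 = u,
        (ρ.cut hη Λ r φ).coeff p.1 * (ρ.cut hη Λ s ψ).coeff p.2 := by
    rw [AddMonoidAlgebra.coeff_mul, Finset.sum_filter, Finset.sum_product]
    rfl
  rw [h1, coeff_cut]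
  split_ifs with hu
  · rw [HahnSeries.coeff_mul]
    symm
    refine Finset.sum_bij (fun p _ => ((p.1 : ρ.Expo), (p.2 : ρ.Expo))) ?_ ?_ ?_ ?_
    · rintro ⟨a, b⟩ hp
      simp only [Finset.mem_filter, Finset.mem_product, mem_support_coeff_cut] at hp
      refine Finset.mem_antidiagonal.2 ⟨hp.1.1.2, hp.1.2.2, congrArg Subtype.val hp.2⟩
    · rintro ⟨a, b⟩ - ⟨a', b'⟩ - h
      exact Prod.ext (Subtype.ext (congrArg Prod.fst h)) (Subtype.ext (congrArg Prod.snd h))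
    · rintro ⟨a, b⟩ hp
      obtain ⟨ha, hb, hab⟩ := Finset.mem_antidiagonal.1 hp
      simp only at ha hb hab
      have h2 := hφ a ha
      have h3 := hψ b hb
      have h4 : ρ.pair η a + ρ.pair η b = r + s := by rw [← map_add, hab, hu]
      have ha' : ρ.pair η a = r := by linarith
      have hb' : ρ.pair η b = s := by linarith
      refine ⟨(⟨a, hφ' a ha ha'⟩, ⟨b, hψ' b hb hb'⟩), ?_, rfl⟩
      simp only [Finset.mem_filter, Finset.mem_product, mem_support_coeff_cut]
      exact ⟨⟨⟨ha', ha⟩, hb', hb⟩, Subtype.ext hab⟩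
    · rintro ⟨a, b⟩ hp
      simp only [Finset.mem_filter, Finset.mem_product, mem_support_coeff_cut] at hp
      simp only [coeff_cut]
      rw [if_pos hp.1.1.1, if_pos hp.1.2.1]
  · symm
    refine Finset.sum_eq_zero ?_
    rintro ⟨a, b⟩ hp
    simp only [Finset.mem_filter, Finset.mem_product, mem_support_coeff_cut] at hp
    refine absurd ?_ hu
    rw [← hp.1.1.1, ← hp.1.2.1, ← map_add, ← hp.2]
    rfl

theorem cut_one (Λ : AddSubmonoid ρ.Expo) : ρ.cut hη Λ 0 1 = 1 := by
  classical
  ext u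
  rw [coeff_cut, AddMonoidAlgebra.one_def, AddMonoidAlgebra.coeff_single, HahnSeries.coeff_one, Finsupp.single_apply]
  by_cases hu : (u : ρ.Expo) = 0
  · have : u = 0 := Subtype.ext hu
    subst this
    simp
  · have : (0 : Λ) ≠ u := fun h => hu (congrArg Subtype.val h.symm)
    simp [hu, this]

/-- A series with leading term `X^a` has `X^a` as its homogeneous part of degree `⟨η, a⟩`. -/
theorem cut_of_le {Λ : AddSubmonoid ρ.Expo} {φ : ρ.Series} {a : ρ.Expo} (ha : a ∈ Λ)
    (h : ∀ u ∈ φ.support, a ≤ u) (h1 : φ.coeff a = 1) :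
    ρ.cut hη Λ (ρ.pair η a) φ = AddMonoidAlgebra.single ⟨a, ha⟩ 1 := by
  classical
  ext u
  rw [coeff_cut, AddMonoidAlgebra.coeff_single, Finsupp.single_apply]
  by_cases hu : (u : ρ.Expo) = a
  · have : ⟨a, ha⟩ = u := Subtype.ext hu.symm
    subst this
    simp [h1]
  · rw [if_neg fun h : (⟨a, ha⟩ : Λ) = u => hu (congrArg Subtype.val h.symm)]
    split_ifs with h2
    · by_contra h0
      exact hu (ρ.eq_of_le_of_pair_le hη (h _ h0) h2.le).symm
    · rfl

theorem cut_mem_etaGrade {S : AddSubmonoid ℝ} {Λ : AddSubmonoid ρ.Expo} (j : S) (φ : ρ.Series) :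
    ρ.cut hη Λ j φ ∈ ρ.etaGrade η S Λ j := fun _ hu => ((ρ.mem_support_coeff_cut hη).1 hu).1

theorem etaGrade_indep (S : AddSubmonoid ℝ) (Λ : AddSubmonoid ρ.Expo) :
    iSupIndep (ρ.etaGrade η S Λ) := by
  refine Filt.iSupIndep_of_coordinates (σ := Λ)
    (fun u => (Finsupp.lapply u).comp (AddMonoidAlgebra.coeffLinearEquiv ℂ).toLinearMap) ?_ ?_
  · intro x hx
    ext u
    exact hx u
  · intro u i j hij
    by_cases h : ρ.pair η u = i
    · refine Or.inr fun x hx => ?_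
      by_contra h0
      exact hij (Subtype.ext (h.symm.trans (hx u (Finsupp.mem_support_iff.2 h0))))
    · refine Or.inl fun x hx => ?_
      by_contra h0
      exact h (hx u (Finsupp.mem_support_iff.2 h0))

theorem etaGrade_iSup {S : AddSubmonoid ℝ} {Λ : AddSubmonoid ρ.Expo}
    (h : ∀ u ∈ Λ, ρ.pair η u ∈ S) : ⨆ j, ρ.etaGrade η S Λ j = ⊤ := by
  rw [eq_top_iff]
  intro x _
  induction x using AddMonoidAlgebra.induction_linear with
  | zero => exact zero_mem _
  | add x y hx hy => exact add_mem (hx trivial) (hy trivial)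
  | single u r =>
    refine Submodule.mem_iSup_of_mem ⟨ρ.pair η u, h u u.2⟩ ?_
    exact AddMonoidAlgebra.single_mem_gradeBy (fun u : Λ => ρ.pair η u) u r

/-- A submodule containing the monomials of degree `j` contains the component of degree `j`. -/
theorem etaGrade_le {S : AddSubmonoid ℝ} {Λ : AddSubmonoid ρ.Expo} {j : S}
    {V : Submodule ℂ (AddMonoidAlgebra ℂ Λ)}
    (h : ∀ u : Λ, ρ.pair η u = j → AddMonoidAlgebra.single u 1 ∈ V) :
    ρ.etaGrade η S Λ j ≤ V := by
  intro x hx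
  have h1 : x = ∑ u ∈ x.coeff.support, x.coeff u • AddMonoidAlgebra.single u (1 : ℂ) := by
    ext u
    have := congrArg (fun f : Λ →₀ ℂ => f u) (Finsupp.sum_single x.coeff)
    simp only [AddMonoidAlgebra.coeff_sum, AddMonoidAlgebra.smul_single,
      AddMonoidAlgebra.coeff_single, smul_eq_mul, mul_one]
    exact this.symm
  rw [h1]
  exact Submodule.sum_mem _ fun u hu => Submodule.smul_mem _ _ (h u (hx u hu))

end ToricCone

namespace ToricCone
variable {d : ℕ} {ρ : ToricCone d}

/-! ### Series with a leading monomial -/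

theorem single_mem_conv {L : AddSubgroup ρ.Expo} {u : ρ.Expo} (hu : u ∈ ρ.semigroup L) (c : ℂ) :
    HahnSeries.single u c ∈ ρ.conv L := by
  refine ⟨fun v hv => ?_, 0, zero_mem _, ?_⟩
  · rw [Set.mem_singleton_iff.1 (HahnSeries.support_single_subset hv)]
    exact hu
  · refine summable_of_ne_finset_zero (s := {u}) fun v hv => ?_
    rw [HahnSeries.coeff_single_of_ne (by simpa using hv)]
    simp

theorem conv_mono {L L' : AddSubgroup ρ.Expo} (h : L ≤ L') : ρ.conv L ≤ ρ.conv L' := fun _ hφ =>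
  ⟨fun u hu => ⟨(hφ.1 u hu).1, h (hφ.1 u hu).2⟩, hφ.2⟩

/-- `φ` is `X^a` plus terms with larger exponents. -/
def HasLeadingMonomial (φ : ρ.Series) (a : ρ.Expo) : Prop :=
  φ.coeff a = 1 ∧ ∀ u ∈ φ.support, a ≤ u

theorem HasLeadingMonomial.mul {φ ψ : ρ.Series} {a b : ρ.Expo} (h : HasLeadingMonomial φ a)
    (h' : HasLeadingMonomial ψ b) : HasLeadingMonomial (φ * ψ) (a + b) :=
  ⟨by rw [coeff_mul_of_le h.2 h'.2, h.1, h'.1, one_mul], le_of_mem_support_mul h.2 h'.2⟩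

theorem hasLeadingMonomial_single (a : ρ.Expo) :
    HasLeadingMonomial (HahnSeries.single a (1 : ℂ)) a :=
  ⟨by simp, fun u hu => (Set.mem_singleton_iff.1 (HahnSeries.support_single_subset hu)).ge⟩

theorem HasLeadingMonomial.pow {φ : ρ.Series} {a : ρ.Expo} (h : HasLeadingMonomial φ a) (n : ℕ) :
    HasLeadingMonomial (φ ^ n) (n • a) := by
  induction n with
  | zero =>
    rw [pow_zero, zero_smul]
    exact hasLeadingMonomial_single 0
  | succ n ih =>
    rw [pow_succ, succ_nsmul]
    exact ih.mul h

theorem HasLeadingMonomial.prod {ι : Type*} (s : Finset ι) {φ : ι → ρ.Series} {a : ι → ρ.Expo}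
    (h : ∀ i ∈ s, HasLeadingMonomial (φ i) (a i)) :
    HasLeadingMonomial (∏ i ∈ s, φ i) (∑ i ∈ s, a i) := by
  classical
  induction s using Finset.induction_on with
  | empty =>
    rw [Finset.prod_empty, Finset.sum_empty]
    exact hasLeadingMonomial_single 0
  | insert i s hi ih =>
    rw [Finset.prod_insert hi, Finset.sum_insert hi]
    exact (h i (Finset.mem_insert_self _ _)).mul
      (ih fun k hk => h k (Finset.mem_insert_of_mem hk))

theorem prod_addMonoidAlgebra_single {ι : Type*} {Λ : AddSubmonoid ρ.Expo} (s : Finset ι)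
    (a : ι → Λ) : ∏ i ∈ s, AddMonoidAlgebra.single (a i) (1 : ℂ) =
      AddMonoidAlgebra.single (∑ i ∈ s, a i) 1 := by
  classical
  induction s using Finset.induction_on with
  | empty => rfl
  | insert i s hi ih =>
    rw [Finset.prod_insert hi, Finset.sum_insert hi, ih, AddMonoidAlgebra.single_mul_single, mul_one]

end ToricCone

namespace Branch
variable {d : ℕ} {ρ : ToricCone d} (Z : Branch ρ)

open ToricCone

variable {η : Fin d → ℝ} (hη : η ∈ interior (ρ.cone : Set (Fin d → ℝ)))

/-! ### Initial forms on algebras of series -/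

theorem pair_mem_degrees {u : ρ.Expo} (hu : u ∈ Z.bigSemigroup) : ρ.pair η u ∈ Z.degrees η :=
  ⟨u, hu, rfl⟩

/-- Initial forms on a subalgebra of `ℂ{ρ^∨ ∩ M_g}` whose elements have their leading exponents
in the semigroup `Λ`. -/
def initialFormsOfSubalgebra {B : Subalgebra ℂ ρ.Series} (hB : B ≤ Z.bigRing)
    {Λ : AddSubmonoid ρ.Expo} (hΛ : Λ ≤ Z.bigSemigroup)
    (hlevel : ∀ i : Z.degrees η, ∀ x ∈ B, (∀ u ∈ x.support, (i : ℝ) ≤ ρ.pair η u) →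
      ∀ u ∈ x.support, ρ.pair η u = i → u ∈ Λ)
    (hmon : ∀ u ∈ Λ, ∃ x ∈ B, HasLeadingMonomial x u) :
    Filt.InitialForms ((ρ.etaFilt η (Z.degrees η)).comap (B := B) B.val)
      (ρ.etaGrade η (Z.degrees η) Λ) where
  ini i := (ρ.cut hη Λ i).comp B.val.toLinearMap
  ini_of_lt {i k} hik x hx :=
    ρ.cut_eq_zero_of_lt hη Λ fun u hu => lt_of_lt_of_le hik (hx u hu)
  mem_above {i} x hx h0 := by
    by_cases hx0 : (x : ρ.Series) = 0
    · rw [show x = 0 from Subtype.ext hx0]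
      exact zero_mem _
    -- `above i` requires an index beyond `i` in `η(ρ^∨ ∩ M_g)`: the least degree attained by `x`.
    -- It is not `i`, since `hlevel` makes the part of degree `i` visible to `cut`.
    obtain ⟨a, ha, hmin⟩ := ρ.exists_isMin_pair hη hx0
    have hlt : (i : ℝ) < ρ.pair η a := by
      refine lt_of_le_of_ne (hx a ha) fun h => ?_
      have hmem := hlevel i x x.2 hx a ha h.symm
      have h1 := (ρ.mem_support_coeff_cut hη (r := i) (u := ⟨a, hmem⟩)).2 ⟨h.symm, ha⟩
      rw [Finsupp.mem_support_iff] at h1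
      refine h1 ?_
      have h2 : ρ.cut hη Λ i (x : ρ.Series) = 0 := h0
      rw [h2]
      rfl
    exact Submodule.mem_iSup_of_mem ⟨ρ.pair η a, Z.pair_mem_degrees ((hB x.2).1 a ha)⟩
      (Submodule.mem_iSup_of_mem hlt hmin)
  ini_one := ρ.cut_one hη Λ
  ini_mul {i j} x hx y hy :=
    ρ.cut_mul hη hx hy (hlevel i x x.2 hx) (hlevel j y y.2 hy)
  map_eq i := by
    refine le_antisymm ?_ (ρ.etaGrade_le fun u hu => ?_)
    · rintro _ ⟨x, -, rfl⟩
      exact ρ.cut_mem_etaGrade hη i _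
    · obtain ⟨x, hx, hlead⟩ := hmon u u.2
      refine ⟨⟨x, hx⟩, fun v hv => ?_, ?_⟩
      · rw [← hu]
        exact ρ.pair_mono hη (hlead.2 v hv)
      · change ρ.cut hη Λ i x = _
        rw [← hu]
        exact ρ.cut_of_le hη u.2 hlead.2 hlead.1
  indep := ρ.etaGrade_indep _ Λ
  iSup_eq := ρ.etaGrade_iSup fun _ hu => Z.pair_mem_degrees (hΛ hu)

/-- Initial forms on `ℂ{ρ^∨ ∩ M_g}`. -/
def initialFormsBig :
    Filt.InitialForms (Z.filtBig η) (ρ.etaGrade η (Z.degrees η) Z.bigSemigroup) :=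
  Z.initialFormsOfSubalgebra hη le_rfl le_rfl (fun _ _ hx _ u hu _ => hx.1 u hu)
    fun u hu => ⟨HahnSeries.single u 1, single_mem_conv hu 1, hasLeadingMonomial_single u⟩

/-! ### Initial forms on `ℂ{ρ^∨ ∩ M}[U_1, …, U_g]` -/

theorem mem_filtU {i : Z.degrees η} {P : MvPolynomial (Fin Z.g) (ρ.conv ρ.M)} :
    P ∈ (Z.filtU η).F i ↔ ∀ v, ∀ α ∈ ((P.coeff v : ρ.conv ρ.M) : ρ.Series).support,
      (i : ℝ) ≤ ρ.pair η (α + Z.wt v) := Iff.rfl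

/-- The part of weight `j` of an element of `ℂ{ρ^∨ ∩ M}[U_1, …, U_g]`, as a function. -/
def iniUFun (j : ℝ) (P : MvPolynomial (Fin Z.g) (ρ.conv ρ.M)) :
    MvPolynomial (Fin Z.g) (AddMonoidAlgebra ℂ (ρ.semigroup ρ.M)) :=
  ∑ v ∈ P.support, MvPolynomial.monomial v
    (ρ.cut hη (ρ.semigroup ρ.M) (j - ρ.pair η (Z.wt v)) ((P.coeff v : ρ.conv ρ.M) : ρ.Series))

theorem coeff_iniUFun (j : ℝ) (P : MvPolynomial (Fin Z.g) (ρ.conv ρ.M)) (v : Fin Z.g →₀ ℕ) :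
    (Z.iniUFun hη j P).coeff v = ρ.cut hη (ρ.semigroup ρ.M) (j - ρ.pair η (Z.wt v))
      ((P.coeff v : ρ.conv ρ.M) : ρ.Series) := by
  classical
  rw [iniUFun, MvPolynomial.coeff_sum]
  simp only [MvPolynomial.coeff_monomial]
  rw [Finset.sum_ite_eq']
  split_ifs with hv
  · rfl
  · rw [MvPolynomial.notMem_support_iff.1 hv, ZeroMemClass.coe_zero, map_zero]

/-- The part of weight `j` of an element of `ℂ{ρ^∨ ∩ M}[U_1, …, U_g]`. -/
def iniU (j : ℝ) : MvPolynomial (Fin Z.g) (ρ.conv ρ.M) →ₗ[ℂ]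
    MvPolynomial (Fin Z.g) (AddMonoidAlgebra ℂ (ρ.semigroup ρ.M)) where
  toFun := Z.iniUFun hη j
  map_add' P Q := by
    refine MvPolynomial.ext _ _ fun v => ?_
    rw [MvPolynomial.coeff_add, coeff_iniUFun, coeff_iniUFun, coeff_iniUFun, MvPolynomial.coeff_add,
      ← map_add]
    rfl
  map_smul' c P := by
    refine MvPolynomial.ext _ _ fun v => ?_
    rw [RingHom.id_apply, MvPolynomial.coeff_smul, coeff_iniUFun, coeff_iniUFun,
      MvPolynomial.coeff_smul, ← map_smul]
    rfl

theorem coeff_iniU (j : ℝ) (P : MvPolynomial (Fin Z.g) (ρ.conv ρ.M)) (v : Fin Z.g →₀ ℕ) :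
    (Z.iniU hη j P).coeff v = ρ.cut hη (ρ.semigroup ρ.M) (j - ρ.pair η (Z.wt v))
      ((P.coeff v : ρ.conv ρ.M) : ρ.Series) := Z.coeff_iniUFun hη j P v

theorem support_iniU_subset (j : ℝ) (P : MvPolynomial (Fin Z.g) (ρ.conv ρ.M)) :
    (Z.iniU hη j P).support ⊆ P.support := by
  intro v hv
  rw [MvPolynomial.mem_support_iff] at hv ⊢
  intro h
  rw [coeff_iniU, h, ZeroMemClass.coe_zero, map_zero] at hv
  exact hv rfl

/-- A non-zero element of `ℂ{ρ^∨ ∩ M}[U_1, …, U_g]` has a term of least weight. -/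
theorem exists_isMin_weight (hη : η ∈ interior (ρ.cone : Set (Fin d → ℝ)))
    {P : MvPolynomial (Fin Z.g) (ρ.conv ρ.M)} (hP : P ≠ 0) :
    ∃ v, ∃ a ∈ ((P.coeff v : ρ.conv ρ.M) : ρ.Series).support, ∀ v',
      ∀ α ∈ ((P.coeff v' : ρ.conv ρ.M) : ρ.Series).support,
        ρ.pair η (a + Z.wt v) ≤ ρ.pair η (α + Z.wt v') := by
  have h : ∀ v ∈ P.support, ((P.coeff v : ρ.conv ρ.M) : ρ.Series) ≠ 0 := fun v hv h0 =>
    MvPolynomial.mem_support_iff.1 hv (Subtype.ext h0)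
  have h' : ∀ v, ∃ a, v ∈ P.support → a ∈ ((P.coeff v : ρ.conv ρ.M) : ρ.Series).support ∧
      ∀ u ∈ ((P.coeff v : ρ.conv ρ.M) : ρ.Series).support, ρ.pair η a ≤ ρ.pair η u := fun v => by
    by_cases hv : v ∈ P.support
    · obtain ⟨a, ha, ha'⟩ := ρ.exists_isMin_pair hη (h v hv)
      exact ⟨a, fun _ => ⟨ha, ha'⟩⟩
    · exact ⟨0, fun h => absurd h hv⟩
  choose a ha using h'
  obtain ⟨v, hv, hmin⟩ := Finset.exists_min_image P.support (fun v => ρ.pair η (a v + Z.wt v))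
    (MvPolynomial.support_nonempty.2 hP)
  refine ⟨v, a v, (ha v hv).1, fun v' α hα => ?_⟩
  have hv' : v' ∈ P.support := by
    rw [MvPolynomial.mem_support_iff]
    intro h0
    rw [h0] at hα
    exact hα rfl
  refine (hmin v' hv').trans ?_
  rw [map_add, map_add]
  exact add_le_add_left ((ha v' hv').2 α hα) _

theorem pair_add_wt_mem_degrees {α : ρ.Expo} (hα : α ∈ ρ.semigroup ρ.M) (v : Fin Z.g →₀ ℕ) :
    ρ.pair η (α + Z.wt v) ∈ Z.degrees η :=
  Z.pair_mem_degrees (Z.Gam_le_bigSemigroup (Z.add_wt_mem_Gam hα v))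

theorem iniU_mem_weightGrade (j : Z.degrees η) (P : MvPolynomial (Fin Z.g) (ρ.conv ρ.M)) :
    Z.iniU hη j P ∈ ρ.weightGrade Z.gamma η (Z.degrees η) j := by
  refine Submodule.sum_mem _ fun v _ => ?_
  -- The difference of degrees may be negative or not a degree at all, so the grading is indexed
  -- here by all real numbers.
  let r : (⊤ : AddSubmonoid ℝ) := ⟨j - ρ.pair η (Z.wt v), trivial⟩
  have h : ρ.etaGrade η ⊤ (ρ.semigroup ρ.M) r ≤
      (ρ.weightGrade Z.gamma η (Z.degrees η) j).comap
        ((MvPolynomial.monomial v).restrictScalars ℂ) := by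
    refine ρ.etaGrade_le fun α hα => Submodule.subset_span ⟨α, v, ?_, rfl⟩
    change ρ.pair η (α + Z.wt v) = j
    rw [map_add, hα]
    exact sub_add_cancel _ _
  exact h (ρ.cut_mem_etaGrade hη r _)

theorem iniU_monomial {α : ρ.Expo} (hα : α ∈ ρ.semigroup ρ.M) (v : Fin Z.g →₀ ℕ) :
    Z.iniU hη (ρ.pair η (α + Z.wt v))
      (MvPolynomial.monomial v ⟨HahnSeries.single α 1, single_mem_conv hα 1⟩) =
        MvPolynomial.monomial v (AddMonoidAlgebra.single ⟨α, hα⟩ 1) := by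
  classical
  refine MvPolynomial.ext _ _ fun v' => ?_
  rw [coeff_iniU, MvPolynomial.coeff_monomial, MvPolynomial.coeff_monomial]
  split_ifs with h
  · subst h
    rw [map_add, add_sub_cancel_right]
    exact ρ.cut_of_le hη hα (hasLeadingMonomial_single α).2 (hasLeadingMonomial_single α).1
  · rw [ZeroMemClass.coe_zero, map_zero]

theorem weightGrade_indep :
    iSupIndep (ρ.weightGrade Z.gamma η (Z.degrees η)) := by
  classical
  refine Filt.iSupIndep_of_coordinates (σ := (Fin Z.g →₀ ℕ) × ρ.semigroup ρ.M)
    (fun s => ((Finsupp.lapply s.2).comp (AddMonoidAlgebra.coeffLinearEquiv ℂ).toLinearMap).comp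
      ((MvPolynomial.lcoeff (AddMonoidAlgebra ℂ (ρ.semigroup ρ.M)) s.1).restrictScalars ℂ)) ?_ ?_
  · intro P hP
    refine MvPolynomial.ext _ _ fun v => ?_
    ext u
    exact hP (v, u)
  · rintro ⟨v, α⟩ i j hij
    have key : ∀ k : Z.degrees η, ρ.pair η (α + Z.wt v) ≠ k →
        ∀ P ∈ ρ.weightGrade Z.gamma η (Z.degrees η) k, (P.coeff v).coeff α = 0 := by
      intro k hk P hP
      induction hP using Submodule.span_induction with
      | mem P hP =>
        obtain ⟨β, v', h, rfl⟩ := hP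
        rw [MvPolynomial.coeff_monomial]
        split_ifs with hv
        · rw [AddMonoidAlgebra.coeff_single, Finsupp.single_apply, if_neg]
          rintro rfl
          subst hv
          exact hk h
        · rfl
      | zero => rfl
      | add P Q _ _ hP hQ =>
        rw [MvPolynomial.coeff_add, AddMonoidAlgebra.coeff_add, Finsupp.add_apply, hP, hQ, add_zero]
      | smul c P _ hP =>
        rw [MvPolynomial.coeff_smul, AddMonoidAlgebra.coeff_smul, Finsupp.smul_apply, hP, smul_zero]
    by_cases h : ρ.pair η (α + Z.wt v) = i
    · exact Or.inr (key j fun h' => hij (Subtype.ext (h.symm.trans h')))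
    · exact Or.inl (key i h)

theorem weightGrade_iSup : ⨆ j, ρ.weightGrade Z.gamma η (Z.degrees η) j = ⊤ := by
  rw [eq_top_iff]
  intro P _
  induction P using MvPolynomial.induction_on' with
  | add P Q hP hQ => exact add_mem (hP trivial) (hQ trivial)
  | monomial v b =>
    induction b using AddMonoidAlgebra.induction_linear with
    | zero =>
      rw [map_zero]
      exact zero_mem _
    | add x y hx hy =>
      rw [map_add]
      exact add_mem (hx trivial) (hy trivial)
    | single α c =>
      refine Submodule.mem_iSup_of_mem ⟨_, Z.pair_add_wt_mem_degrees α.2 v⟩ ?_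
      have h : MvPolynomial.monomial v (AddMonoidAlgebra.single α c) =
          c • MvPolynomial.monomial v (AddMonoidAlgebra.single α (1 : ℂ)) := by
        rw [MvPolynomial.smul_monomial, AddMonoidAlgebra.smul_single, smul_eq_mul, mul_one]
      rw [h]
      exact Submodule.smul_mem _ _ (Submodule.subset_span ⟨α, v, rfl, rfl⟩)

/-- Initial forms on `ℂ{ρ^∨ ∩ M}[U_1, …, U_g]`. -/
def initialFormsU :
    Filt.InitialForms (Z.filtU η) (ρ.weightGrade Z.gamma η (Z.degrees η)) where
  ini i := Z.iniU hη i
  ini_of_lt {i k} hik P hP := by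
    refine MvPolynomial.ext _ _ fun v => ?_
    rw [coeff_iniU, MvPolynomial.coeff_zero]
    refine ρ.cut_eq_zero_of_lt hη _ fun α hα => ?_
    have h1 := Z.mem_filtU.1 hP v α hα
    have h2 : (i : ℝ) < k := hik
    rw [map_add] at h1
    linarith
  mem_above {i} P hP h0 := by
    by_cases hP0 : P = 0
    · rw [hP0]
      exact zero_mem _
    obtain ⟨v, a, ha, hmin⟩ := Z.exists_isMin_weight hη hP0
    have haM := (P.coeff v).2.1 a ha
    have hlt : (i : ℝ) < ρ.pair η (a + Z.wt v) := by
      refine lt_of_le_of_ne (hP v a ha) fun h => ?_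
      have h1 := (ρ.mem_support_coeff_cut hη (r := i - ρ.pair η (Z.wt v)) (u := ⟨a, haM⟩)).2
        ⟨by rw [h, map_add, add_sub_cancel_right], ha⟩
      rw [← coeff_iniU, h0, Finsupp.mem_support_iff] at h1
      exact h1 rfl
    exact Submodule.mem_iSup_of_mem ⟨_, Z.pair_add_wt_mem_degrees haM v⟩
      (Submodule.mem_iSup_of_mem hlt hmin)
  ini_one := by
    classical
    refine MvPolynomial.ext _ _ fun v => ?_
    rw [coeff_iniU, MvPolynomial.coeff_one, MvPolynomial.coeff_one]
    split_ifs with h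
    · subst h
      rw [wt_zero, map_zero, sub_zero, OneMemClass.coe_one]
      exact ρ.cut_one hη _
    · exact map_zero (ρ.cut hη (ρ.semigroup ρ.M) _)
  ini_mul {i j} P hP Q hQ := by
    refine MvPolynomial.ext _ _ fun v => ?_
    rw [coeff_iniU, MvPolynomial.coeff_mul, MvPolynomial.coeff_mul,
      AddSubmonoidClass.coe_finsetSum, map_sum]
    refine Finset.sum_congr rfl fun x hx => ?_
    have hx' := Finset.HasAntidiagonal.mem_antidiagonal.1 hx
    -- The weight of `U^v` splits along `v = x.1 + x.2`, which reduces the claim to `cut_mul` for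
    -- the coefficients.
    have h1 : ((i + j : Z.degrees η) : ℝ) - ρ.pair η (Z.wt v) =
        (i - ρ.pair η (Z.wt x.1)) + (j - ρ.pair η (Z.wt x.2)) := by
      rw [← hx', wt_add, map_add, AddSubmonoid.coe_add]
      ring
    rw [coeff_iniU, coeff_iniU, h1]
    refine ρ.cut_mul hη (fun α hα => ?_) (fun α hα => ?_) (fun α hα _ => (P.coeff x.1).2.1 α hα)
      (fun α hα _ => (Q.coeff x.2).2.1 α hα)
    · have := Z.mem_filtU.1 hP _ α hα
      rw [map_add] at this
      linarith
    · have := Z.mem_filtU.1 hQ _ α hα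
      rw [map_add] at this
      linarith
  map_eq i := by
    refine le_antisymm ?_ (Submodule.span_le.2 ?_)
    · rintro _ ⟨P, -, rfl⟩
      exact Z.iniU_mem_weightGrade hη i P
    · rintro _ ⟨α, v, h, rfl⟩
      have h' : ρ.pair η (α + Z.wt v) = i := h
      refine ⟨MvPolynomial.monomial v ⟨HahnSeries.single (α : ρ.Expo) 1, single_mem_conv α.2 1⟩,
        ?_, ?_⟩
      · classical
        intro v' β hβ
        rw [MvPolynomial.coeff_monomial] at hβ
        split_ifs at hβ with hv
        · subst hv
          rw [Set.mem_singleton_iff.1 (HahnSeries.support_single_subset hβ)]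
          exact h.ge
        · exact absurd rfl hβ
      · have := Z.iniU_monomial hη α.2 v
        rwa [h'] at this
  indep := Z.weightGrade_indep
  iSup_eq := Z.weightGrade_iSup

end Branch

/-! ### Change of the exponent semigroup and dimensions of homogeneous components -/

namespace ToricCone
variable {d : ℕ} (ρ : ToricCone d)
  {η : Fin d → ℝ} (hη : η ∈ interior (ρ.cone : Set (Fin d → ℝ)))

theorem coeff_mapDomain_inclusion {Λ Λ' : AddSubmonoid ρ.Expo} (h : Λ ≤ Λ')
    (x : AddMonoidAlgebra ℂ Λ) (u : Λ) :
    (AddMonoidAlgebra.mapDomainAlgHom ℂ ℂ (AddSubmonoid.inclusion h) x).coeff ⟨u, h u.2⟩ =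
      x.coeff u :=
  Finsupp.mapDomain_apply (AddSubmonoid.inclusion_injective h) x.coeff u

theorem coeff_mapDomain_inclusion_of_notMem {Λ Λ' : AddSubmonoid ρ.Expo} (h : Λ ≤ Λ')
    (x : AddMonoidAlgebra ℂ Λ) {u : Λ'} (hu : (u : ρ.Expo) ∉ Λ) :
    (AddMonoidAlgebra.mapDomainAlgHom ℂ ℂ (AddSubmonoid.inclusion h) x).coeff u = 0 := by
  refine Finsupp.mapDomain_of_notMem_range x.coeff u ?_
  rintro ⟨v, rfl⟩
  exact hu v.2

theorem cut_eq_mapDomain {Λ Λ' : AddSubmonoid ρ.Expo} (h : Λ ≤ Λ') {r : ℝ} {φ : ρ.Series}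
    (hφ : ∀ u ∈ φ.support, ρ.pair η u = r → u ∈ Λ) : ρ.cut hη Λ' r φ =
      AddMonoidAlgebra.mapDomainAlgHom ℂ ℂ (AddSubmonoid.inclusion h) (ρ.cut hη Λ r φ) := by
  classical
  ext u
  by_cases hu : (u : ρ.Expo) ∈ Λ
  · exact (ρ.coeff_mapDomain_inclusion h (ρ.cut hη Λ r φ) ⟨u, hu⟩).symm
  · rw [ρ.coeff_mapDomain_inclusion_of_notMem h _ hu]
    by_contra h0
    obtain ⟨h1, h2⟩ := (ρ.mem_support_coeff_cut hη).1 (Finsupp.mem_support_iff.2 h0)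
    exact hu (hφ _ h2 h1)

/-- The component of degree `j` is non-zero iff `j` is the degree of an element of `Λ`. -/
theorem nontrivial_etaGrade_iff {S : AddSubmonoid ℝ} {Λ : AddSubmonoid ρ.Expo} {j : S} :
    Nontrivial (ρ.etaGrade η S Λ j) ↔ ∃ u ∈ Λ, ρ.pair η u = j := by
  rw [Submodule.nontrivial_iff_ne_bot]
  constructor
  · intro h
    by_contra! hne
    exact h (le_bot_iff.1 (ρ.etaGrade_le fun u hu => absurd hu (hne u u.2)))
  · rintro ⟨u, hu, hj⟩ h
    have h1 : AddMonoidAlgebra.single (⟨u, hu⟩ : Λ) (1 : ℂ) ∈ ρ.etaGrade η S Λ j := by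
      have := AddMonoidAlgebra.single_mem_gradeBy (fun u : Λ => ρ.pair η u) ⟨u, hu⟩ (1 : ℂ)
      rwa [hj] at this
    rw [h, Submodule.mem_bot] at h1
    have h2 := congrArg (fun x => x.coeff ⟨u, hu⟩) h1
    simp at h2

theorem etaGrade_le_span {S : AddSubmonoid ℝ} {Λ : AddSubmonoid ρ.Expo}
    (hinj : ∀ u ∈ Λ, ∀ v ∈ Λ, ρ.pair η u = ρ.pair η v → u = v) {j : S} {u : ρ.Expo} (hu : u ∈ Λ)
    (hj : ρ.pair η u = j) : ρ.etaGrade η S Λ j ≤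
      Submodule.span ℂ {AddMonoidAlgebra.single (⟨u, hu⟩ : Λ) (1 : ℂ)} := by
  refine ρ.etaGrade_le fun v hv => ?_
  have : v = ⟨u, hu⟩ := Subtype.ext (hinj v v.2 u hu (hv.trans hj.symm))
  rw [this]
  exact Submodule.mem_span_singleton_self _

theorem rank_etaGrade_le_one {S : AddSubmonoid ℝ} {Λ : AddSubmonoid ρ.Expo}
    (hinj : ∀ u ∈ Λ, ∀ v ∈ Λ, ρ.pair η u = ρ.pair η v → u = v) (j : S) :
    Module.rank ℂ (ρ.etaGrade η S Λ j) ≤ 1 := by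
  rw [rank_submodule_le_one_iff']
  by_cases h : ∃ u ∈ Λ, ρ.pair η u = j
  · obtain ⟨u, hu, hj⟩ := h
    exact ⟨_, ρ.etaGrade_le_span hinj hu hj⟩
  · exact ⟨0, ρ.etaGrade_le fun u hu => absurd ⟨u, u.2, hu⟩ h⟩

theorem rank_etaGrade_eq_one {S : AddSubmonoid ℝ} {Λ : AddSubmonoid ρ.Expo}
    (hinj : ∀ u ∈ Λ, ∀ v ∈ Λ, ρ.pair η u = ρ.pair η v → u = v) {j : S}
    (hj : ∃ u ∈ Λ, ρ.pair η u = j) : Module.rank ℂ (ρ.etaGrade η S Λ j) = 1 := by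
  refine le_antisymm (ρ.rank_etaGrade_le_one hinj j) (Cardinal.one_le_iff_ne_zero.2 ?_)
  have := ρ.nontrivial_etaGrade_iff.2 hj
  exact rank_pos.ne'

end ToricCone

namespace Branch
variable {d : ℕ} {ρ : ToricCone d} {Z : Branch ρ}

open ToricCone

theorem R_le_bigRing : Z.R ≤ Z.bigRing := by
  intro x hx
  have h : x ∈ Algebra.adjoin (ρ.conv ρ.M) ({Z.ζ} : Set ρ.Series) := hx
  rw [Algebra.adjoin_singleton_eq_range_aeval] at h
  obtain ⟨P, rfl⟩ := h
  change Polynomial.aeval Z.ζ P ∈ Z.bigRing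
  rw [Polynomial.aeval_eq_sum_range]
  refine sum_mem fun i _ => ?_
  rw [Algebra.smul_def]
  exact mul_mem (conv_mono (Z.M_le_lattice _) (P.coeff i).2) (pow_mem Z.ζ_mem_bigRing i)

variable {q : Fin Z.g → ρ.Poly} {η : Fin d → ℝ}

/-! ### The homomorphism `Ψ₀` and initial forms -/

variable (q) in
/-- The value of the monomial `U^v` at the semi-roots. -/
def semiRootMonomial (v : Fin Z.g →₀ ℕ) : ρ.Series := ∏ i, Polynomial.aeval Z.ζ (q i) ^ v i

theorem coe_Psi (P : MvPolynomial (Fin Z.g) (ρ.conv ρ.M)) : (Z.Psi q P : ρ.Series) =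
    ∑ v ∈ P.support, ((P.coeff v : ρ.conv ρ.M) : ρ.Series) * semiRootMonomial q v := by
  change MvPolynomial.aeval (fun j => Polynomial.aeval Z.ζ (q j)) P = _
  rw [MvPolynomial.aeval_def, MvPolynomial.eval₂_eq']
  rfl

/-- The normalization enters here: otherwise the graded map would be the monomial map only up to a
scalar for each `U_j`. -/
theorem hasLeadingMonomial_semiRootMonomial (hq : ∀ j, Z.IsSemiRoot j (q j))
    (hnorm : ∀ j, (Polynomial.aeval Z.ζ (q j)).coeff (Z.gamma j) = 1)
    (v : Fin Z.g →₀ ℕ) :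
    HasLeadingMonomial (semiRootMonomial q v) (Z.wt v) :=
  HasLeadingMonomial.prod _ fun i _ => HasLeadingMonomial.pow ⟨hnorm i, (hq i).hasOrder.2⟩ (v i)

theorem isFiltered_Psi (hq : ∀ j, Z.IsSemiRoot j (q j))
    (hnorm : ∀ j, (Polynomial.aeval Z.ζ (q j)).coeff (Z.gamma j) = 1)
    (hη : η ∈ interior (ρ.cone : Set (Fin d → ℝ))) :
    Filt.IsFiltered (Z.filtU η) (Z.filtR η) (Z.Psi q) := by
  intro i P hP u hu
  change u ∈ ((Z.Psi q P : Z.R) : ρ.Series).support at hu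
  have : ∃ v ∈ P.support, u ∈ (((P.coeff v : ρ.conv ρ.M) : ρ.Series) *
      semiRootMonomial q v).support := by
    by_contra! hcon
    refine hu ?_
    rw [coe_Psi, HahnSeries.coeff_sum]
    exact Finset.sum_eq_zero fun v hv => not_not.1 (hcon v hv)
  obtain ⟨v, -, hv⟩ := this
  obtain ⟨a, ha, b, hb, rfl⟩ := HahnSeries.support_mul_subset hv
  have h1 := Z.mem_filtU.1 hP v a ha
  have h2 := ρ.pair_mono hη ((hasLeadingMonomial_semiRootMonomial hq hnorm v).2 b hb)
  rw [map_add] at h1 ⊢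
  linarith

variable (Z) in
theorem semigroup_le_Gam : ρ.semigroup ρ.M ≤ Z.Gam := le_sup_left

theorem monomialMap_monomial (v : Fin Z.g →₀ ℕ) (b : AddMonoidAlgebra ℂ (ρ.semigroup ρ.M)) :
    Z.monomialMap (MvPolynomial.monomial v b) =
      AddMonoidAlgebra.mapDomainAlgHom ℂ ℂ
        (AddSubmonoid.inclusion Z.semigroup_le_Gam) b *
          AddMonoidAlgebra.single ⟨Z.wt v, Z.wt_mem_Gam v⟩ 1 := by
  rw [MvPolynomial.monomial_eq, map_mul, Finsupp.prod_fintype _ _ (fun i => pow_zero _), map_prod]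
  congr 1
  · exact MvPolynomial.aevalTower_C _ _ b
  · have h : ∀ i, Z.monomialMap (MvPolynomial.X i ^ v i) =
        AddMonoidAlgebra.single (v i • ⟨Z.gamma i, Z.gamma_mem_Gam i⟩ : Z.Gam) 1 := fun i => by
      rw [map_pow, monomialMap, MvPolynomial.aevalTower_X, AddMonoidAlgebra.single_pow, one_pow]
    rw [Finset.prod_congr rfl fun i _ => h i, prod_addMonoidAlgebra_single]
    congr 1
    refine Subtype.ext ?_
    rw [AddSubmonoidClass.coe_finsetSum]
    rfl

/-- On monomials with exponents `v_i < n_i` the map to `ℂ[Γ]` is injective. -/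
theorem coeff_monomialMap_monomial {v v' : Fin Z.g →₀ ℕ} (hv : ∀ k, v k < Z.charInt k)
    (hv' : ∀ k, v' k < Z.charInt k) (b : AddMonoidAlgebra ℂ (ρ.semigroup ρ.M))
    (α : ρ.semigroup ρ.M) [Decidable (v' = v)] :
    (Z.monomialMap (MvPolynomial.monomial v' b)).coeff ⟨α + Z.wt v, Z.add_wt_mem_Gam α.2 v⟩ =
      if v' = v then b.coeff α else 0 := by
  classical
  induction b using AddMonoidAlgebra.induction_linear with
  | zero => simp
  | add x y hx hy =>
    rw [map_add, map_add, AddMonoidAlgebra.coeff_add, AddMonoidAlgebra.coeff_add, Finsupp.add_apply,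
      Finsupp.add_apply, hx, hy]
    split_ifs
    · rfl
    · rw [add_zero]
  | single β c =>
    have h1 : AddMonoidAlgebra.mapDomainAlgHom ℂ ℂ
        (AddSubmonoid.inclusion Z.semigroup_le_Gam)
          (AddMonoidAlgebra.single β c) = AddMonoidAlgebra.single
            (AddSubmonoid.inclusion Z.semigroup_le_Gam β) c :=
      AddMonoidAlgebra.mapDomain_single
    rw [monomialMap_monomial, h1, AddMonoidAlgebra.single_mul_single, mul_one,
      AddMonoidAlgebra.coeff_single, AddMonoidAlgebra.coeff_single, Finsupp.single_apply,
      Finsupp.single_apply, ← ite_and]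
    refine if_congr ?_ rfl rfl
    rw [Subtype.ext_iff]
    change (β : ρ.Expo) + Z.wt v' = α + Z.wt v ↔ _
    constructor
    · intro h
      have := Z.eq_of_add_wt_eq hv' hv β.2.2 α.2.2 h
      subst this
      exact ⟨rfl, Subtype.ext (add_right_cancel h)⟩
    · rintro ⟨rfl, rfl⟩
      rfl

/-- In the box an exponent of `Γ` comes from at most one pair `(α, v)`, so no cancellation occurs
and coefficients can be read off the image. -/
theorem coeff_monomialMap {P : MvPolynomial (Fin Z.g) (AddMonoidAlgebra ℂ (ρ.semigroup ρ.M))}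
    (hP : ∀ v ∈ P.support, ∀ k, v k < Z.charInt k) {v : Fin Z.g →₀ ℕ}
    (hv : ∀ k, v k < Z.charInt k) (α : ρ.semigroup ρ.M) :
    (Z.monomialMap P).coeff ⟨α + Z.wt v, Z.add_wt_mem_Gam α.2 v⟩ = (P.coeff v).coeff α := by
  classical
  conv_lhs => rw [← MvPolynomial.support_sum_monomial_coeff P]
  rw [map_sum, AddMonoidAlgebra.coeff_sum, Finsupp.finsetSum_apply,
    Finset.sum_congr rfl fun v' hv' => coeff_monomialMap_monomial hv (hP v' hv') (P.coeff v') α,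
    Finset.sum_ite_eq']
  split_ifs with h
  · rfl
  · rw [MvPolynomial.notMem_support_iff.1 h]
    rfl

/-- The initial form of `Ψ₀(P)` is the image of the initial form of `P`. -/
theorem cut_Psi (hq : ∀ j, Z.IsSemiRoot j (q j))
    (hnorm : ∀ j, (Polynomial.aeval Z.ζ (q j)).coeff (Z.gamma j) = 1)
    (hη : η ∈ interior (ρ.cone : Set (Fin d → ℝ)))
    {Λ : AddSubmonoid ρ.Expo} (hΛ : Z.Gam ≤ Λ) {i : Z.degrees η}
    {P : MvPolynomial (Fin Z.g) (ρ.conv ρ.M)} (hP : P ∈ (Z.filtU η).F i) :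
    ρ.cut hη Λ i (Z.Psi q P : ρ.Series) =
      AddMonoidAlgebra.mapDomainAlgHom ℂ ℂ (AddSubmonoid.inclusion hΛ)
        (Z.monomialMap (Z.iniU hη i P)) := by
  have hdef : Z.iniU hη i P = Z.iniUFun hη i P := rfl
  rw [coe_Psi, map_sum, hdef, iniUFun, map_sum, map_sum]
  refine Finset.sum_congr rfl fun v _ => ?_
  have hlead := hasLeadingMonomial_semiRootMonomial hq hnorm v
  have hM : ∀ u ∈ ((P.coeff v : ρ.conv ρ.M) : ρ.Series).support, u ∈ ρ.semigroup ρ.M :=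
    (P.coeff v).2.1
  have hle := Z.semigroup_le_Gam
  -- Each term is a product, so its degree is split between the coefficient and the semi-root
  -- monomial in order to apply `cut_mul`.
  have h1 : (i : ℝ) = (i - ρ.pair η (Z.wt v)) + ρ.pair η (Z.wt v) := (sub_add_cancel _ _).symm
  rw [monomialMap_monomial,
    map_mul (AddMonoidAlgebra.mapDomainAlgHom ℂ ℂ (AddSubmonoid.inclusion hΛ))]
  conv_lhs => rw [h1]
  rw [ρ.cut_mul hη (fun u hu => ?_) (fun u hu => ρ.pair_mono hη (hlead.2 u hu))
    (fun u hu _ => hΛ (hle (hM u hu))) (fun u hu h => ?_),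
    ρ.cut_of_le hη (hΛ (Z.wt_mem_Gam v)) hlead.2 hlead.1,
    ρ.cut_eq_mapDomain hη (hle.trans hΛ) fun u hu _ => hM u hu]
  · congr 1
    · have h2 : AddSubmonoid.inclusion (hle.trans hΛ) =
          (AddSubmonoid.inclusion hΛ).comp (AddSubmonoid.inclusion hle) := rfl
      rw [h2, AddMonoidAlgebra.mapDomainAlgHom_comp]
      rfl
    · exact (AddMonoidAlgebra.mapDomain_single (R := ℂ) (r := 1) (f := AddSubmonoid.inclusion hΛ)
      (a := ⟨Z.wt v, Z.wt_mem_Gam v⟩)).symm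
  · have := Z.mem_filtU.1 hP v u hu
    rw [map_add] at this
    linarith
  · rw [← ρ.eq_of_le_of_pair_le hη (hlead.2 u hu) h.le]
    exact hΛ (Z.wt_mem_Gam v)

/-- `Ψ₀` is strict on the elements with exponents `v_i < n_i`. -/
theorem mem_filtU_of_Psi_mem (hq : ∀ j, Z.IsSemiRoot j (q j))
    (hnorm : ∀ j, (Polynomial.aeval Z.ζ (q j)).coeff (Z.gamma j) = 1)
    (hη : η ∈ interior (ρ.cone : Set (Fin d → ℝ)))
    {i : Z.degrees η} {Q : MvPolynomial (Fin Z.g) (ρ.conv ρ.M)}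
    (hQ : ∀ v ∈ Q.support, ∀ k, v k < Z.charInt k)
    (h : ∀ u ∈ (Z.Psi q Q : ρ.Series).support, (i : ℝ) ≤ ρ.pair η u) : Q ∈ (Z.filtU η).F i := by
  by_cases hQ0 : Q = 0
  · rw [hQ0]
    exact zero_mem _
  obtain ⟨v, a, ha, hmin⟩ := Z.exists_isMin_weight hη hQ0
  have haM := (Q.coeff v).2.1 a ha
  -- `j` is the least weight in `Q`. If `j < i`, the part of `Ψ₀(Q)` of degree `j` vanishes,
  -- although it is the image of a non-zero form supported in the box.
  set j : Z.degrees η := ⟨_, Z.pair_add_wt_mem_degrees haM v⟩ with hj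
  have hQj : Q ∈ (Z.filtU η).F j := hmin
  by_contra hnot
  have hlt : (j : ℝ) < i := by
    by_contra hle
    exact hnot ((Z.filtU η).anti (not_lt.1 hle : i ≤ j) hQj)
  have h1 := cut_Psi hq hnorm hη le_rfl hQj
  rw [ρ.cut_eq_zero_of_lt hη _ fun u hu => hlt.trans_le (h u hu)] at h1
  have h2 : Z.monomialMap (Z.iniU hη j Q) = 0 := by
    refine AddMonoidAlgebra.mapDomain_injective (AddSubmonoid.inclusion_injective le_rfl) ?_
    rw [AddMonoidAlgebra.mapDomain_zero]
    exact h1.symm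
  have hv : v ∈ Q.support := by
    rw [MvPolynomial.mem_support_iff]
    intro h0
    rw [h0] at ha
    exact ha rfl
  have h3 := coeff_monomialMap (fun v' hv' => hQ v' (Z.support_iniU_subset hη j Q hv')) (hQ v hv)
    ⟨a, haM⟩
  rw [h2, coeff_iniU] at h3
  refine Finsupp.mem_support_iff.1 ((ρ.mem_support_coeff_cut hη (u := ⟨a, haM⟩)).2 ⟨?_, ha⟩) h3.symm
  rw [hj]
  change _ = ρ.pair η (a + Z.wt v) - _
  rw [map_add, add_sub_cancel_right]

/-- The leading exponents of the elements of `R` belong to `Γ`. -/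
theorem level_mem_Gam (hq : ∀ j, Z.IsSemiRoot j (q j))
    (hnorm : ∀ j, (Polynomial.aeval Z.ζ (q j)).coeff (Z.gamma j) = 1)
    (hη : η ∈ interior (ρ.cone : Set (Fin d → ℝ)))
    (i : Z.degrees η) (x : ρ.Series) (hx : x ∈ Z.R)
    (h : ∀ u ∈ x.support, (i : ℝ) ≤ ρ.pair η u) :
    ∀ u ∈ x.support, ρ.pair η u = i → u ∈ Z.Gam := by
  intro u hu hui
  -- By strictness `Q` lies in the `i`-th term of the weighted filtration. So the degree `i` part of
  -- `x` is the image of an initial form of `Q` in `ℂ[Γ]` and has no exponent outside `Γ`.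
  obtain ⟨Q, hQ, hQx⟩ := exists_box_expansion hq ⟨x, hx⟩
  have hQx' : (Z.Psi q Q : ρ.Series) = x := congrArg Subtype.val hQx
  rw [← hQx'] at h
  have hc := cut_Psi hq hnorm hη Z.Gam_le_bigSemigroup (mem_filtU_of_Psi_mem hq hnorm hη hQ h)
  rw [hQx'] at hc
  by_contra hnot
  have hub : u ∈ Z.bigSemigroup := (R_le_bigRing hx).1 u hu
  have h1 := (ρ.mem_support_coeff_cut hη (r := i) (u := ⟨u, hub⟩)).2 ⟨hui, hu⟩
  rw [hc, Finsupp.mem_support_iff] at h1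
  exact h1 (ρ.coeff_mapDomain_inclusion_of_notMem _ _ hnot)

theorem conv_M_le_R : ρ.conv ρ.M ≤ Z.R := fun x hx =>
  Subalgebra.algebraMap_mem (Algebra.adjoin (ρ.conv ρ.M) ({Z.ζ} : Set ρ.Series)) ⟨x, hx⟩

theorem exists_mem_R_hasLeadingMonomial (hq : ∀ j, Z.IsSemiRoot j (q j))
    (hnorm : ∀ j, (Polynomial.aeval Z.ζ (q j)).coeff (Z.gamma j) = 1)
    {u : ρ.Expo} (hu : u ∈ Z.Gam) :
    ∃ x ∈ Z.R, HasLeadingMonomial x u := by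
  obtain ⟨α, hα, v, rfl⟩ := Z.exists_eq_add_wt hu
  refine ⟨HahnSeries.single α 1 * semiRootMonomial q v,
    mul_mem (conv_M_le_R (single_mem_conv hα 1)) (prod_mem fun i _ => pow_mem ?_ _),
    (hasLeadingMonomial_single α).mul (hasLeadingMonomial_semiRootMonomial hq hnorm v)⟩
  exact Polynomial.aeval_mem_adjoin_singleton (ρ.conv ρ.M) Z.ζ

/-- Initial forms on `R`. -/
def initialFormsR (hq : ∀ j, Z.IsSemiRoot j (q j))
    (hnorm : ∀ j, (Polynomial.aeval Z.ζ (q j)).coeff (Z.gamma j) = 1)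
    (hη : η ∈ interior (ρ.cone : Set (Fin d → ℝ))) :
    Filt.InitialForms (Z.filtR η) (ρ.etaGrade η (Z.degrees η) Z.Gam) :=
  Z.initialFormsOfSubalgebra hη R_le_bigRing Z.Gam_le_bigSemigroup (level_mem_Gam hq hnorm hη)
    fun _ hu => exists_mem_R_hasLeadingMonomial hq hnorm hu

/-! ### Irrational weights -/

/-- An irrational weight is injective on `M_g`. -/
theorem eq_of_pair_eq (hirr : LinearIndependent ℚ η) {u v : ρ.Expo} (hu : u ∈ Z.bigSemigroup)
    (hv : v ∈ Z.bigSemigroup) (h : ρ.pair η u = ρ.pair η v) : u = v := by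
  have hw : u - v ∈ ρ.fracM Z.f.natDegree := Z.lattice_le_fracM _ (sub_mem hu.2 hv.2)
  have hn : (Z.f.natDegree : ℝ) ≠ 0 := Nat.cast_ne_zero.2 Z.natDegree_pos.ne'
  choose m hm using ρ.mem_M_iff.1 (show Z.f.natDegree • (u - v) ∈ ρ.M from hw)
  have hm' : ∀ i, (Z.f.natDegree : ℝ) * (show Fin d → ℝ from (u - v)) i = m i := fun i => by
    rw [← hm i, ← nsmul_eq_mul]
    rfl
  -- Multiplication by `n` makes `u - v` integral, so equal degrees give a rational linear relation
  -- between the coordinates of `η`.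
  have h0 : ∑ i, (m i : ℚ) • η i = 0 := by
    have h1 : ρ.pair η (u - v) = 0 := by rw [map_sub, h, sub_self]
    have h2 : ∑ i, η i * (show Fin d → ℝ from (u - v)) i = 0 := h1
    have h3 := congrArg (fun x : ℝ => (Z.f.natDegree : ℝ) * x) h2
    simp only [Finset.mul_sum, mul_zero] at h3
    rw [← h3]
    refine Finset.sum_congr rfl fun i _ => ?_
    rw [Rat.smul_def, Rat.cast_intCast, ← hm' i]
    ring
  have h4 := Fintype.linearIndependent_iff.1 hirr (fun i => (m i : ℚ)) h0
  rw [← sub_eq_zero]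
  funext i
  have h5 : m i = 0 := by exact_mod_cast h4 i
  have h6 := hm' i
  rw [h5, Int.cast_zero] at h6
  exact (mul_eq_zero.1 h6).resolve_left hn

end Branch

end ToricQO

end

/-! ### The associated graded sequence and the case of irrational weights -/

theorem mainTheorem7 {d : ℕ} (ρ : ToricQO.ToricCone d) (Z : ToricQO.Branch ρ)
    (q : Fin Z.g → ρ.Poly) (hq : ∀ j, Z.IsSemiRoot j (q j))
    (hnorm : ∀ j, (Polynomial.aeval Z.ζ (q j)).coeff (Z.gamma j) = 1)
    (η : Fin d → ℝ) (hη : η ∈ interior (ρ.cone : Set (Fin d → ℝ))) :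
    ∃ (hR : Z.R ≤ Z.bigRing) (hΓ : Z.Gam ≤ Z.bigSemigroup)
      (hΨ : ToricQO.Filt.IsFiltered (Z.filtU η) (Z.filtR η) (Z.Psi q))
      (hι : ToricQO.Filt.IsFiltered (Z.filtR η) (Z.filtBig η) (Subalgebra.inclusion hR)),
      (∃ (e₁ : (Z.filtU η).Gr ≃ₐ[ℂ]
            MvPolynomial (Fin Z.g) (AddMonoidAlgebra ℂ (ρ.semigroup ρ.M)))
          (e₂ : (Z.filtR η).Gr ≃ₐ[ℂ] AddMonoidAlgebra ℂ Z.Gam)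
          (e₃ : (Z.filtBig η).Gr ≃ₐ[ℂ] AddMonoidAlgebra ℂ Z.bigSemigroup),
        (Z.filtU η).IsGradedEquiv (ρ.weightGrade Z.gamma η (Z.degrees η)) e₁ ∧
        (Z.filtR η).IsGradedEquiv (ρ.etaGrade η (Z.degrees η) Z.Gam) e₂ ∧
        (Z.filtBig η).IsGradedEquiv (ρ.etaGrade η (Z.degrees η) Z.bigSemigroup) e₃ ∧
        (e₂ : (Z.filtR η).Gr →ₐ[ℂ] AddMonoidAlgebra ℂ Z.Gam).comp
            (ToricQO.Filt.grMap (Z.filtU η) (Z.filtR η) (Z.Psi q) hΨ) =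
          Z.monomialMap.comp (e₁ : (Z.filtU η).Gr →ₐ[ℂ] _) ∧
        (e₃ : (Z.filtBig η).Gr →ₐ[ℂ] AddMonoidAlgebra ℂ Z.bigSemigroup).comp
            (ToricQO.Filt.grMap (Z.filtR η) (Z.filtBig η) (Subalgebra.inclusion hR) hι) =
          (AddMonoidAlgebra.mapDomainAlgHom ℂ ℂ (AddSubmonoid.inclusion hΓ)).comp
            (e₂ : (Z.filtR η).Gr →ₐ[ℂ] _)) ∧
      (LinearIndependent ℚ η →
        (∀ j, Module.rank ℂ ((Z.filtBig η).Piece j) = 1) ∧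
        (∀ j, Module.rank ℂ ((Z.filtR η).Piece j) ≤ 1) ∧
        Function.Injective (Z.deg η) ∧
        (∀ u : Z.bigSemigroup, (u : ρ.Expo) ∈ Z.Gam ↔ Nontrivial ((Z.filtR η).Piece (Z.deg η u))) ∧
        ∃ D : AddSubmonoid (Z.degrees η), (∀ j, j ∈ D ↔ Nontrivial ((Z.filtR η).Piece j)) ∧
          ∃ e : Z.Gam ≃+ D, ∀ u, ((e u : Z.degrees η) : ℝ) = ρ.pair η u) := by
  have hΓ := Z.Gam_le_bigSemigroup
  -- Both filtrations are induced from the same filtration of the ring of series.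
  have hι : ToricQO.Filt.IsFiltered (Z.filtR η) (Z.filtBig η)
      (Subalgebra.inclusion ToricQO.Branch.R_le_bigRing) := fun _ _ hx => hx
  refine ⟨ToricQO.Branch.R_le_bigRing, hΓ, ToricQO.Branch.isFiltered_Psi hq hnorm hη, hι, ?_, ?_⟩
  · refine ⟨(Z.initialFormsU hη).grEquiv, (ToricQO.Branch.initialFormsR hq hnorm hη).grEquiv,
      (Z.initialFormsBig hη).grEquiv, (Z.initialFormsU hη).isGradedEquiv,
      (ToricQO.Branch.initialFormsR hq hnorm hη).isGradedEquiv,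
      (Z.initialFormsBig hη).isGradedEquiv, ?_, ?_⟩
    · refine ToricQO.Filt.InitialForms.grEquiv_comp_grMap _ _ _ _ _ fun i P hP => ?_
      have h := ToricQO.Branch.cut_Psi hq hnorm hη le_rfl hP
      refine Eq.trans h ?_
      -- `cut_Psi` is used with target `Γ` itself, where the inclusion is the identity.
      have hid : AddSubmonoid.inclusion (le_refl Z.Gam) = AddMonoidHom.id _ := rfl
      rw [hid, AddMonoidAlgebra.mapDomainAlgHom_id]
      rfl
    · refine ToricQO.Filt.InitialForms.grEquiv_comp_grMap _ _ _ _ _ fun i x hx => ?_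
      exact ρ.cut_eq_mapDomain hη hΓ (ToricQO.Branch.level_mem_Gam hq hnorm hη i x x.2 hx)
  · intro hirr
    have hinj : ∀ u ∈ Z.bigSemigroup, ∀ v ∈ Z.bigSemigroup, ρ.pair η u = ρ.pair η v → u = v :=
      fun u hu v hv h => ToricQO.Branch.eq_of_pair_eq hirr hu hv h
    -- Non-vanishing components of `gr R` are those whose degree is attained on `Γ`; injectivity of
    -- `η` then recovers the element of `Γ` from its degree.
    have hnt : ∀ j, Nontrivial ((Z.filtR η).Piece j) ↔ ∃ u ∈ Z.Gam, ρ.pair η u = j := fun j => by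
      rw [((ToricQO.Branch.initialFormsR hq hnorm hη).pieceEquiv j).toEquiv.nontrivial_congr]
      exact ρ.nontrivial_etaGrade_iff
    refine ⟨fun j => ?_, fun j => ?_, fun u v h => ?_, fun u => ?_, ?_⟩
    · rw [((Z.initialFormsBig hη).pieceEquiv j).rank_eq]
      exact ρ.rank_etaGrade_eq_one hinj j.2
    · rw [((ToricQO.Branch.initialFormsR hq hnorm hη).pieceEquiv j).rank_eq]
      exact ρ.rank_etaGrade_le_one (fun u hu v hv => hinj u (hΓ hu) v (hΓ hv)) j
    · exact Subtype.ext (hinj u u.2 v v.2 (congrArg Subtype.val h))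
    · rw [hnt]
      refine ⟨fun hu => ⟨u, hu, rfl⟩, ?_⟩
      rintro ⟨v, hv, h⟩
      rwa [← hinj v (hΓ hv) u u.2 h]
    · let δ : Z.Gam →+ Z.degrees η :=
        { toFun := fun u => ⟨ρ.pair η u, Z.pair_mem_degrees (hΓ u.2)⟩
          map_zero' := Subtype.ext (map_zero (ρ.pair η))
          map_add' := fun u v => Subtype.ext (map_add (ρ.pair η) (u : ρ.Expo) v) }
      refine ⟨AddMonoidHom.mrange δ, fun j => ?_, AddEquiv.ofBijective δ.mrangeRestrict ⟨?_, ?_⟩,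
        fun u => rfl⟩
      · rw [hnt]
        constructor
        · rintro ⟨u, rfl⟩
          exact ⟨u, u.2, rfl⟩
        · rintro ⟨u, hu, h⟩
          exact ⟨⟨u, hu⟩, Subtype.ext h⟩
      · intro u v h
        exact Subtype.ext (hinj u (hΓ u.2) v (hΓ v.2)
          (congrArg (fun x : AddMonoidHom.mrange δ => ((x : Z.degrees η) : ℝ)) h))
      · exact AddMonoidHom.mrangeRestrict_surjective δ
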